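/- **Definitions.** A *1-flow category* $\mathscr C$ consists of a finite set $\mathrm{Ob}(\mathscr C)$, a grading $|\cdot|\colon \mathrm{Ob}(\mathscr C)\to\mathbb Z$, and, for all objects $a,b$ with $|a|-|b|\in\{1,2\}$, a compact manifold with boundary $\mathcal M(a,b)$ of dimension $|a|-|b|-1$, such that $\partial\mathcal M(a,c)=\coprod_{|b|=|a|-1}\mathcal M(b,c)\times\mathcal M(a,b)$ whenever $|a|-|c|=2$. The components of $\mathcal M(a,c)$ are then intervals and circles. If $|a|-|d|=3$, let $\partial\mathcal M(a,d)$ be the union of $\coprod_{|b|=|a|-1}\mathcal M(b,d)\times\mathcal M(a,b)$ and $\coprod_{|c|=|a|-2}\mathcal M(c,d)\times\mathcal M(a,c)$, glued along their common subset $\coprod_{b,c}\mathcal M(c,d)\times\mathcal M(b,c)\times\mathcal M(a,b)$. A *sign assignment* gives every point $P$ of a $0$-dimensional moduli space a sign $s(P)\in\mathbb Z/2$ such that $s(P_1)+s(Q_1)+s(P_2)+s(Q_2)=1\in\mathbb Z/2$ whenever $(P_1,Q_1),(P_2,Q_2)$ are the two end points of an interval component of some $\mathcal M(a,c)$. A *pre-framing*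 gives every component $C$ of a $1$-dimensional moduli space a value $f(C)\in\mathbb Z/2$. For a component $C$ of $\partial\mathcal M(a,d)$, $|a|-|d|=3$, put $\tilde f(C)=1+f(S^1)$ if $C=\{P\}\times S^1$ or $C=S^1\times\{Q\}$ with $S^1$ a circle component, and otherwise $\tilde f(C)=\sum f(I)+\sum(1+s(P)+f(J))$, the sums being over the intervals $I\times\{Q\}\subset\mathcal M(b,d)\times\mathcal M(a,b)$, respectively $\{P\}\times J\subset\mathcal M(c,d)\times\mathcal M(a,c)$, contained in $C$. The triple $(\mathscr C,s,f)$ is a *framed 1-flow category* if $\sum_C(1+\tilde f(C))=0\in\mathbb Z/2$ for all $a,d$ with $|a|-|d|=3$, the sum being over all components of $\partial\mathcal M(a,d)$. Put $[a:b]=\sum_{A\in\mathcal M(a,b)}(-1)^{s(A)}$ for $|a|=|b|+1$. Let $C^k(\mathscr C;\mathbb Z/2)$ be the space of functions from the objects of degree $k$ to $\mathbb Z/2$, with $(\delta\varphi)(a)=\sum_b[a:b]\varphi(b)$; its cohomology is $H^k(\mathscr C;\mathbb Z/2)$. A *special graph structure* $\Gamma$ consists of finite sets $V$ (vertices), $E$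 (edges, each with a two-element set of end points in $V$; two edges may have the same end points) and $L$ (loops), signs $s\colon V\to\mathbb Z/2$, a subset $E'\subset E$ with $f\colon E'\to\mathbb Z/2$, and a subset $E''\subset E\setminus E'$ of edges each directed towards one of its end points, such that: every vertex lies in one or two edges; a vertex in only one edge (a boundary point) lies in an edge of $E'$, and every other vertex lies in an edge of $E'$ and in an edge of $E\setminus E'$; the end points of an edge of $E'$ have different signs; the end points of an edge of $E\setminus E'$ have equal signs if and only if the edge is in $E''$. If $\Gamma$ has no boundary points, put $$o(\Gamma)=|L|+\sum_C\bigl(1+F(C)+D(C)\bigr)\in\mathbb Z/2,$$ the sum being over the components $C$ of the graph $(V,E)$, which are circles, where $F(C)$ is the sum of $f(e)$ over the edges $e\in E'$ in $C$, and $D(C)$ is the number modulo $2$ of edges of $E''$ in $C$ which point in a chosen direction along the circle $C$. Let $\varphi\in C^k(\mathscr C;\mathbb Z/2)$ be a cocycle and, for $|b|=k+1$, let $\mathcal M(b,\varphi)=\coprod_{\varphi(c)=1}\mathcal M(b,c)$. A *combinatorial boundary matching* $\mathcal C$ for $\varphi$ is a choice, for every such $b$, of a partition of $\mathcal M(b,\varphi)$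 into ordered pairs. For $|a|=k+2$ define $\Gamma_{\mathcal C}(a,\varphi)$ as follows. Its vertices are the points $(B,A)\in\mathcal M(b,c)\times\mathcal M(a,b)$ with $\varphi(c)=1$, with sign $s(B)+s(A)$. The edges in $E'$ are the interval components $I$ of the $\mathcal M(a,c)$ with $\varphi(c)=1$, joining the end points of $I$, with value $f(I)$. The edges in $E\setminus E'$ are, for every pair $(B_1,B_2)$ of $\mathcal C$ in $\mathcal M(b,\varphi)$ and every $A\in\mathcal M(a,b)$, an edge between $(B_1,A)$ and $(B_2,A)$, which is directed towards $(B_2,A)$ if $s(B_1)=s(B_2)$ and undirected otherwise. The loops are the circle components $K$ of the $\mathcal M(a,c)$ with $\varphi(c)=1$ and $f(K)=1$. Finally let $\mathrm{sq}^\varphi(a)=o(\Gamma_{\mathcal C}(a,\varphi))$. **Theorem.** Let $(\mathscr C,s,f)$ be a framed 1-flow category and $k\in\mathbb Z$. Every cocycle $\varphi\in C^k(\mathscr C;\mathbb Z/2)$ has a combinatorial boundary matching, and for each such matching $\mathcal C$ and each object $a$ of degree $k+2$, $\Gamma_{\mathcal C}(a,\varphi)$ is a special graph structure without boundary points. The cochain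 $\mathrm{sq}^\varphi\in C^{k+2}(\mathscr C;\mathbb Z/2)$ is a cocycle, and its cohomology class does not depend on the choice of the combinatorial boundary matching for $\varphi$. Furthermore, there is a well-defined linear map $$\mathrm{Sq}^2\colon H^k(\mathscr C;\mathbb Z/2)\to H^{k+2}(\mathscr C;\mathbb Z/2),\qquad z\mapsto[\mathrm{sq}^\varphi],$$ where $\varphi$ is any choice of cocycle representing the cohomology class $z$. -/

import Mathlib

universe u v w

/-- A 1-flow category: a finite graded set of objects; for `|a| = |b| + 1` a compact `0`-manifold
`Pt a b` (that is, a finite set); for `|a| = |c| + 2` a compact topological `1`-manifold with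
boundary `Mod a c`, whose boundary is identified with the disjoint union over all `b` with
`|b| = |a| - 1` of `Pt b c × Pt a b`. -/
structure OneFlowCategory where
  Ob : Type u
  finite_ob : Finite Ob
  /-- the grading `|·|` -/
  gr : Ob → ℤ
  Pt : ∀ a b : Ob, gr a = gr b + 1 → Type v
  finite_pt : ∀ a b h, Finite (Pt a b h)
  Mod : ∀ a c : Ob, gr a = gr c + 2 → Type w
  top_mod : ∀ a c h, TopologicalSpace (Mod a c h)
  t2_mod : ∀ a c h, T2Space (Mod a c h)
  compact_mod : ∀ a c h, CompactSpace (Mod a c h)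
  charted_mod : ∀ a c h, ChartedSpace (EuclideanHalfSpace 1) (Mod a c h)
  /-- the boundary condition -/
  bdryEquiv : ∀ a c h,
    (Σ b : {b : Ob // gr b = gr c + 1 ∧ gr a = gr b + 1}, Pt b.1 c b.2.1 × Pt a b.1 b.2.2) ≃
      ((modelWithCornersEuclideanHalfSpace 1).boundary (Mod a c h) : Set (Mod a c h))

attribute [instance] OneFlowCategory.finite_ob OneFlowCategory.finite_pt OneFlowCategory.top_mod
  OneFlowCategory.t2_mod OneFlowCategory.compact_mod OneFlowCategory.charted_mod

namespace OneFlowCategory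

variable (C : OneFlowCategory.{u, v, w})

/-- The objects of degree `k`. -/
abbrev Obj (k : ℤ) : Type u := {a : C.Ob // C.gr a = k}

theorem gr_eq {i j : ℤ} (a : C.Obj i) (b : C.Obj j) (d : ℤ) (h : i = j + d) :
    C.gr a.1 = C.gr b.1 + d := by
  rw [a.2, b.2, h]

/-- The pairs `(B, A)` in the disjoint union over `b` of `Pt b c × Pt a b`. -/
abbrev Broken (a c : C.Ob) : Type (max u v) :=
  Σ b : {b : C.Ob // C.gr b = C.gr c + 1 ∧ C.gr a = C.gr b + 1}, C.Pt b.1 c b.2.1 × C.Pt a b.1 b.2.2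

/-- The connected components of a one-dimensional moduli space. -/
abbrev Comp (a c : C.Ob) (h : C.gr a = C.gr c + 2) : Type w := ConnectedComponents (C.Mod a c h)

variable {C}

/-- The component which contains a given boundary point. -/
def endComp {a c : C.Ob} (h : C.gr a = C.gr c + 2) (x : C.Broken a c) : C.Comp a c h :=
  ConnectedComponents.mk (C.bdryEquiv a c h x).1

/-- A component is an interval if it contains a boundary point, and a circle otherwise. -/
def IsInterval {a c : C.Ob} {h : C.gr a = C.gr c + 2} (K : C.Comp a c h) : Prop :=
  ∃ x : C.Broken a c, endComp h x = K

variable (C)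

/-- A sign assignment, with the signs `{0, 1}` regarded as elements of `ZMod 2`. Two different
boundary points on the same component are the two end points of an interval. -/
structure SignAssignment where
  sg : ∀ {a b : C.Ob} {h : C.gr a = C.gr b + 1}, C.Pt a b h → ZMod 2
  interval : ∀ {a c : C.Ob} (h : C.gr a = C.gr c + 2) (x y : C.Broken a c), x ≠ y →
    endComp h x = endComp h y → sg x.2.1 + sg x.2.2 + sg y.2.1 + sg y.2.2 = 1

/-- A pre-framing: a value in `{0, 1} = ZMod 2` for every component of every one-dimensional
moduli space. -/
structure PreFraming where
  val : ∀ {a c : C.Ob} {h : C.gr a = C.gr c + 2}, C.Comp a c h → ZMod 2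

/-- For `|a| = |d| + 3`, the pieces `K × {R}` and `{P} × K` from which the boundary of `(a, d)` is
glued together, where `K` is a component of a one-dimensional moduli space. -/
abbrev Piece (a d : C.Ob) : Type (max u v w) :=
  (Σ b : {b : C.Ob // C.gr b = C.gr d + 2 ∧ C.gr a = C.gr b + 1},
      C.Comp b.1 d b.2.1 × C.Pt a b.1 b.2.2) ⊕
  (Σ c : {c : C.Ob // C.gr c = C.gr d + 1 ∧ C.gr a = C.gr c + 2},
      C.Pt c.1 d c.2.1 × C.Comp a c.1 c.2.2)

/-- Two pieces meet at a corner `(P, Q, R)`, which is a boundary point `(P, Q)` times `R`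
in the one, and `P` times a boundary point `(Q, R)` in the other. -/
inductive Meet (a d : C.Ob) : C.Piece a d → C.Piece a d → Prop
  | corner (b c : C.Ob) (hab : C.gr a = C.gr b + 1) (hbc : C.gr b = C.gr c + 1)
      (hcd : C.gr c = C.gr d + 1) (hbd : C.gr b = C.gr d + 2) (hac : C.gr a = C.gr c + 2)
      (P : C.Pt c d hcd) (Q : C.Pt b c hbc) (R : C.Pt a b hab) :
      Meet a d (Sum.inl ⟨⟨b, hbd, hab⟩, endComp hbd ⟨⟨c, hcd, hbc⟩, P, Q⟩, R⟩)
        (Sum.inr ⟨⟨c, hcd, hac⟩, P, endComp hac ⟨⟨b, hbc, hab⟩, Q, R⟩⟩)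

/-- The components of the boundary of `(a, d)`: the pieces modulo the equivalence relation
generated by meeting at a corner. -/
abbrev BdryComp (a d : C.Ob) : Type (max u v w) := Quot (C.Meet a d)

variable {C}

open Classical in
/-- The contribution of a piece to the framing value of its boundary component. -/
noncomputable def pieceFraming (s : C.SignAssignment) (f : C.PreFraming) {a d : C.Ob} :
    C.Piece a d → ZMod 2
  | Sum.inl ⟨_, K, _⟩ => if IsInterval K then f.val K else 1 + f.val K
  | Sum.inr ⟨_, P, K⟩ => if IsInterval K then 1 + s.sg P + f.val K else 1 + f.val K

/-- The framing value of a component of the boundary of `(a, d)`. -/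
noncomputable def bdryFraming (s : C.SignAssignment) (f : C.PreFraming) {a d : C.Ob}
    (K : C.BdryComp a d) : ZMod 2 :=
  ∑ᶠ (p : C.Piece a d) (_ : Quot.mk _ p = K), pieceFraming s f p

/-- The compatibility condition. (All sums occurring here and below have finite index sets, since
a compact manifold has finitely many components.) -/
def IsFraming (s : C.SignAssignment) (f : C.PreFraming) : Prop :=
  ∀ a d : C.Ob, C.gr a = C.gr d + 3 → ∑ᶠ K : C.BdryComp a d, (1 + bdryFraming s f K) = 0

/-- The number `[a : b]`. -/
noncomputable def incidence (s : C.SignAssignment) {a b : C.Ob} (h : C.gr a = C.gr b + 1) : ℤ :=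
  ∑ᶠ A : C.Pt a b h, (-1 : ℤ) ^ (s.sg A).val

variable (C)

/-- Cochains of degree `k` with coefficients in `ZMod 2`. -/
abbrev Cochain (k : ℤ) : Type u := C.Obj k → ZMod 2

variable {C}

/-- The coboundary map from degree `i` to degree `j = i + 1`. -/
noncomputable def delta (s : C.SignAssignment) (i j : ℤ) (h : j = i + 1) :
    C.Cochain i →ₗ[ZMod 2] C.Cochain j where
  toFun φ a := ∑ᶠ b : C.Obj i, ((incidence s (C.gr_eq a b 1 h) : ℤ) : ZMod 2) * φ b
  map_add' φ ψ := by
    funext a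
    simp only [Pi.add_apply, mul_add]
    exact finsum_add_distrib (Set.toFinite _) (Set.toFinite _)
  map_smul' r φ := by
    funext a
    simp only [Pi.smul_apply, smul_eq_mul, RingHom.id_apply, mul_left_comm _ r]
    exact (mul_finsum' _ _ (Set.toFinite _)).symm

/-- The cocycles of degree `k`. -/
noncomputable def cocycles (s : C.SignAssignment) (k : ℤ) : Submodule (ZMod 2) (C.Cochain k) :=
  LinearMap.ker (delta s k (k + 1) rfl)

/-- The coboundaries of degree `k`. -/
noncomputable def coboundaries (s : C.SignAssignment) (k : ℤ) : Submodule (ZMod 2) (C.Cochain k) :=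
  LinearMap.range (delta s (k - 1) k (by ring))

/-- The cohomology group in degree `k` with coefficients in `ZMod 2`. -/
abbrev Cohomology (s : C.SignAssignment) (k : ℤ) : Type u :=
  cocycles s k ⧸ (coboundaries s k).submoduleOf (cocycles s k)

/-- The cohomology class of a cocycle. -/
noncomputable def cls (s : C.SignAssignment) {k : ℤ} (φ : C.Cochain k) (h : φ ∈ cocycles s k) :
    Cohomology s k :=
  Submodule.Quotient.mk ⟨φ, h⟩

end OneFlowCategory

/-- The data of a special graph structure. Edges are indexed, so that two edges may have the same
vertices. The edges in `framed` form the set `E'`, those in `directed` form the set `E''`. -/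
structure GraphData where
  V : Type u
  E : Type v
  L : Type w
  sgn : V → ZMod 2
  /-- the set of vertices of an edge -/
  ends : E → Set V
  framed : Set E
  fr : framed → ZMod 2
  directed : Set E
  /-- the vertex towards which a directed edge points -/
  head : directed → V

namespace GraphData

variable (G : GraphData.{u, v, w})

/-- The vertices contained in only one edge. -/
def bdry : Set G.V := {x | {e | x ∈ G.ends e}.ncard = 1}

/-- The conditions for a special graph structure. -/
structure IsSpecial : Prop where
  finite_V : Finite G.V
  finite_E : Finite G.E
  finite_L : Finite G.L
  two_ends : ∀ e, (G.ends e).ncard = 2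
  directed_sub : G.directed ⊆ G.framedᶜ
  head_mem : ∀ e, G.head e ∈ G.ends e.1
  valency : ∀ x, {e | x ∈ G.ends e}.ncard = 1 ∨ {e | x ∈ G.ends e}.ncard = 2
  bdry_framed : ∀ x ∈ G.bdry, ∀ e, x ∈ G.ends e → e ∈ G.framed
  inner_edges : ∀ x, x ∉ G.bdry →
    (∃ e ∈ G.framed, x ∈ G.ends e) ∧ ∃ e, e ∉ G.framed ∧ x ∈ G.ends e
  sgn_framed : ∀ e ∈ G.framed, ∀ x ∈ G.ends e, ∀ y ∈ G.ends e, x ≠ y → G.sgn x ≠ G.sgn y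
  sgn_unframed : ∀ e, e ∉ G.framed → ∀ x ∈ G.ends e, ∀ y ∈ G.ends e, x ≠ y →
    (G.sgn x = G.sgn y ↔ e ∈ G.directed)

/-- The components which contain a vertex: classes of vertices under the equivalence relation
generated by the edges. -/
abbrev Component : Type u := Quot fun x y : G.V => ∃ e, x ∈ G.ends e ∧ y ∈ G.ends e

variable {G}

/-- The edge `e` is in the component `K`. -/
def InComp (e : G.E) (K : G.Component) : Prop := ∃ x ∈ G.ends e, Quot.mk _ x = K

/-- The sum of the framing values in a component. -/
noncomputable def F (K : G.Component) : ZMod 2 :=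
  ∑ᶠ (e : G.framed) (_ : InComp e.1 K), G.fr e

variable (G)

/-- A choice of direction along every (circle) component: all edges are given a source and a target
such that every vertex is entered by exactly one edge and left by exactly one edge. -/
structure Direction where
  src : G.E → G.V
  tgt : G.E → G.V
  ends_eq : ∀ e, G.ends e = {src e, tgt e}
  src_unique : ∀ x, ∃! e, src e = x
  tgt_unique : ∀ x, ∃! e, tgt e = x

variable {G}

/-- The number modulo `2` of directed edges in a component which point in the given direction. -/
noncomputable def D (t : G.Direction) (K : G.Component) : ZMod 2 :=
  ({e : G.directed | InComp e.1 K ∧ G.head e = t.tgt e.1}.ncard : ZMod 2)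

variable (G)

open Classical in
/-- `o(Γ) = |L| + ∑ (1 + F(C) + D(C))`, the sum being over the components which contain a vertex,
and `D` being formed with a chosen direction. A direction exists for every special graph structure
without boundary points; in all other cases `o` has the meaningless value `0`. -/
noncomputable def o : ZMod 2 :=
  if h : Nonempty G.Direction then
    (Nat.card G.L : ZMod 2) + ∑ᶠ K : G.Component, (1 + F K + D h.some K)
  else 0

end GraphData

namespace OneFlowCategory

variable {C : OneFlowCategory.{u, v, w}} {k : ℤ}

/-- The objects which represent the cochain `φ`. -/
abbrev Supp (φ : C.Cochain k) : Type u := {c : C.Obj k // φ c = 1}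

/-- The disjoint union of the moduli spaces from `b` to the objects which represent `φ`. -/
abbrev PtTo (φ : C.Cochain k) (b : C.Obj (k + 1)) : Type (max u v) :=
  Σ c : Supp φ, C.Pt b.1 c.1.1 (C.gr_eq b c.1 1 rfl)

/-- A combinatorial boundary matching: for every `b`, a partition of the points from `b` to `φ`
into ordered pairs. (For those `b` without such points there is nothing to choose.) -/
structure BoundaryMatching (φ : C.Cochain k) where
  pairs : ∀ b : C.Obj (k + 1), Set (PtTo φ b × PtTo φ b)
  ne : ∀ b, ∀ p ∈ pairs b, p.1 ≠ p.2
  partition : ∀ b (x : PtTo φ b), ∃! p, p ∈ pairs b ∧ (x = p.1 ∨ x = p.2)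

/-- The vertices of `Γ(a, φ)`: all `(B, A)` in the disjoint union of `Pt b c × Pt a b`, for `c`
representing `φ`. -/
abbrev Vert (φ : C.Cochain k) (a : C.Obj (k + 2)) : Type (max u v) :=
  Σ c : Supp φ, C.Broken a.1 c.1.1

/-- The vertex `(B, A)`. -/
def vert {φ : C.Cochain k} {a : C.Obj (k + 2)} (b : C.Obj (k + 1)) (B : PtTo φ b)
    (A : C.Pt a.1 b.1 (C.gr_eq a b 1 (by ring))) : Vert φ a :=
  ⟨B.1, ⟨b.1, C.gr_eq b B.1.1 1 rfl, C.gr_eq a b 1 (by ring)⟩, B.2, A⟩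

/-- The intervals in the moduli spaces from `a` to the objects which represent `φ`. -/
abbrev IntervalEdge (φ : C.Cochain k) (a : C.Obj (k + 2)) : Type (max u w) :=
  Σ c : Supp φ, {K : C.Comp a.1 c.1.1 (C.gr_eq a c.1 2 rfl) // IsInterval K}

/-- The edges `{(B₁, A), (B₂, A)}` for all pairs `(B₁, B₂)` in the matching and all `A`. -/
abbrev MatchEdge {φ : C.Cochain k} (m : BoundaryMatching φ) (a : C.Obj (k + 2)) :
    Type (max u v) :=
  Σ b : C.Obj (k + 1), (m.pairs b) × C.Pt a.1 b.1 (C.gr_eq a b 1 (by ring))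

/-- The circles with framing value `1` in the moduli spaces from `a` to the objects which
represent `φ`. -/
abbrev Loop (f : C.PreFraming) (φ : C.Cochain k) (a : C.Obj (k + 2)) : Type (max u w) :=
  Σ c : Supp φ, {K : C.Comp a.1 c.1.1 (C.gr_eq a c.1 2 rfl) // ¬ IsInterval K ∧ f.val K = 1}

/-- The special graph structure `Γ(a, φ)` determined by a combinatorial boundary matching. -/
def graph (s : C.SignAssignment) (f : C.PreFraming) {φ : C.Cochain k} (m : BoundaryMatching φ)
    (a : C.Obj (k + 2)) : GraphData.{max u v, max u v w, max u w} where
  V := Vert φ a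
  E := IntervalEdge φ a ⊕ MatchEdge m a
  L := Loop f φ a
  sgn x := s.sg x.2.2.1 + s.sg x.2.2.2
  ends e := match e with
    | Sum.inl ⟨c, K⟩ => {x | ∃ z : C.Broken a.1 c.1.1, endComp _ z = K.1 ∧ x = ⟨c, z⟩}
    | Sum.inr ⟨b, p, A⟩ => {vert b p.1.1 A, vert b p.1.2 A}
  framed := Set.range Sum.inl
  fr e := match e.1 with
    | Sum.inl ⟨_, K⟩ => f.val K.1
    | Sum.inr _ => 0
  directed := {e | ∃ q : MatchEdge m a, e = Sum.inr q ∧ s.sg q.2.1.1.1.2 = s.sg q.2.1.1.2.2}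
  head e := match e with
    | ⟨Sum.inl _, h⟩ => absurd h (by rintro ⟨q, hq, _⟩; cases hq)
    | ⟨Sum.inr ⟨b, p, A⟩, _⟩ => vert b p.1.2 A

/-- The cochain `sq^φ`, formed with a combinatorial boundary matching for `φ`. -/
noncomputable def sq (s : C.SignAssignment) (f : C.PreFraming) {φ : C.Cochain k}
    (m : BoundaryMatching φ) : C.Cochain (k + 2) :=
  fun a => (graph s f m a).o

end OneFlowCategory

/-! The proof translates everything into signs of permutations. An oriented perfect matching of a
finite set `V` is an equivalence `I ⊕ I ≃ V` listing tails and heads, and `relPar p q` is the sign,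
in `ZMod 2`, of a permutation carrying `p` to `q`. A bijection of the edges acts once on tails and
once on heads, so its choice does not matter. Hence `relPar` is additive under composition
(`relPar_trans`) and under disjoint unions, it grows by one for each reversed edge (`relPar_flip`),
and on a product the matchings coming from the two factors differ by the product of the numbers of
edges (`relPar_prod`). When the edges of two matchings run coherently around the circles of their
union, the permutation is one step along each circle, so `relPar` counts circles modulo 2
(`relPar_eq_card_quot`).

With `IsMatched.o_eq` this turns `sq` at `a` into three terms: the sum of `f` over all components of
the relevant moduli spaces, the relative parity of the interval matching and the boundary matching,
and the sum of 1 + sign(tail) over the boundary edges. The formula makes sense for families of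
objects with repetitions (`sqFam`). In the same way the framing condition becomes an identity for
the relative parity of two matchings of the triples `(P, Q, R)`, namely by intervals times `R` and
by `P` times intervals (`relPar_leftMatch_rightMatch`).

Independence of the matching: `relPar_trans` eliminates the interval matching, and what remains is a
sum over the points `A` of a function of the target of `A`, hence a coboundary (`sqFam_add_sqFam`).
Linearity: `sqFam` is additive on unions of families, and a doubled family, matched copy to copy,
has `sqFam` zero; so the class depends only on multiplicities modulo 2 (`sqFam_add_sqFam_mem`).
Coboundaries: the family representing a coboundary has a canonical boundary matching by intervals,
and the framing identity exhibits its `sqFam` as a coboundary (`sqFam_cobMatch`). Cocycle: on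
triples, the framing identity compares left with right intervals, the product formula compares right
intervals with boundary edges, and all terms cancel (`delta_sqFam`).

The topological input is that an interval has exactly two ends, of opposite total sign. There are at
most two because distinct ends have different signs in `ZMod 2`; there are at least two because a
clopen part of a compact 1-manifold has an even number of boundary points (`even_ncard_boundary`).
The latter is proved by counting jumps of indicator functions, without classifying 1-manifolds. -/

namespace OneManifold

open Filter Topology Set
open scoped NNReal

/-! ### Compact 1-manifolds: parity of the number of boundary points -/

section Sides

variable {X Y : Type*}

open Classical in
/-- The value, near a nontrivial filter, of the indicator function of a set which is eventually
constant along that filter; it is `0` for the trivial filter. -/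
noncomputable def ind (l : Filter X) (A : Set X) : ZMod 2 := if l.NeBot ∧ A ∈ l then 1 else 0

/-- The set is eventually everything or eventually empty along the filter. -/
def Tame (l : Filter X) (A : Set X) : Prop := A ∈ l ∨ Aᶜ ∈ l

theorem Tame.mono {l l' : Filter X} {A : Set X} (h : l' ≤ l) : Tame l A → Tame l' A :=
  Or.imp (fun H => h H) (fun H => h H)

theorem Tame.compl {l : Filter X} {A : Set X} (h : Tame l A) : Tame l Aᶜ :=
  h.symm.imp id (fun H => by rwa [compl_compl])

theorem Tame.inter {l : Filter X} {A B : Set X} (h : Tame l A) (h' : Tame l B) :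
    Tame l (A ∩ B) := by
  rcases h with h | h
  · rcases h' with h' | h'
    · exact Or.inl (inter_mem h h')
    · exact Or.inr (mem_of_superset h' fun x hx hx' => hx hx'.2)
  · exact Or.inr (mem_of_superset h fun x hx hx' => hx hx'.1)

@[simp] theorem ind_bot (A : Set X) : ind ⊥ A = 0 := by simp [ind]

theorem ind_of_mem {l : Filter X} [l.NeBot] {A : Set X} (h : A ∈ l) : ind l A = 1 := by
  simp [ind, h, ‹l.NeBot›]

theorem ind_of_compl_mem {l : Filter X} {A : Set X} (h : Aᶜ ∈ l) : ind l A = 0 := by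
  rw [ind, if_neg]
  rintro ⟨hl, hA⟩
  exact hl.ne (empty_mem_iff_bot.1 (by simpa using inter_mem hA h))

theorem ind_congr {l : Filter X} {A B : Set X} (h : A ∈ l ↔ B ∈ l) : ind l A = ind l B := by
  have : (l.NeBot ∧ A ∈ l) = (l.NeBot ∧ B ∈ l) := by rw [h]
  unfold ind
  congr

theorem ind_map {l : Filter X} (g : X → Y) (A : Set Y) : ind (map g l) A = ind l (g ⁻¹' A) := by
  have : ((map g l).NeBot ∧ A ∈ map g l) = (l.NeBot ∧ g ⁻¹' A ∈ l) := by
    rw [map_neBot_iff, mem_map]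
  unfold ind
  congr

theorem ind_union {l : Filter X} {A B : Set X} (hd : Disjoint A B) (hA : Tame l A)
    (hB : Tame l B) : ind l (A ∪ B) = ind l A + ind l B := by
  rcases l.eq_or_neBot with rfl | hl
  · simp
  rcases hA with hA | hA
  · rw [ind_of_mem hA, ind_of_mem (mem_of_superset hA subset_union_left),
      ind_of_compl_mem (mem_of_superset hA hd.subset_compl_right), add_zero]
  · rw [ind_of_compl_mem hA, zero_add]
    refine ind_congr ⟨fun h => ?_, fun h => mem_of_superset h subset_union_right⟩
    exact mem_of_superset (inter_mem h hA) fun x hx => hx.1.resolve_left hx.2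

end Sides

section Line

/-- The sum of the two one-sided values of the indicator function of a set. -/
noncomputable def lineJump (B : Set ℝ≥0) (t : ℝ≥0) : ZMod 2 := ind (𝓝[>] t) B + ind (𝓝[<] t) B

/-- Both sides see the same value. At `0` this fails, since the left filter is trivial and has value
`0`; that asymmetry is what detects boundary points. -/
theorem lineJump_eq_zero {B : Set ℝ≥0} {t : ℝ≥0} (ht : t ≠ 0) (h : Tame (𝓝 t) B) :
    lineJump B t = 0 := by
  have : (𝓝[<] t).NeBot := nhdsLT_neBot_of_exists_lt ⟨0, pos_iff_ne_zero.2 ht⟩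
  rcases h with h | h
  · rw [lineJump, ind_of_mem (mem_nhdsWithin_of_mem_nhds h),
      ind_of_mem (mem_nhdsWithin_of_mem_nhds h)]
    decide
  · rw [lineJump, ind_of_compl_mem (mem_nhdsWithin_of_mem_nhds h),
      ind_of_compl_mem (mem_nhdsWithin_of_mem_nhds h), add_zero]

/-- The interiors of `B` and of its complement cover the connected interval between `m` and `t`, so
one of them contains it. -/
theorem ind_right_eq_ind_left {B : Set ℝ≥0} {m t : ℝ≥0} (hmt : m < t)
    (h : ∀ x, m < x → x < t → Tame (𝓝 x) B) : ind (𝓝[>] m) B = ind (𝓝[<] t) B := by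
  have h1 : Ioo m t ∈ 𝓝[>] m := Ioo_mem_nhdsGT hmt
  have h2 : Ioo m t ∈ 𝓝[<] t := Ioo_mem_nhdsLT hmt
  have : (𝓝[<] t).NeBot := nhdsLT_neBot_of_exists_lt ⟨m, hmt⟩
  have hd : Disjoint (interior B) (interior Bᶜ) :=
    disjoint_compl_right.mono interior_subset interior_subset
  have hcov : Ioo m t ⊆ interior B ∪ interior Bᶜ := fun x hx =>
    (h x hx.1 hx.2).imp mem_interior_iff_mem_nhds.2 mem_interior_iff_mem_nhds.2
  rcases isPreconnected_Ioo.subset_or_subset isOpen_interior isOpen_interior hd hcov with H | H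
  · rw [ind_of_mem (mem_of_superset h1 (H.trans interior_subset)),
      ind_of_mem (mem_of_superset h2 (H.trans interior_subset))]
  · rw [ind_of_compl_mem (mem_of_superset h1 (H.trans interior_subset)),
      ind_of_compl_mem (mem_of_superset h2 (H.trans interior_subset))]

/-- Telescoping: the left value at the largest point of `F` cancels against the sum over the smaller
points, and its right value persists up to `t`. -/
theorem sum_lineJump {B : Set ℝ≥0} (F : Finset ℝ≥0) : ∀ t : ℝ≥0, (∀ x ∈ F, x < t) →
    (∀ x < t, x ∉ F → x ≠ 0 ∧ Tame (𝓝 x) B) → ∑ x ∈ F, lineJump B x = ind (𝓝[<] t) B := by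
  refine Finset.induction_on_max F ?_ ?_
  · intro t _ h
    have : t = 0 := by
      by_contra h0
      exact (h 0 (pos_iff_ne_zero.2 h0) (by simp)).1 rfl
    subst this
    simp
  · intro m F hm ih t ht h
    rw [Finset.sum_insert (fun H => (hm m H).false), ih m hm]
    · rw [lineJump, add_assoc, CharTwo.add_self_eq_zero, add_zero]
      refine ind_right_eq_ind_left (ht m (by simp)) fun x hx hx' => (h x hx' ?_).2
      rw [Finset.mem_insert, not_or]
      exact ⟨hx.ne', fun H => (hm x H).not_gt hx⟩
    · intro x hx hxF
      refine h x (hx.trans (ht m (by simp))) ?_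
      rw [Finset.mem_insert, not_or]
      exact ⟨hx.ne, hxF⟩

theorem finsum_lineJump {B : Set ℝ≥0} (hB : BddAbove B) (hF : {x | ¬ Tame (𝓝 x) B}.Finite) :
    ∑ᶠ x, lineJump B x = 0 := by
  classical
  obtain ⟨c, hc⟩ := hB
  -- The point `0` is included even if `B` is constant near it, because its jump need not vanish.
  set F : Finset ℝ≥0 := insert 0 hF.toFinset with hFdef
  have hF' : ∀ x, x ∉ F → x ≠ 0 ∧ Tame (𝓝 x) B := by
    intro x hx
    simpa [hFdef] using hx
  rw [finsum_eq_sum_of_support_subset (s := F)]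
  · obtain ⟨t, ht⟩ : ∃ t, ∀ x ∈ insert c F, x < t :=
      ⟨(insert c F).sup id + 1, fun x hx =>
        lt_of_le_of_lt (Finset.le_sup (f := id) hx) (lt_add_one _)⟩
    rw [sum_lineJump F t (fun x hx => ht x (by simp [hx])) fun x _ hx => hF' x hx]
    apply ind_of_compl_mem
    have : Ioo c t ∈ 𝓝[<] t := Ioo_mem_nhdsLT (ht c (by simp))
    exact mem_of_superset this fun x hx hx' => (hc hx').not_gt hx.1
  · intro x hx
    by_contra hx'
    exact hx (lineJump_eq_zero (hF' x hx').1 (hF' x hx').2)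

end Line

section Charts

variable {M : Type*} [TopologicalSpace M]

/-- The germs on the right of a point in a chart. -/
def rightSide (e : OpenPartialHomeomorph M ℝ≥0) (x : M) : Filter M := map e.symm (𝓝[>] e x)

/-- The germs on the left of a point in a chart. -/
def leftSide (e : OpenPartialHomeomorph M ℝ≥0) (x : M) : Filter M := map e.symm (𝓝[<] e x)

variable {e e' : OpenPartialHomeomorph M ℝ≥0} {x : M}

theorem rightSide_le (hx : x ∈ e.source) : rightSide e x ≤ 𝓝 x := by
  rw [← e.symm_map_nhds_eq hx]
  exact map_mono nhdsWithin_le_nhds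

theorem leftSide_le (hx : x ∈ e.source) : leftSide e x ≤ 𝓝 x := by
  rw [← e.symm_map_nhds_eq hx]
  exact map_mono nhdsWithin_le_nhds

theorem sides_sup (hx : x ∈ e.source) : rightSide e x ⊔ leftSide e x = 𝓝[≠] x := by
  rw [rightSide, leftSide, ← map_sup, sup_comm, nhdsLT_sup_nhdsGT,
    e.symm.map_nhdsWithin_eq (e.map_source hx), e.left_inv hx]
  have : e.symm '' (e.symm.source ∩ {e x}ᶜ) = e.source ∩ {x}ᶜ := by
    ext y
    constructor
    · rintro ⟨t, ⟨ht, hne⟩, rfl⟩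
      refine ⟨e.map_target ht, fun h => hne ?_⟩
      rw [mem_singleton_iff] at h
      rw [mem_singleton_iff, ← h, e.right_inv ht]
    · rintro ⟨hy, hne⟩
      refine ⟨e y, ⟨e.map_source hy, fun h => hne ?_⟩, e.left_inv hy⟩
      exact e.injOn hy hx h
  rw [this, inter_comm, nhdsWithin_inter_of_mem']
  exact mem_nhdsWithin_of_mem_nhds (e.open_source.mem_nhds hx)

theorem sides_disjoint (hx : x ∈ e.source) : Disjoint (rightSide e x) (leftSide e x) := by
  have ht : e.target ∈ 𝓝 (e x) := e.open_target.mem_nhds (e.map_source hx)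
  refine Filter.disjoint_iff.2 ⟨e ⁻¹' Ioi (e x), ?_, e ⁻¹' Iio (e x), ?_, ?_⟩
  · rw [rightSide, mem_map]
    filter_upwards [self_mem_nhdsWithin, mem_nhdsWithin_of_mem_nhds ht] with t h1 h2
    simpa [e.right_inv h2] using h1
  · rw [leftSide, mem_map]
    filter_upwards [self_mem_nhdsWithin, mem_nhdsWithin_of_mem_nhds ht] with t h1 h2
    simpa [e.right_inv h2] using h1
  · exact Disjoint.preimage _ (Set.disjoint_left.2 fun t h1 h2 => lt_asymm (mem_Ioi.1 h1) h2)

/-- A transition map only shows that each side is contained in a side of the other chart. As both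
pairs split the same punctured neighbourhood filter and one pair is disjoint, containment upgrades
to equality. -/
theorem eq_of_sup_eq_sup {α : Type*} [DistribLattice α] [OrderBot α] {R L R' L' : α}
    (hR : R ≤ R') (hL : L ≤ L') (h : R ⊔ L = R' ⊔ L') (hd : Disjoint R' L') : R = R' ∧ L = L' := by
  constructor
  · refine le_antisymm hR ?_
    calc R' = R' ⊓ (R ⊔ L) := by rw [h]; simp
      _ = R' ⊓ R ⊔ R' ⊓ L := inf_sup_left _ _ _
      _ ≤ R := sup_le inf_le_right ((hd.mono_right hL).eq_bot ▸ bot_le)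
  · refine le_antisymm hL ?_
    calc L' = L' ⊓ (R ⊔ L) := by rw [h]; simp
      _ = L' ⊓ R ⊔ L' ⊓ L := inf_sup_left _ _ _
      _ ≤ L := sup_le ((hd.symm.mono_right hR).eq_bot ▸ bot_le) inf_le_right

/-- The two sides of a point do not depend on the chart, up to exchanging them. -/
theorem sides_eq (hx : x ∈ e.source) (hx' : x ∈ e'.source) :
    (rightSide e x = rightSide e' x ∧ leftSide e x = leftSide e' x) ∨
      (rightSide e x = leftSide e' x ∧ leftSide e x = rightSide e' x) := by
  set g : OpenPartialHomeomorph ℝ≥0 ℝ≥0 := e.symm.trans e' with hg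
  have hs : g.source ∈ 𝓝 (e x) := by
    refine g.open_source.mem_nhds ?_
    simp [hg, e.map_source hx, e.left_inv hx, hx']
  obtain ⟨a, b, hab, hn, hsub⟩ := exists_Icc_mem_subset_of_mem_nhds hs
  have hgx : g (e x) = e' x := by simp [hg, e.left_inv hx]
  have hcont : Tendsto g (𝓝 (e x)) (𝓝 (e' x)) := hgx ▸ (g.continuousAt (mem_of_mem_nhds hs)).tendsto
  have hfac : ∀ s : Set ℝ≥0, map e.symm (𝓝[s] (e x)) = map e'.symm (map g (𝓝[s] (e x))) := by
    intro s
    rw [map_map]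
    refine map_congr ?_
    filter_upwards [mem_nhdsWithin_of_mem_nhds hs] with t ht
    simp only [hg, OpenPartialHomeomorph.trans_source, mem_inter_iff, mem_preimage,
      OpenPartialHomeomorph.symm_source] at ht
    simp [hg, e'.left_inv ht.2]
  have key : ∀ s s' : Set ℝ≥0, (∀ t ∈ Icc a b, t ∈ s → g t ∈ s') →
      map e.symm (𝓝[s] (e x)) ≤ map e'.symm (𝓝[s'] (e' x)) := by
    intro s s' h
    rw [hfac]
    refine map_mono (tendsto_nhdsWithin_iff.2 ⟨hcont.mono_left nhdsWithin_le_nhds, ?_⟩)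
    filter_upwards [self_mem_nhdsWithin, mem_nhdsWithin_of_mem_nhds hn] with t h1 h2 using h t h2 h1
  have hsup : rightSide e x ⊔ leftSide e x = rightSide e' x ⊔ leftSide e' x := by
    rw [sides_sup hx, sides_sup hx']
  -- A continuous injection of an interval is monotone or antitone, so the transition map preserves
  -- or exchanges the two sides.
  rcases ContinuousOn.strictMonoOn_of_injOn_Icc' (hab.1.trans hab.2)
    (g.continuousOn.mono hsub) (g.injOn.mono hsub) with hm | hm
  · refine Or.inl (eq_of_sup_eq_sup (key _ _ fun t ht h => ?_) (key _ _ fun t ht h => ?_) hsup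
      (sides_disjoint hx'))
    · exact hgx ▸ hm hab ht h
    · exact hgx ▸ hm ht hab h
  · refine Or.inr (eq_of_sup_eq_sup (key _ _ fun t ht h => ?_) (key _ _ fun t ht h => ?_)
      (hsup.trans (sup_comm _ _)) (sides_disjoint hx').symm)
    · exact hgx ▸ hm hab ht h
    · exact hgx ▸ hm ht hab h

/-- The sum of the values of the indicator function of a set on the two sides of a point. -/
noncomputable def jump (e : OpenPartialHomeomorph M ℝ≥0) (A : Set M) (x : M) : ZMod 2 :=
  ind (rightSide e x) A + ind (leftSide e x) A

theorem jump_eq (hx : x ∈ e.source) (hx' : x ∈ e'.source) (A : Set M) :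
    jump e A x = jump e' A x := by
  rcases sides_eq hx hx' with h | h
  · rw [jump, jump, h.1, h.2]
  · rw [jump, jump, h.1, h.2, add_comm]

end Charts

section Global

variable {M : Type*} [TopologicalSpace M] {e : M → OpenPartialHomeomorph M ℝ≥0}

/-- The indicator function of the set is constant on every side of every point, and locally
constant away from finitely many points. -/
structure PiecewiseConstant (e : M → OpenPartialHomeomorph M ℝ≥0) (A : Set M) : Prop where
  right : ∀ x, Tame (rightSide (e x) x) A
  left : ∀ x, Tame (leftSide (e x) x) A
  finite : {x | ¬ Tame (𝓝 x) A}.Finite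

theorem PiecewiseConstant.compl {A : Set M} (h : PiecewiseConstant e A) :
    PiecewiseConstant e Aᶜ :=
  ⟨fun x => (h.right x).compl, fun x => (h.left x).compl,
    h.finite.subset fun _ hx h' => hx h'.compl⟩

theorem PiecewiseConstant.inter {A B : Set M} (hA : PiecewiseConstant e A)
    (hB : PiecewiseConstant e B) : PiecewiseConstant e (A ∩ B) := by
  refine ⟨fun x => (hA.right x).inter (hB.right x), fun x => (hA.left x).inter (hB.left x),
    (hA.finite.union hB.finite).subset fun x hx => ?_⟩
  by_contra h
  rw [mem_union, not_or] at h
  exact hx ((not_not.1 h.1).inter (not_not.1 h.2))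

theorem PiecewiseConstant.of_isClopen (he : ∀ x, x ∈ (e x).source) {A : Set M}
    (hA : IsClopen A) : PiecewiseConstant e A := by
  have h : ∀ x, Tame (𝓝 x) A := fun x => by
    by_cases hx : x ∈ A
    · exact Or.inl (hA.isOpen.mem_nhds hx)
    · exact Or.inr (hA.compl.isOpen.mem_nhds hx)
  refine ⟨fun x => (h x).mono (rightSide_le (he x)), fun x => (h x).mono (leftSide_le (he x)), ?_⟩
  have : {x | ¬ Tame (𝓝 x) A} = ∅ := eq_empty_of_forall_notMem fun x hx => hx (h x)
  rw [this]
  exact finite_empty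

/-- An interior point of the manifold has two sides, contributing 1 + 1 = 0; a boundary point has
only one. -/
theorem jump_of_mem {x : M} {e : OpenPartialHomeomorph M ℝ≥0} (hx : x ∈ e.source) {A : Set M}
    (hA : A ∈ 𝓝 x) : jump e A x = if e x = 0 then 1 else 0 := by
  have h1 : ind (rightSide e x) A = 1 := by
    have : (rightSide e x).NeBot := by
      rw [rightSide, map_neBot_iff]
      infer_instance
    exact ind_of_mem (rightSide_le hx hA)
  rw [jump, h1]
  split_ifs with h
  · rw [leftSide, h]
    simp
  · have : (leftSide e x).NeBot := by
      rw [leftSide, map_neBot_iff]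
      exact nhdsLT_neBot_of_exists_lt ⟨0, pos_iff_ne_zero.2 h⟩
    rw [ind_of_mem (leftSide_le hx hA)]
    decide

theorem jump_of_compl_mem {x : M} {e : OpenPartialHomeomorph M ℝ≥0} (hx : x ∈ e.source)
    {A : Set M} (hA : Aᶜ ∈ 𝓝 x) : jump e A x = 0 := by
  rw [jump, ind_of_compl_mem (rightSide_le hx hA), ind_of_compl_mem (leftSide_le hx hA), add_zero]

theorem PiecewiseConstant.finite_support (he : ∀ x, x ∈ (e x).source)
    (hb : {x | e x x = 0}.Finite) {A : Set M} (hA : PiecewiseConstant e A) :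
    (Function.support fun x => jump (e x) A x).Finite := by
  refine (hA.finite.union hb).subset fun x hx => ?_
  by_contra h
  rw [mem_union, not_or] at h
  rcases not_not.1 h.1 with h1 | h1
  · exact hx ((jump_of_mem (he x) h1).trans (if_neg h.2))
  · exact hx (jump_of_compl_mem (he x) h1)

theorem PiecewiseConstant.finsum_jump_union (he : ∀ x, x ∈ (e x).source)
    (hb : {x | e x x = 0}.Finite) {A B : Set M} (hA : PiecewiseConstant e A)
    (hB : PiecewiseConstant e B) (hd : Disjoint A B) :
    ∑ᶠ x, jump (e x) (A ∪ B) x = ∑ᶠ x, jump (e x) A x + ∑ᶠ x, jump (e x) B x := by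
  rw [← finsum_add_distrib (hA.finite_support he hb) (hB.finite_support he hb)]
  refine finsum_congr fun x => ?_
  simp only [jump, ind_union hd (hA.right x) (hB.right x), ind_union hd (hA.left x) (hB.left x)]
  ring

theorem tame_right_Icc (a b t : ℝ≥0) : Tame (𝓝[>] t) (Icc a b) := by
  rcases lt_or_ge t a with h | h
  · exact Or.inr (mem_nhdsWithin_of_mem_nhds (mem_of_superset (Iio_mem_nhds h)
      fun x hx hx' => hx'.1.not_gt hx))
  rcases lt_or_ge t b with h' | h'
  · exact Or.inl (mem_of_superset (Ioo_mem_nhdsGT h') fun x hx => ⟨h.trans hx.1.le, hx.2.le⟩)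
  · exact Or.inr (mem_of_superset self_mem_nhdsWithin
      fun x hx hx' => (h'.trans_lt hx).not_ge hx'.2)

theorem tame_left_Icc (a b t : ℝ≥0) : Tame (𝓝[<] t) (Icc a b) := by
  rcases lt_or_ge b t with h | h
  · exact Or.inr (mem_nhdsWithin_of_mem_nhds (mem_of_superset (Ioi_mem_nhds h)
      fun x hx hx' => hx'.2.not_gt hx))
  rcases lt_or_ge a t with h' | h'
  · exact Or.inl (mem_of_superset (Ioo_mem_nhdsLT h') fun x hx => ⟨hx.1.le, hx.2.le.trans h⟩)
  · exact Or.inr (mem_of_superset self_mem_nhdsWithin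
      fun x hx hx' => (hx.trans_le h').not_ge hx'.1)

/-- The compact arc in a chart with given end points. -/
def arc (e : OpenPartialHomeomorph M ℝ≥0) (a b : ℝ≥0) : Set M := e.symm '' Icc a b

theorem preimage_arc {e : OpenPartialHomeomorph M ℝ≥0} {a b t : ℝ≥0} (h : Icc a b ⊆ e.target)
    (ht : t ∈ e.target) : e.symm t ∈ arc e a b ↔ t ∈ Icc a b := by
  refine ⟨?_, fun h => mem_image_of_mem _ h⟩
  rintro ⟨t', ht', heq⟩
  rwa [← e.symm.injOn (h ht') ht heq]

theorem arc_mem_nhds {e : OpenPartialHomeomorph M ℝ≥0} {a b t : ℝ≥0} (h : Icc a b ∈ 𝓝 t)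
    (ht : t ∈ e.target) : arc e a b ∈ 𝓝 (e.symm t) := by
  rw [← e.symm.map_nhds_eq ht]
  exact image_mem_map h

variable [T2Space M]

theorem isClosed_arc {e : OpenPartialHomeomorph M ℝ≥0} {a b : ℝ≥0} (h : Icc a b ⊆ e.target) :
    IsClosed (arc e a b) :=
  (isCompact_Icc.image_of_continuousOn (e.continuousOn_symm.mono h)).isClosed

/-- Near a point of the arc, the sides are computed in the chart of the arc and carried over by
`sides_eq`; off the arc, closedness suffices. Only the two end points can fail local constancy. -/
theorem arc_piecewiseConstant (he : ∀ x, x ∈ (e x).source) (e₀ : OpenPartialHomeomorph M ℝ≥0)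
    {a b : ℝ≥0} (h : Icc a b ⊆ e₀.target) : PiecewiseConstant e (arc e₀ a b) := by
  have hc := (isClosed_arc h).isOpen_compl
  have hpre : ∀ t ∈ e₀.target, ∀ l ≤ 𝓝 t, Tame l (Icc a b) →
      Tame (map e₀.symm l) (arc e₀ a b) := by
    intro t ht l hl htame
    have htar : e₀.target ∈ l := hl (e₀.open_target.mem_nhds ht)
    refine htame.imp (fun H => ?_) (fun H => ?_) <;> rw [mem_map] <;>
      filter_upwards [H, htar] with u hu hut
    · exact (preimage_arc h hut).2 hu
    · exact fun hu' => hu ((preimage_arc h hut).1 hu')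
  have hsides : ∀ x, Tame (rightSide (e x) x) (arc e₀ a b) ∧
      Tame (leftSide (e x) x) (arc e₀ a b) := by
    intro x
    by_cases hx : x ∈ arc e₀ a b
    · obtain ⟨t, ht, rfl⟩ := hx
      have hr := hpre t (h ht) _ nhdsWithin_le_nhds (tame_right_Icc a b t)
      have hl := hpre t (h ht) _ nhdsWithin_le_nhds (tame_left_Icc a b t)
      have hs : e₀.symm t ∈ e₀.source := e₀.map_target (h ht)
      have h1 : rightSide e₀ (e₀.symm t) = map e₀.symm (𝓝[>] t) := by
        rw [rightSide, e₀.right_inv (h ht)]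
      have h2 : leftSide e₀ (e₀.symm t) = map e₀.symm (𝓝[<] t) := by
        rw [leftSide, e₀.right_inv (h ht)]
      rcases sides_eq (he _) hs with ⟨h3, h4⟩ | ⟨h3, h4⟩ <;> rw [h3, h4, h1, h2]
      · exact ⟨hr, hl⟩
      · exact ⟨hl, hr⟩
    · have := hc.mem_nhds hx
      exact ⟨Or.inr (rightSide_le (he x) this), Or.inr (leftSide_le (he x) this)⟩
  refine ⟨fun x => (hsides x).1, fun x => (hsides x).2, ?_⟩
  refine ((finite_singleton a).insert b |>.image e₀.symm).subset fun x hx => ?_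
  by_cases hxa : x ∈ arc e₀ a b
  · obtain ⟨t, ht, rfl⟩ := hxa
    refine mem_image_of_mem _ ?_
    by_contra hne
    rw [mem_insert_iff, mem_singleton_iff, not_or] at hne
    refine hx (Or.inl (arc_mem_nhds (Icc_mem_nhds ?_ ?_) (h ht)))
    · exact lt_of_le_of_ne ht.1 (Ne.symm hne.2)
    · exact lt_of_le_of_ne ht.2 hne.1
  · exact absurd (Or.inr (hc.mem_nhds hxa)) hx

/-- The sum of the jumps vanishes for a piecewise constant set inside an arc. -/
theorem PiecewiseConstant.finsum_jump_of_subset_arc (he : ∀ x, x ∈ (e x).source)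
    (e₀ : OpenPartialHomeomorph M ℝ≥0) {a b : ℝ≥0} (h : Icc a b ⊆ e₀.target) {A : Set M}
    (hA : PiecewiseConstant e A) (hsub : A ⊆ arc e₀ a b) : ∑ᶠ x, jump (e x) A x = 0 := by
  -- `B` is `A` read on the half line. It is bounded, and by `jump_eq` its jumps are those of `A`,
  -- so `finsum_lineJump` applies.
  set B : Set ℝ≥0 := e₀.target ∩ e₀.symm ⁻¹' A with hB
  have hBI : B ⊆ Icc a b := fun t ht => (preimage_arc h ht.1).1 (hsub ht.2)
  have hmem : ∀ t ∈ e₀.target, ∀ l ≤ 𝓝 t, ind (map e₀.symm l) A = ind l B := by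
    intro t ht l hl
    rw [ind_map]
    have htar : e₀.target ∈ l := hl (e₀.open_target.mem_nhds ht)
    exact ind_congr ⟨fun H => inter_mem htar H, fun H => mem_of_superset H inter_subset_right⟩
  have hj : ∀ t ∈ Icc a b, lineJump B t = jump (e (e₀.symm t)) A (e₀.symm t) := by
    intro t ht
    rw [jump_eq (he _) (e₀.map_target (h ht)), jump, rightSide, leftSide, e₀.right_inv (h ht),
      hmem t (h ht) _ nhdsWithin_le_nhds, hmem t (h ht) _ nhdsWithin_le_nhds, lineJump]
  have hout : ∀ t, t ∉ Icc a b → Bᶜ ∈ 𝓝 t := fun t ht =>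
    mem_of_superset (isClosed_Icc.isOpen_compl.mem_nhds ht) (compl_subset_compl.2 hBI)
  have h1 : ∑ᶠ x, jump (e x) A x = ∑ᶠ (x) (_ : x ∈ arc e₀ a b), jump (e x) A x := by
    refine finsum_congr fun x => ?_
    by_cases hx : x ∈ arc e₀ a b
    · simp [hx]
    · simp only [hx, finsum_false]
      refine jump_of_compl_mem (he x) (mem_of_superset
        ((isClosed_arc h).isOpen_compl.mem_nhds hx) (compl_subset_compl.2 hsub))
  have h2 : ∑ᶠ t, lineJump B t = ∑ᶠ (t) (_ : t ∈ Icc a b), lineJump B t := by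
    refine finsum_congr fun t => ?_
    by_cases ht : t ∈ Icc a b
    · simp [ht]
    · simp only [ht, finsum_false]
      rw [lineJump, ind_of_compl_mem (mem_nhdsWithin_of_mem_nhds (hout t ht)),
        ind_of_compl_mem (mem_nhdsWithin_of_mem_nhds (hout t ht)), add_zero]
  rw [h1, ← finsum_mem_eq_of_bijOn (s := Icc a b) (t := arc e₀ a b)
    (f := lineJump B) e₀.symm
    ((e₀.symm.injOn.mono h).bijOn_image) hj, ← h2]
  refine finsum_lineJump ⟨b, fun t ht => (hBI ht).2⟩ ?_
  refine (hA.finite.image e₀).subset fun t ht => ?_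
  by_cases hI : t ∈ Icc a b
  · refine ⟨e₀.symm t, fun H => ht ?_, e₀.right_inv (h hI)⟩
    have htar := e₀.open_target.mem_nhds (h hI)
    have hmap := e₀.symm.map_nhds_eq (h hI)
    refine H.imp (fun H => ?_) (fun H => ?_) <;> rw [← hmap, mem_map] at H
    · exact inter_mem htar H
    · exact mem_of_superset H fun u hu hu' => hu hu'.2
  · exact absurd (Or.inr (hout t hI)) ht

variable [CompactSpace M]

/-- By compactness finitely many arcs cover `M`. Cutting `A` along one arc at a time reduces to
pieces inside a single arc, because the sum of jumps is additive on disjoint pieces. -/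
theorem PiecewiseConstant.finsum_jump (he : ∀ x, x ∈ (e x).source)
    (hb : {x | e x x = 0}.Finite) {A : Set M} (hA : PiecewiseConstant e A) :
    ∑ᶠ x, jump (e x) A x = 0 := by
  classical
  have harc : ∀ x, ∃ a b, Icc a b ⊆ (e x).target ∧ arc (e x) a b ∈ 𝓝 x := by
    intro x
    obtain ⟨a, b, -, hn, hs⟩ := exists_Icc_mem_subset_of_mem_nhds
      ((e x).open_target.mem_nhds ((e x).map_source (he x)))
    refine ⟨a, b, hs, ?_⟩
    have := arc_mem_nhds hn ((e x).map_source (he x))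
    rwa [(e x).left_inv (he x)] at this
  choose a b hsub hnhds using harc
  obtain ⟨t, ht⟩ := CompactSpace.elim_nhds_subcover _ hnhds
  suffices H : ∀ t : Finset M, ∀ A, PiecewiseConstant e A →
      A ⊆ ⋃ x ∈ t, arc (e x) (a x) (b x) → ∑ᶠ x, jump (e x) A x = 0 from
    H t A hA (by rw [ht]; exact subset_univ _)
  intro t
  induction t using Finset.induction_on with
  | empty =>
    intro A hA h
    have : A = ∅ := by simpa using h
    subst this
    rw [← finsum_zero (α := M)]
    exact finsum_congr fun x => jump_of_compl_mem (he x) (by simp)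
  | insert x t _ ih =>
    intro A hA h
    have hK := arc_piecewiseConstant he (e x) (hsub x)
    have hd : Disjoint (A ∩ arc (e x) (a x) (b x)) (A ∩ (arc (e x) (a x) (b x))ᶜ) :=
      disjoint_compl_right.mono inter_subset_right inter_subset_right
    have hu := (hA.inter hK).finsum_jump_union he hb (hA.inter hK.compl) hd
    rw [inter_union_compl] at hu
    rw [hu, (hA.inter hK).finsum_jump_of_subset_arc he (e x) (hsub x) inter_subset_right, zero_add]
    refine ih _ (hA.inter hK.compl) fun y hy => ?_
    have := h hy.1
    simp only [Finset.mem_insert, iUnion_iUnion_eq_or_left] at this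
    exact this.resolve_left hy.2

/-- A clopen subset of a compact `1`-manifold contains an even number of boundary points. -/
theorem even_ncard_boundary (he : ∀ x, x ∈ (e x).source) (hb : {x | e x x = 0}.Finite)
    {A : Set M} (hA : IsClopen A) : Even (A ∩ {x | e x x = 0}).ncard := by
  classical
  have h0 := (PiecewiseConstant.of_isClopen he hA).finsum_jump he hb
  have h1 : ∀ x, jump (e x) A x = ∑ᶠ (_ : x ∈ A ∩ {x | e x x = 0}), (1 : ZMod 2) := by
    intro x
    by_cases hx : x ∈ A
    · rw [jump_of_mem (he x) (hA.isOpen.mem_nhds hx)]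
      by_cases h : e x x = 0 <;> simp [hx, h]
    · rw [jump_of_compl_mem (he x) (hA.compl.isOpen.mem_nhds hx)]
      simp [hx]
  rw [finsum_congr h1, finsum_mem_eq_finite_toFinset_sum _ (hb.inter_of_right A)] at h0
  rw [← ZMod.natCast_eq_zero_iff_even, ncard_eq_toFinset_card _ (hb.inter_of_right A)]
  simpa using h0

end Global

section EuclideanHalfSpace

/-- The half line. -/
noncomputable def halfLine : EuclideanHalfSpace 1 ≃ₜ ℝ≥0 where
  toFun x := ⟨x.1 0, x.2⟩
  invFun t := ⟨WithLp.toLp 2 fun _ => (t : ℝ), t.2⟩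
  left_inv x := by
    apply Subtype.ext
    ext i
    rw [Subsingleton.elim i 0]
    rfl
  right_inv t := rfl
  continuous_toFun := by fun_prop
  continuous_invFun := by fun_prop

theorem halfLine_eq_zero (y : EuclideanHalfSpace 1) : halfLine y = 0 ↔ y.1 0 = 0 := by
  rw [← NNReal.coe_inj]
  rfl

variable (M : Type*) [TopologicalSpace M] [ChartedSpace (EuclideanHalfSpace 1) M]

theorem mem_boundary_iff (x : M) :
    x ∈ (modelWithCornersEuclideanHalfSpace 1).boundary M ↔
      ((chartAt (EuclideanHalfSpace 1) x).transHomeomorph halfLine) x = 0 := by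
  change _ ∈ frontier _ ↔ _
  rw [frontier_range_modelWithCornersEuclideanHalfSpace]
  exact (eq_comm.trans (halfLine_eq_zero _).symm)

/-- The charts make `M` locally connected, so that compactness leaves only finitely many components.
-/
theorem finite_connectedComponents [CompactSpace M] : Finite (ConnectedComponents M) := by
  have := ChartedSpace.locallyConnectedSpace (EuclideanHalfSpace 1) M
  infer_instance

variable {M}

/-- A compact connected `1`-manifold does not have exactly one boundary point. -/
theorem exists_ne_boundary [T2Space M] [CompactSpace M]
    (hb : ((modelWithCornersEuclideanHalfSpace 1).boundary M).Finite) {x : M}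
    (hx : x ∈ (modelWithCornersEuclideanHalfSpace 1).boundary M) :
    ∃ y ∈ (modelWithCornersEuclideanHalfSpace 1).boundary M, y ≠ x ∧
      ConnectedComponents.mk y = ConnectedComponents.mk x := by
  have := ChartedSpace.locallyConnectedSpace (EuclideanHalfSpace 1) M
  have hA : IsClopen (connectedComponent x) :=
    ⟨isClosed_connectedComponent, isOpen_connectedComponent⟩
  have hset : {y : M | ((chartAt (EuclideanHalfSpace 1) y).transHomeomorph halfLine) y = 0} =
      (modelWithCornersEuclideanHalfSpace 1).boundary M :=
    Set.ext fun y => (mem_boundary_iff M y).symm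
  have hev := even_ncard_boundary (e := fun y : M =>
    (chartAt (EuclideanHalfSpace 1) y).transHomeomorph halfLine)
    (fun y => mem_chart_source _ y) (by rwa [hset]) hA
  rw [hset] at hev
  have hfin := hb.inter_of_right (connectedComponent x)
  have hxm : x ∈ connectedComponent x ∩ (modelWithCornersEuclideanHalfSpace 1).boundary M :=
    ⟨mem_connectedComponent, hx⟩
  -- The count is even, and positive because of `x`.
  have h1 : 1 < (connectedComponent x ∩
      (modelWithCornersEuclideanHalfSpace 1).boundary M).ncard := by
    have hpos := (ncard_pos hfin).2 ⟨x, hxm⟩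
    rcases hev with ⟨r, hr⟩
    omega
  obtain ⟨y, hy, hyx⟩ := exists_ne_of_one_lt_ncard h1 x
  exact ⟨y, hy.2, hyx, ConnectedComponents.coe_eq_coe'.2 hy.1⟩

end EuclideanHalfSpace

end OneManifold

/-! ### Finite sums over sums, products and fibres -/

section Finsum

variable {I J R : Type*} [AddCommMonoid R]

theorem finsum_add [Finite I] (g h : I → R) : ∑ᶠ i, (g i + h i) = ∑ᶠ i, g i + ∑ᶠ i, h i :=
  finsum_add_distrib (Set.toFinite _) (Set.toFinite _)

theorem finsum_sumType [Finite I] [Finite J] (g : I ⊕ J → R) :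
    ∑ᶠ x, g x = ∑ᶠ i, g (Sum.inl i) + ∑ᶠ j, g (Sum.inr j) := by
  have := Fintype.ofFinite I
  have := Fintype.ofFinite J
  simp only [finsum_eq_sum_of_fintype, Fintype.sum_sum_type]

theorem finsum_sigmaType {β : I → Type*} [Finite I] [∀ i, Finite (β i)] (g : (Σ i, β i) → R) :
    ∑ᶠ x, g x = ∑ᶠ i, ∑ᶠ y, g ⟨i, y⟩ := by
  have := Fintype.ofFinite I
  have := fun i => Fintype.ofFinite (β i)
  simp only [finsum_eq_sum_of_fintype, Fintype.sum_sigma]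

theorem finsum_prodType [Finite I] [Finite J] (g : I × J → R) :
    ∑ᶠ x, g x = ∑ᶠ i, ∑ᶠ j, g (i, j) := by
  have := Fintype.ofFinite I
  have := Fintype.ofFinite J
  simp only [finsum_eq_sum_of_fintype, Fintype.sum_prod_type]

theorem finsum_const_zmod [Finite I] (c : ZMod 2) : ∑ᶠ _ : I, c = Nat.card I * c := by
  have := Fintype.ofFinite I
  simp [finsum_eq_sum_of_fintype]

theorem finsum_fiber [Finite I] [Finite J] (π : I → J) (g : I → R) :
    ∑ᶠ j, ∑ᶠ (i) (_ : π i = j), g i = ∑ᶠ i, g i := by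
  classical
  have := Fintype.ofFinite I
  have := Fintype.ofFinite J
  simp only [finsum_eq_sum_of_fintype, finsum_eq_if]
  rw [Finset.sum_comm]
  simp

end Finsum

/-! ### Permutation parity and relative parity of oriented matchings -/

namespace Matching

open Equiv

section PermPar

variable {V W : Type*} [Finite V] [Finite W]

open Classical in
/-- The sign of a permutation as an element of `ZMod 2`. -/
noncomputable def permPar (σ : Perm V) : ZMod 2 :=
  letI := Fintype.ofFinite V
  if Perm.sign σ = 1 then 0 else 1

theorem permPar_def [Fintype V] [DecidableEq V] (σ : Perm V) :
    permPar σ = if Perm.sign σ = 1 then 0 else 1 := by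
  unfold permPar
  congr!

theorem permPar_trans (σ τ : Perm V) : permPar (σ.trans τ) = permPar σ + permPar τ := by
  classical
  have := Fintype.ofFinite V
  simp only [permPar_def, Perm.sign_trans]
  rcases Int.units_eq_one_or (Perm.sign σ) with h | h <;>
    rcases Int.units_eq_one_or (Perm.sign τ) with h' | h' <;> rw [h, h'] <;> decide

@[simp] theorem permPar_refl : permPar (Equiv.refl V) = 0 := by
  classical
  have := Fintype.ofFinite V
  simp [permPar_def]

theorem permPar_congr (e : V ≃ W) (σ : Perm V) (τ : Perm W) (h : ∀ x, e (σ x) = τ (e x)) :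
    permPar σ = permPar τ := by
  classical
  have := Fintype.ofFinite V
  have := Fintype.ofFinite W
  simp only [permPar_def, Perm.sign_eq_sign_of_equiv σ τ e h]

theorem permPar_swap [DecidableEq V] {x y : V} (h : x ≠ y) : permPar (swap x y) = 1 := by
  have := Fintype.ofFinite V
  simp [permPar_def, Perm.sign_swap h]

theorem permPar_sumCongr (σ : Perm V) (τ : Perm W) :
    permPar (V := V ⊕ W) (σ.sumCongr τ) = permPar σ + permPar τ := by
  classical
  have := Fintype.ofFinite V
  have := Fintype.ofFinite W
  simp only [permPar_def]
  rw [show Perm.sign (σ.sumCongr τ) = Perm.sign σ * Perm.sign τ from Perm.sign_sumCongr σ τ]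
  rcases Int.units_eq_one_or (Perm.sign σ) with h | h <;>
    rcases Int.units_eq_one_or (Perm.sign τ) with h' | h' <;> rw [h, h'] <;> decide

/-- Induction on a finite set of blocks outside which `σ` is the identity. Peeling off one block
leaves a permutation extended by the identity, which keeps its sign. -/
theorem permPar_sigma {B : Type*} {W : B → Type*} [Finite B] [∀ b, Finite (W b)]
    (σ : ∀ b, Perm (W b)) : permPar (Equiv.sigmaCongrRight σ) = ∑ᶠ b, permPar (σ b) := by
  classical
  have := Fintype.ofFinite B
  have := fun b => Fintype.ofFinite (W b)
  suffices H : ∀ s : Finset B, ∀ σ : ∀ b, Perm (W b), (∀ b, b ∉ s → σ b = Equiv.refl _) →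
      permPar (Equiv.sigmaCongrRight σ) = ∑ b ∈ s, permPar (σ b) by
    rw [finsum_eq_sum_of_fintype]
    exact H _ _ fun b hb => absurd (Finset.mem_univ b) hb
  intro s
  induction s using Finset.induction_on with
  | empty =>
    intro σ h
    have : Equiv.sigmaCongrRight σ = Equiv.refl _ := by
      ext1 ⟨b, x⟩
      simp [h b]
    rw [this]
    simp
  | insert b s hb ih =>
    intro σ h
    have hsplit : Equiv.sigmaCongrRight σ =
        (Equiv.sigmaCongrRight (Function.update σ b (Equiv.refl _))).trans
          (Equiv.sigmaCongrRight (Function.update (fun b => Equiv.refl (W b)) b (σ b))) := by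
      ext1 ⟨c, x⟩
      by_cases hc : c = b
      · subst hc
        simp
      · simp [hc]
    rw [hsplit, permPar_trans, ih, Finset.sum_insert hb, add_comm]
    · congr 1
      · let e : W b ≃ {x : Σ b, W b // x.1 = b} := (Equiv.sigmaSubtype b).symm
        have : Equiv.sigmaCongrRight (Function.update (fun b => Equiv.refl (W b)) b (σ b)) =
            (σ b).extendDomain e := by
          ext1 ⟨c, x⟩
          by_cases hc : c = b
          · subst hc
            have : (⟨c, x⟩ : Σ b, W b) = (e x : Σ b, W b) := rfl
            rw [this, Perm.extendDomain_apply_image]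
            simp [e, Equiv.sigmaSubtype]
          · refine Eq.trans ?_
              (Perm.extendDomain_apply_not_subtype (σ b) e (b := (⟨c, x⟩ : Σ b, W b)) hc).symm
            simp [hc]
        rw [this, permPar_def, permPar_def, Perm.sign_extendDomain]
      · refine Finset.sum_congr rfl fun c hc => ?_
        rw [Function.update_of_ne]
        rintro rfl
        exact hb hc
    · intro c hc
      by_cases hcb : c = b
      · subst hcb
        simp
      · rw [Function.update_of_ne hcb]
        exact h c (by simp [hc, hcb])

end PermPar

section Unions

variable {V V' I J : Type*}

/-- The union of a family of oriented matchings. -/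
def sigmaMatch {B : Type*} {W L : B → Type*} (p : ∀ b, L b ⊕ L b ≃ W b) :
    (Σ b, L b) ⊕ (Σ b, L b) ≃ Σ b, W b :=
  (Equiv.sigmaSumDistrib _ _).symm.trans (Equiv.sigmaCongrRight p)

@[simp] theorem sigmaMatch_inl {B : Type*} {W L : B → Type*} (p : ∀ b, L b ⊕ L b ≃ W b)
    (b : B) (i : L b) : sigmaMatch p (Sum.inl ⟨b, i⟩) = ⟨b, p b (Sum.inl i)⟩ := rfl

@[simp] theorem sigmaMatch_inr {B : Type*} {W L : B → Type*} (p : ∀ b, L b ⊕ L b ≃ W b)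
    (b : B) (i : L b) : sigmaMatch p (Sum.inr ⟨b, i⟩) = ⟨b, p b (Sum.inr i)⟩ := rfl

/-- The disjoint union of two oriented matchings. -/
def sumMatch (p : I ⊕ I ≃ V) (q : J ⊕ J ≃ V') : (I ⊕ J) ⊕ (I ⊕ J) ≃ V ⊕ V' :=
  (Equiv.sumSumSumComm I J I J).trans (p.sumCongr q)

@[simp] theorem sumMatch_inl_inl (p : I ⊕ I ≃ V) (q : J ⊕ J ≃ V') (i : I) :
    sumMatch p q (Sum.inl (Sum.inl i)) = Sum.inl (p (Sum.inl i)) := rfl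

@[simp] theorem sumMatch_inl_inr (p : I ⊕ I ≃ V) (q : J ⊕ J ≃ V') (j : J) :
    sumMatch p q (Sum.inl (Sum.inr j)) = Sum.inr (q (Sum.inl j)) := rfl

@[simp] theorem sumMatch_inr_inl (p : I ⊕ I ≃ V) (q : J ⊕ J ≃ V') (i : I) :
    sumMatch p q (Sum.inr (Sum.inl i)) = Sum.inl (p (Sum.inr i)) := rfl

@[simp] theorem sumMatch_inr_inr (p : I ⊕ I ≃ V) (q : J ⊕ J ≃ V') (j : J) :
    sumMatch p q (Sum.inr (Sum.inr j)) = Sum.inr (q (Sum.inr j)) := rfl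

theorem nonempty_equiv [Finite I] [Finite J] (p : I ⊕ I ≃ V) (q : J ⊕ J ≃ V) : Nonempty (I ≃ J) := by
  have h := Nat.card_congr (p.trans q.symm)
  rw [Nat.card_sum, Nat.card_sum] at h
  exact Finite.card_eq.1 (by omega)

end Unions

section RelPar

variable {V V' : Type*} {I J K I' J' : Type*} [Finite V] [Finite V']
  [Finite I] [Finite J] [Finite K] [Finite I'] [Finite J']

/-- The sign of a permutation which maps one oriented perfect matching to another. The matchings
are given by listing the tails and the heads of their edges. -/
noncomputable def relPar (p : I ⊕ I ≃ V) (q : J ⊕ J ≃ V) : ZMod 2 :=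
  permPar (p.symm.trans (((nonempty_equiv p q).some.sumCongr (nonempty_equiv p q).some).trans q))

/-- Two bijections of the edges differ by a permutation acting identically on tails and on heads,
whose parity is counted twice and so vanishes. -/
theorem relPar_eq (p : I ⊕ I ≃ V) (q : J ⊕ J ≃ V) (e : I ≃ J) :
    relPar p q = permPar (p.symm.trans ((e.sumCongr e).trans q)) := by
  set e' := (nonempty_equiv p q).some with he'
  have h : p.symm.trans ((e'.sumCongr e').trans q) =
      (p.symm.trans ((e.sumCongr e).trans q)).trans
        (q.symm.trans (((e.symm.trans e').sumCongr (e.symm.trans e')).trans q)) := by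
    ext x
    rcases hx : p.symm x with i | i <;> simp [hx]
  have h' : permPar (q.symm.trans
      (((e.symm.trans e').sumCongr (e.symm.trans e')).trans q)) = 0 := by
    rw [← permPar_congr q ((e.symm.trans e').sumCongr (e.symm.trans e') : Perm (J ⊕ J)) _
        fun x => by rw [trans_apply, trans_apply, symm_apply_apply],
      permPar_sumCongr, CharTwo.add_self_eq_zero]
  rw [relPar, ← he', h, permPar_trans, h', add_zero]

theorem relPar_eq_permPar (p : I ⊕ I ≃ V) (q : J ⊕ J ≃ V) (σ : Perm V) (e : I ≃ J)
    (hl : ∀ i, σ (p (Sum.inl i)) = q (Sum.inl (e i)))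
    (hr : ∀ i, σ (p (Sum.inr i)) = q (Sum.inr (e i))) : relPar p q = permPar σ := by
  rw [relPar_eq p q e]
  congr 1
  ext x
  obtain ⟨y, rfl⟩ := p.surjective x
  rcases y with i | i <;> simp [hl, hr]

@[simp] theorem relPar_self (p : I ⊕ I ≃ V) : relPar p p = 0 := by
  have : p.symm.trans ((Equiv.sumCongr (Equiv.refl I) (Equiv.refl I)).trans p) = Equiv.refl V := by
    ext x
    simp
  rw [relPar_eq p p (Equiv.refl I), this, permPar_refl]

theorem relPar_trans (p : I ⊕ I ≃ V) (q : J ⊕ J ≃ V) (r : K ⊕ K ≃ V) :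
    relPar p q + relPar q r = relPar p r := by
  obtain ⟨e⟩ := nonempty_equiv p q
  obtain ⟨e'⟩ := nonempty_equiv q r
  rw [relPar_eq p q e, relPar_eq q r e', relPar_eq p r (e.trans e'), ← permPar_trans]
  congr 1
  ext x
  rcases hx : p.symm x with i | i <;> simp [hx]

theorem relPar_comm (p : I ⊕ I ≃ V) (q : J ⊕ J ≃ V) : relPar p q = relPar q p := by
  have h := relPar_trans p q p
  rw [relPar_self] at h
  exact (CharTwo.add_eq_zero.1 h)

/-- Invariance under relabelling of vertices and edges. It is the tool for all later identifications
of matchings, whose hypotheses mostly hold by `rfl`. -/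
theorem relPar_congr (p : I ⊕ I ≃ V) (q : J ⊕ J ≃ V) (p' : I' ⊕ I' ≃ V') (q' : J' ⊕ J' ≃ V')
    (E : V ≃ V') (eI : I ≃ I') (eJ : J ≃ J')
    (hp : ∀ x, E (p x) = p' (Sum.map eI eI x)) (hq : ∀ x, E (q x) = q' (Sum.map eJ eJ x)) :
    relPar p q = relPar p' q' := by
  obtain ⟨e⟩ := nonempty_equiv p q
  rw [relPar_eq p q e, relPar_eq p' q' (eI.symm.trans (e.trans eJ))]
  refine permPar_congr E _ _ fun x => ?_
  obtain ⟨y, rfl⟩ := p.surjective x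
  simp only [trans_apply, symm_apply_apply, hp, hq]
  rcases y with i | i <;> simp

theorem relPar_sigmaMatch {B : Type*} {W L N : B → Type*} [Finite B] [∀ b, Finite (W b)]
    [∀ b, Finite (L b)] [∀ b, Finite (N b)] (p : ∀ b, L b ⊕ L b ≃ W b)
    (q : ∀ b, N b ⊕ N b ≃ W b) :
    relPar (sigmaMatch p) (sigmaMatch q) = ∑ᶠ b, relPar (p b) (q b) := by
  have e := fun b => (nonempty_equiv (p b) (q b)).some
  rw [finsum_congr fun b => relPar_eq (p b) (q b) (e b), ← permPar_sigma]
  refine relPar_eq_permPar _ _ _ (Equiv.sigmaCongrRight e) ?_ ?_ <;> rintro ⟨b, i⟩ <;> simp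

theorem relPar_sumMatch (p : I ⊕ I ≃ V) (q : J ⊕ J ≃ V) (p' : I' ⊕ I' ≃ V') (q' : J' ⊕ J' ≃ V') :
    relPar (sumMatch p p') (sumMatch q q') = relPar p q + relPar p' q' := by
  obtain ⟨e⟩ := nonempty_equiv p q
  obtain ⟨e'⟩ := nonempty_equiv p' q'
  rw [relPar_eq _ _ e, relPar_eq _ _ e', ← permPar_sumCongr]
  refine relPar_eq_permPar _ _ _ (e.sumCongr e') ?_ ?_ <;> rintro (i | i) <;> simp

/-- Reversing some edges of an oriented matching. -/
theorem relPar_flip (p p' : I ⊕ I ≃ V) (c : I → ZMod 2)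
    (h0 : ∀ i, c i = 0 → p' (Sum.inl i) = p (Sum.inl i) ∧ p' (Sum.inr i) = p (Sum.inr i))
    (h1 : ∀ i, c i = 1 → p' (Sum.inl i) = p (Sum.inr i) ∧ p' (Sum.inr i) = p (Sum.inl i)) :
    relPar p p' = ∑ᶠ i, c i := by
  classical
  have hc : ∀ i, c i = 0 ∨ c i = 1 := fun i => by
    generalize c i = x
    revert x
    decide
  -- The vertex set splits into one two-point block per edge; a reversed edge contributes a
  -- transposition.
  let σ : I → Perm Bool := fun i => if c i = 0 then Equiv.refl _ else swap true false
  have hσ : ∀ i, permPar (σ i) = c i := by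
    intro i
    rcases hc i with h | h
    · simp [σ, h]
    · simp [σ, h, permPar_swap]
  rw [relPar_eq p p' (Equiv.refl I), ← finsum_congr hσ, ← permPar_sigma]
  let E : (Σ _ : I, Bool) ≃ V :=
    ((Equiv.sigmaEquivProd I Bool).trans (Equiv.prodComm I Bool)).trans
      ((Equiv.boolProdEquivSum I).trans p)
  symm
  refine permPar_congr E _ _ fun x => ?_
  rcases x with ⟨i, b⟩
  have hE : ∀ b, E ⟨i, b⟩ = p (bif b then Sum.inr i else Sum.inl i) := by
    intro b
    cases b <;> rfl
  rcases hc i with h | h <;> cases b <;> simp [hE, σ, h, h0, h1]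

/-- The two matchings of a product which come from matchings of the factors. -/
theorem relPar_prod (p : I ⊕ I ≃ V) (q : J ⊕ J ≃ V') (P : (I × V') ⊕ (I × V') ≃ V × V')
    (Q : (V × J) ⊕ (V × J) ≃ V × V') (hPl : ∀ i y, P (Sum.inl (i, y)) = (p (Sum.inl i), y))
    (hPr : ∀ i y, P (Sum.inr (i, y)) = (p (Sum.inr i), y))
    (hQl : ∀ x j, Q (Sum.inl (x, j)) = (x, q (Sum.inl j)))
    (hQr : ∀ x j, Q (Sum.inr (x, j)) = (x, q (Sum.inr j))) :
    relPar P Q = Nat.card I * Nat.card J := by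
  classical
  let e : I × V' ≃ V × J :=
    { toFun := fun x => (match q.symm x.2 with
        | Sum.inl j => (p (Sum.inl x.1), j)
        | Sum.inr j => (p (Sum.inr x.1), j))
      invFun := fun y => (match p.symm y.1 with
        | Sum.inl i => (i, q (Sum.inl y.2))
        | Sum.inr i => (i, q (Sum.inr y.2)))
      left_inv := by
        rintro ⟨i, y⟩
        obtain ⟨z, rfl⟩ := q.surjective y
        rcases z with j | j <;> simp
      right_inv := by
        rintro ⟨x, j⟩
        obtain ⟨z, rfl⟩ := p.surjective x
        rcases z with i | i <;> simp }
  have el : ∀ i j, e (i, q (Sum.inl j)) = (p (Sum.inl i), j) := fun i j => by simp [e]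
  have er : ∀ i j, e (i, q (Sum.inr j)) = (p (Sum.inr i), j) := fun i j => by simp [e]
  -- An edge of `p` and an edge of `q` span a rectangle. Exchanging its two mixed corners carries
  -- the pair of edges parallel to the first factor to the pair parallel to the second, preserving
  -- orientation; so each rectangle contributes one transposition.
  let σ : I × J → Perm (Bool × Bool) := fun _ => swap (true, false) (false, true)
  have hσ : ∀ x, permPar (σ x) = 1 := fun x => permPar_swap (by decide)
  let E : (Σ _ : I × J, Bool × Bool) ≃ V × V' :=
    { toFun := fun x => (p (bif x.2.1 then Sum.inr x.1.1 else Sum.inl x.1.1),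
        q (bif x.2.2 then Sum.inr x.1.2 else Sum.inl x.1.2))
      invFun := fun y => (match p.symm y.1, q.symm y.2 with
        | Sum.inl i, Sum.inl j => ⟨(i, j), (false, false)⟩
        | Sum.inr i, Sum.inl j => ⟨(i, j), (true, false)⟩
        | Sum.inl i, Sum.inr j => ⟨(i, j), (false, true)⟩
        | Sum.inr i, Sum.inr j => ⟨(i, j), (true, true)⟩)
      left_inv := by
        rintro ⟨⟨i, j⟩, b, b'⟩
        cases b <;> cases b' <;> simp
      right_inv := by
        rintro ⟨x, y⟩
        obtain ⟨x, rfl⟩ := p.surjective x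
        obtain ⟨y, rfl⟩ := q.surjective y
        rcases x with i | i <;> rcases y with j | j <;> simp }
  have hsum : ∑ᶠ x : I × J, permPar (σ x) = Nat.card I * Nat.card J := by
    rw [finsum_congr hσ, finsum_const_zmod, Nat.card_prod]
    push_cast
    ring
  rw [relPar_eq P Q e, ← hsum, ← permPar_sigma]
  symm
  refine permPar_congr E _ _ fun x => ?_
  rcases x with ⟨⟨i, j⟩, b, b'⟩
  have hPl' : ∀ i y, P.symm (p (Sum.inl i), y) = Sum.inl (i, y) := fun i y => by
    rw [Equiv.symm_apply_eq, hPl]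
  have hPr' : ∀ i y, P.symm (p (Sum.inr i), y) = Sum.inr (i, y) := fun i y => by
    rw [Equiv.symm_apply_eq, hPr]
  have s1 : swap (true, false) (false, true) (false, false) = (false, false) := by decide
  have s2 : swap (true, false) (false, true) (true, true) = (true, true) := by decide
  cases b <;> cases b' <;> simp [E, σ, hPl', hPr', el, er, hQl, hQr, s1, s2]

end RelPar

end Matching

/-! ### Alternating circles in the union of two matchings -/

namespace Matching

open Equiv

theorem zmod_two_cases (x : ZMod 2) : x = 0 ∨ x = 1 := by
  revert x
  decide

section Cycles

variable {V : Type*} [Finite V]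

/-- The sign of `τ` is -1 to the power of the support size plus the number of cycles. Here the
support is all of `V`, hence even, and the classes of `r` are the cycles. -/
theorem card_quot_eq_permPar (τ : Perm V) (hτ : ∀ x, τ x ≠ x) (hV : Even (Nat.card V))
    {r : V → V → Prop} (h1 : ∀ x, Relation.EqvGen r x (τ x))
    (h2 : ∀ x y, r x y → τ.SameCycle x y) : (Nat.card (Quot r) : ZMod 2) = permPar τ := by
  classical
  have := Fintype.ofFinite V
  have hsupp : τ.support = Finset.univ := by
    ext x
    simp [hτ]
  let g : Quot r → τ.cycleFactorsFinset := Quot.lift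
    (fun x => ⟨τ.cycleOf x, Perm.cycleOf_mem_cycleFactorsFinset_iff.2 (by simp [hsupp])⟩)
    fun x y h => Subtype.ext (h2 x y h).cycleOf_eq
  have hg : Function.Bijective g := by
    constructor
    · rintro ⟨x⟩ ⟨y⟩ h
      have hxy : τ.cycleOf x = τ.cycleOf y := congrArg Subtype.val h
      have hs : τ.SameCycle x y := by
        have hy : y ∈ (τ.cycleOf x).support := by
          rw [hxy, Perm.mem_support_cycleOf_iff]
          exact ⟨Perm.SameCycle.refl _ _, by simp [hsupp]⟩
        exact (Perm.mem_support_cycleOf_iff.1 hy).1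
      obtain ⟨n, -, hn⟩ := hs.exists_pow_eq'
      refine Quot.eqvGen_sound ?_
      rw [← hn]
      clear hn
      induction n with
      | zero => exact Relation.EqvGen.refl _
      | succ n ih =>
        rw [pow_succ', Perm.mul_apply]
        exact ih.trans _ _ _ (h1 _)
    · rintro ⟨c, hc⟩
      obtain ⟨x, hx⟩ := (Perm.mem_cycleFactorsFinset_iff.1 hc).1.nonempty_support
      exact ⟨Quot.mk _ x, Subtype.ext (Perm.cycle_is_cycleOf hx hc).symm⟩
  have hcard : Nat.card (Quot r) = Multiset.card τ.cycleType := by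
    rw [Nat.card_congr (Equiv.ofBijective g hg), Perm.cycleType_def, Multiset.card_map]
    simp
  have hsign : Perm.sign τ = (-1) ^ (Nat.card (Quot r)) := by
    rw [Perm.sign_of_cycleType, Perm.sum_cycleType, hsupp, Finset.card_univ,
      ← Nat.card_eq_fintype_card, pow_add, hV.neg_one_pow, one_mul, hcard]
  rw [permPar_def, hsign]
  rcases Nat.even_or_odd (Nat.card (Quot r)) with h | h
  · rw [h.neg_one_pow, if_pos rfl]
    exact (ZMod.natCast_eq_zero_iff_even).2 h
  · rw [h.neg_one_pow, if_neg (by decide)]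
    exact (ZMod.natCast_eq_one_iff_odd).2 h

end Cycles

section Colouring

variable {V I J : Type*}

/-- Two vertices are joined by an edge of one of two matchings. -/
def Joined (p : I ⊕ I ≃ V) (q : J ⊕ J ≃ V) (x y : V) : Prop :=
  (∃ i, x = p (Sum.inl i) ∧ y = p (Sum.inr i)) ∨ ∃ j, x = q (Sum.inl j) ∧ y = q (Sum.inr j)

/-- A colouring of the vertices of the union of two matchings with alternating colours. -/
structure IsColouring (p : I ⊕ I ≃ V) (q : J ⊕ J ≃ V) (c : V → ZMod 2) : Prop where
  left : ∀ i, c (p (Sum.inr i)) = 1 + c (p (Sum.inl i))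
  right : ∀ j, c (q (Sum.inr j)) = 1 + c (q (Sum.inl j))

/-- The permutation which exchanges the end points of every edge of a matching. -/
def partner (p : I ⊕ I ≃ V) : Perm V := p.symm.trans ((Equiv.sumComm I I).trans p)

@[simp] theorem partner_inl (p : I ⊕ I ≃ V) (i : I) :
    partner p (p (Sum.inl i)) = p (Sum.inr i) := by simp [partner]

@[simp] theorem partner_inr (p : I ⊕ I ≃ V) (i : I) :
    partner p (p (Sum.inr i)) = p (Sum.inl i) := by simp [partner]

@[simp] theorem partner_mul_self (p : I ⊕ I ≃ V) : partner p * partner p = 1 := by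
  ext x
  obtain ⟨y, rfl⟩ := p.surjective x
  rcases y with i | i <;> simp

theorem partner_ne (p : I ⊕ I ≃ V) (x : V) : partner p x ≠ x := by
  obtain ⟨y, rfl⟩ := p.surjective x
  rcases y with i | i <;> simp

/-- In the group generated by two involutions without fixed points, reflections have no fixed
points. -/
theorem not_sameCycle_partner (p : I ⊕ I ≃ V) (q : J ⊕ J ≃ V) (x : V) :
    ¬ (partner p * partner q).SameCycle x (partner p x) := by
  set α := partner p
  set β := partner q
  have hα : α * α = 1 := partner_mul_self p
  have hβ : β * β = 1 := partner_mul_self q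
  have hα' : α⁻¹ = α := inv_eq_of_mul_eq_one_right hα
  have hβ' : β⁻¹ = β := inv_eq_of_mul_eq_one_right hβ
  set ρ := α * β with hρ
  have hρ' : ρ⁻¹ = β * α := by rw [hρ, mul_inv_rev, hα', hβ']
  have hαρ : ∀ m : ℤ, α * ρ ^ m = ρ ^ (-m) * α := by
    intro m
    have : α * ρ * α⁻¹ = ρ⁻¹ := by
      rw [hρ', hα', hρ, ← mul_assoc, hα, one_mul]
    rw [zpow_neg, ← inv_zpow, ← this, conj_zpow]
    simp
  have hβρ : ∀ m : ℤ, β * ρ ^ m = ρ ^ (-m) * β := by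
    intro m
    have : β * ρ * β⁻¹ = ρ⁻¹ := by
      rw [hρ', hβ', hρ, mul_assoc, mul_assoc, hβ, mul_one]
    rw [zpow_neg, ← inv_zpow, ← this, conj_zpow]
    simp
  rintro ⟨n, hn⟩
  -- Dihedral group argument: if a reflection moved `x` along its rotation orbit, the point halfway
  -- would be fixed by `partner p` or by `partner q`, according to the parity of `n`.
  rcases Int.even_or_odd' n with ⟨m, rfl | rfl⟩
  · apply partner_ne p ((ρ ^ m) x)
    change (α * ρ ^ m) x = _
    rw [hαρ, Perm.mul_apply, ← hn, ← Perm.mul_apply, ← zpow_add]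
    congr 2
    ring
  · apply partner_ne q ((ρ ^ m) x)
    have h : β x = (ρ ^ (2 * m)) x := by
      have h1 : ρ (β x) = α x := by
        rw [← Perm.mul_apply, hρ, mul_assoc, hβ, mul_one]
      rw [← hn, add_comm, zpow_add, zpow_one, Perm.mul_apply] at h1
      exact ρ.injective h1
    change (β * ρ ^ m) x = _
    rw [hβρ, Perm.mul_apply, h, ← Perm.mul_apply, ← zpow_add]
    congr 2
    ring

/-- A component is the union of two cycles of the rotation `ρ`, exchanged by `partner p`; they are
distinct by `not_sameCycle_partner`. Colour `0` marks the cycle of a chosen representative of the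
component. -/
theorem exists_isColouring (p : I ⊕ I ≃ V) (q : J ⊕ J ≃ V) : ∃ c, IsColouring p q c := by
  classical
  set ρ := partner p * partner q with hρ
  let rep : V → V := fun x => (Quot.mk (Joined p q) x).out
  have hrep : ∀ x y, Joined p q x y → rep x = rep y := fun x y h =>
    congrArg Quot.out (Quot.sound h)
  have step : ∀ x y : V, ρ.SameCycle x y ∨ ρ.SameCycle x (partner p y) →
      ρ.SameCycle x (partner p y) ∨ ρ.SameCycle x (partner p (partner p y)) := by
    intro x y h
    rw [← Perm.mul_apply (partner p) (partner p), partner_mul_self]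
    exact h.symm
  have step' : ∀ x y : V, ρ.SameCycle x y ∨ ρ.SameCycle x (partner p y) →
      ρ.SameCycle x (partner q y) ∨ ρ.SameCycle x (partner p (partner q y)) := by
    rintro x y (h | h)
    · right
      rw [← Perm.mul_apply, ← hρ]
      exact Perm.sameCycle_apply_right.2 h
    · left
      have : ρ (partner q y) = partner p y := by
        rw [← Perm.mul_apply, hρ, mul_assoc, partner_mul_self, mul_one]
      rw [← this] at h
      exact Perm.sameCycle_apply_right.1 h
  have hj : ∀ x y z : V, Joined p q y z → (ρ.SameCycle x y ∨ ρ.SameCycle x (partner p y) ↔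
      ρ.SameCycle x z ∨ ρ.SameCycle x (partner p z)) := by
    rintro x y z (⟨i, rfl, rfl⟩ | ⟨j, rfl, rfl⟩)
    · have h1 := step x (p (Sum.inl i))
      have h2 := step x (p (Sum.inr i))
      rw [partner_inl] at h1 ⊢
      rw [partner_inr] at h1 h2 ⊢
      exact or_comm
    · have h1 := step' x (q (Sum.inl j))
      have h2 := step' x (q (Sum.inr j))
      rw [partner_inl] at h1
      rw [partner_inr] at h2
      exact ⟨h1, h2⟩
  have hor : ∀ x, ρ.SameCycle (rep x) x ∨ ρ.SameCycle (rep x) (partner p x) := by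
    intro x
    have hgen : Relation.EqvGen (Joined p q) (rep x) x := Quot.eqvGen_exact (Quot.out_eq _)
    suffices H : ∀ y z, Relation.EqvGen (Joined p q) y z → ∀ w,
        (ρ.SameCycle w y ∨ ρ.SameCycle w (partner p y) ↔
          ρ.SameCycle w z ∨ ρ.SameCycle w (partner p z)) from
      (H _ _ hgen (rep x)).1 (Or.inl (Perm.SameCycle.refl _ _))
    intro y z h
    induction h with
    | rel y z h => exact fun w => hj w y z h
    | refl y => exact fun w => Iff.rfl
    | symm y z _ ih => exact fun w => (ih w).symm
    | trans y z t _ _ ih ih' => exact fun w => (ih w).trans (ih' w)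
  let c : V → ZMod 2 := fun x => if ρ.SameCycle (rep x) x then 0 else 1
  have hflip : ∀ x y, rep x = rep y → (ρ.SameCycle (rep x) x ↔ ¬ ρ.SameCycle (rep x) y) →
      c y = 1 + c x := by
    intro x y h h'
    simp only [c, ← h]
    by_cases hx : ρ.SameCycle (rep x) x
    · rw [if_neg (h'.1 hx), if_pos hx, add_zero]
    · rw [if_pos (not_not.1 fun hy => hx (h'.2 hy)), if_neg hx]
      decide
  have hnot : ∀ x, ρ.SameCycle (rep x) x ↔ ¬ ρ.SameCycle (rep x) (partner p x) := fun x =>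
    ⟨fun h h' => not_sameCycle_partner p q x (h.symm.trans h'), fun h => (hor x).resolve_right h⟩
  refine ⟨c, fun i => ?_, fun j => ?_⟩
  · refine hflip _ _ (hrep _ _ (Or.inl ⟨i, rfl, rfl⟩)) ?_
    have := hnot (p (Sum.inl i))
    rwa [partner_inl] at this
  · have hr := hrep _ _ (Or.inr ⟨j, rfl, rfl⟩ : Joined p q (q (Sum.inl j)) (q (Sum.inr j)))
    refine hflip _ _ hr ?_
    have h1 := hnot (q (Sum.inl j))
    have : ρ (q (Sum.inr j)) = partner p (q (Sum.inl j)) := by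
      rw [hρ, Perm.mul_apply, partner_inr]
    rwa [← this, Perm.sameCycle_apply_right] at h1

/-- Reversing the edges with a tail of colour `1`. -/
theorem exists_reorient (p : I ⊕ I ≃ V) (c : V → ZMod 2)
    (hc : ∀ i, c (p (Sum.inr i)) = 1 + c (p (Sum.inl i))) :
    ∃ p' : I ⊕ I ≃ V,
      (∀ i, c (p (Sum.inl i)) = 0 →
        p' (Sum.inl i) = p (Sum.inl i) ∧ p' (Sum.inr i) = p (Sum.inr i)) ∧
      (∀ i, c (p (Sum.inl i)) = 1 →
        p' (Sum.inl i) = p (Sum.inr i) ∧ p' (Sum.inr i) = p (Sum.inl i)) ∧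
      (∀ i, c (p' (Sum.inl i)) = 0) ∧ ∀ i, c (p' (Sum.inr i)) = 1 := by
  classical
  let σ : I ⊕ I → I ⊕ I := fun x => if c (p (Sum.inl (x.elim id id))) = 0 then x else x.swap
  have hσ : Function.Involutive σ := by
    rintro (i | i) <;> by_cases h : c (p (Sum.inl i)) = 0 <;> simp [σ, h]
  have h0 : ∀ i, c (p (Sum.inl i)) = 0 → hσ.toPerm σ (Sum.inl i) = Sum.inl i ∧
      hσ.toPerm σ (Sum.inr i) = Sum.inr i := fun i h => by simp [σ, h]
  have h1 : ∀ i, c (p (Sum.inl i)) = 1 → hσ.toPerm σ (Sum.inl i) = Sum.inr i ∧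
      hσ.toPerm σ (Sum.inr i) = Sum.inl i := fun i h => by simp [σ, h]
  refine ⟨(hσ.toPerm σ).trans p, fun i h => ?_, fun i h => ?_, fun i => ?_, fun i => ?_⟩
  · simp [h0 i h]
  · simp [h1 i h]
  · rcases zmod_two_cases (c (p (Sum.inl i))) with h | h
    · simp [h0 i h, h]
    · simp only [trans_apply, (h1 i h).1, hc, h]
      decide
  · rcases zmod_two_cases (c (p (Sum.inl i))) with h | h
    · simp [h0 i h, hc, h]
    · simp [h1 i h, h]

/-- Applied to two matchings of the same vertices, this moves sums from the edges of one kind to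
those of the other. -/
theorem finsum_matching [Finite I] {R : Type*} [AddCommMonoid R] (p : I ⊕ I ≃ V) (g : V → R) :
    ∑ᶠ x, g x = ∑ᶠ i, (g (p (Sum.inl i)) + g (p (Sum.inr i))) := by
  rw [← finsum_comp_equiv p, finsum_sumType, finsum_add]

variable [Finite V] [Finite I] [Finite J]

/-- The number of components of the union of two matchings. -/
theorem relPar_eq_card_quot (p : I ⊕ I ≃ V) (q : J ⊕ J ≃ V) {c : V → ZMod 2}
    (hc : IsColouring p q c) {r : V → V → Prop}
    (h1 : ∀ x y, Joined p q x y → Relation.EqvGen r x y)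
    (h2 : ∀ x y, r x y → Relation.EqvGen (Joined p q) x y) :
    relPar p q = Nat.card (Quot r) + ∑ᶠ i, c (p (Sum.inl i)) +
      ∑ᶠ j, (1 + c (q (Sum.inl j))) := by
  -- Edges of `p` are turned to run from colour `0` to `1`, those of `q` from `1` to `0`, so that
  -- all run coherently around the circles. `relPar_flip` records the cost.
  obtain ⟨p', hp0, hp1, hpl, hpr⟩ := exists_reorient p c hc.left
  have hadd : ∀ a b : ZMod 2, a = 1 + b → 1 + a = 1 + (1 + b) := by decide
  obtain ⟨q', hq0, hq1, hql, hqr⟩ := exists_reorient q (fun x => 1 + c x)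
    fun j => hadd _ _ (hc.right j)
  have hql' : ∀ j, c (q' (Sum.inl j)) = 1 := fun j =>
    (by decide : ∀ a : ZMod 2, 1 + a = 0 → a = 1) _ (hql j)
  have hqr' : ∀ j, c (q' (Sum.inr j)) = 0 := fun j =>
    (by decide : ∀ a : ZMod 2, 1 + a = 1 → a = 0) _ (hqr j)
  have hp := relPar_flip p p' (fun i => c (p (Sum.inl i))) hp0 hp1
  have hq := relPar_flip q q' (fun j => 1 + c (q (Sum.inl j))) hq0 hq1
  -- the end points of colour one of the two kinds of edges
  have he : ∀ i, ∃ j, q' (Sum.inl j) = p' (Sum.inr i) := by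
    intro i
    obtain ⟨y, hy⟩ := q'.surjective (p' (Sum.inr i))
    rcases y with j | j
    · exact ⟨j, hy⟩
    · have := hqr' j
      rw [hy, hpr] at this
      exact absurd this (by decide)
  choose e he using he
  have hbij : Function.Bijective e := by
    refine (Function.Injective.bijective_of_nat_card_le ?_ ?_)
    · intro i i' h
      have := he i
      rw [h, he i'] at this
      exact (Sum.inr_injective (p'.injective this)).symm
    · obtain ⟨e'⟩ := nonempty_equiv q p
      exact (Nat.card_congr e').le
  let eq : I ≃ J := Equiv.ofBijective e hbij
  -- With each edge of `p'` paired to the edge of `q'` starting at its head, `τ` moves every vertex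
  -- one step around its circle.
  set τ : Perm V := p'.symm.trans ((eq.sumCongr eq).trans q') with hτ
  have hτl : ∀ i, τ (p' (Sum.inl i)) = p' (Sum.inr i) := fun i => by
    simp [hτ, eq, he]
  have hτr : ∀ i, τ (p' (Sum.inr i)) = q' (Sum.inr (e i)) := fun i => by
    simp [hτ, eq]
  have hcτ : ∀ x, c (τ x) = 1 + c x := by
    intro x
    obtain ⟨y, rfl⟩ := p'.surjective x
    rcases y with i | i
    · rw [hτl, hpl, hpr, add_zero]
    · rw [hτr, hqr', hpr]
      decide
  have hrel : relPar p' q' = permPar τ := relPar_eq p' q' eq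
  have hp'j : ∀ i, Relation.EqvGen (Joined p q) (p' (Sum.inl i)) (p' (Sum.inr i)) := by
    intro i
    rcases zmod_two_cases (c (p (Sum.inl i))) with h | h
    · rw [(hp0 i h).1, (hp0 i h).2]
      exact .rel _ _ (Or.inl ⟨i, rfl, rfl⟩)
    · rw [(hp1 i h).1, (hp1 i h).2]
      exact .symm _ _ (.rel _ _ (Or.inl ⟨i, rfl, rfl⟩))
  have hq'j : ∀ j, Relation.EqvGen (Joined p q) (q' (Sum.inl j)) (q' (Sum.inr j)) := by
    intro j
    rcases zmod_two_cases (1 + c (q (Sum.inl j))) with h | h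
    · rw [(hq0 j h).1, (hq0 j h).2]
      exact .rel _ _ (Or.inr ⟨j, rfl, rfl⟩)
    · rw [(hq1 j h).1, (hq1 j h).2]
      exact .symm _ _ (.rel _ _ (Or.inr ⟨j, rfl, rfl⟩))
  have hlift : ∀ {r r' : V → V → Prop}, (∀ x y, r x y → Relation.EqvGen r' x y) →
      ∀ x y, Relation.EqvGen r x y → Relation.EqvGen r' x y := by
    intro r r' h x y hxy
    induction hxy with
    | rel x y h' => exact h x y h'
    | refl x => exact .refl x
    | symm x y _ ih => exact ih.symm
    | trans x y z _ _ ih ih' => exact ih.trans _ _ _ ih'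
  have hcyc : ∀ x y, Joined p q x y → τ.SameCycle x y := by
    have hpc : ∀ i, τ.SameCycle (p' (Sum.inl i)) (p' (Sum.inr i)) := fun i => by
      rw [← hτl]
      exact Perm.sameCycle_apply_right.2 (Perm.SameCycle.refl _ _)
    have hqc : ∀ j, τ.SameCycle (q' (Sum.inl j)) (q' (Sum.inr j)) := fun j => by
      obtain ⟨i, rfl⟩ := hbij.surjective j
      rw [he, ← hτr]
      exact Perm.sameCycle_apply_right.2 (Perm.SameCycle.refl _ _)
    rintro x y (⟨i, rfl, rfl⟩ | ⟨j, rfl, rfl⟩)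
    · have := hpc i
      rcases zmod_two_cases (c (p (Sum.inl i))) with h | h
      · rwa [(hp0 i h).1, (hp0 i h).2] at this
      · rw [(hp1 i h).1, (hp1 i h).2] at this
        exact this.symm
    · have := hqc j
      rcases zmod_two_cases (1 + c (q (Sum.inl j))) with h | h
      · rwa [(hq0 j h).1, (hq0 j h).2] at this
      · rw [(hq1 j h).1, (hq1 j h).2] at this
        exact this.symm
  have hcard := card_quot_eq_permPar τ (r := r) (fun x hx => by
      have := hcτ x
      rw [hx] at this
      exact (by decide : ∀ a : ZMod 2, a ≠ 1 + a) _ this)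
    (by rw [Nat.card_congr p.symm, Nat.card_sum]; exact ⟨_, rfl⟩)
    (fun x => by
      obtain ⟨y, rfl⟩ := p'.surjective x
      rcases y with i | i
      · rw [hτl]
        exact hlift h1 _ _ (hp'j i)
      · rw [hτr, ← he]
        exact hlift h1 _ _ (hq'j (e i)))
    (fun x y hxy => by
      have := h2 x y hxy
      clear hxy
      induction this with
      | rel x y h => exact hcyc x y h
      | refl x => exact Perm.SameCycle.refl _ _
      | symm x y _ ih => exact ih.symm
      | trans x y z _ _ ih ih' => exact ih.trans ih')
  rw [hcard, ← hrel, ← hp, ← hq, relPar_comm q q', add_comm (relPar p' q'), relPar_trans,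
    relPar_comm q' q, ← relPar_trans p q' q, relPar_comm q' q]

/-- The number of components of the union of two matchings, if the end points of every edge have
different signs. -/
theorem card_quot_of_sign (p : I ⊕ I ≃ V) (q : J ⊕ J ≃ V) (sg : V → ZMod 2)
    (hs : IsColouring p q sg) {r : V → V → Prop}
    (h1 : ∀ x y, Joined p q x y → Relation.EqvGen r x y)
    (h2 : ∀ x y, r x y → Relation.EqvGen (Joined p q) x y) :
    (Nat.card (Quot r) : ZMod 2) = relPar p q + ∑ᶠ i, sg (p (Sum.inl i)) +
      ∑ᶠ j, sg (q (Sum.inl j)) + Nat.card J := by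
  obtain ⟨c, hc⟩ := exists_isColouring p q
  have h := relPar_eq_card_quot p q hc h1 h2
  -- Both colourings alternate, so `c + sg` is constant along each edge, and the weight `1 + sg`
  -- counts it once per edge. Summing over `V` by either matching therefore lets `sg` replace `c` in
  -- the formula.
  have key : ∀ a b : ZMod 2, (a + b) * (1 + b) + (1 + a + (1 + b)) * (1 + (1 + b)) = a + b := by
    decide
  have hp := finsum_matching p (fun x => (c x + sg x) * (1 + sg x))
  have hq := finsum_matching q (fun x => (c x + sg x) * (1 + sg x))
  simp only [hc.left, hs.left, key] at hp
  simp only [hc.right, hs.right, key] at hq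
  rw [hp, finsum_add, finsum_add] at hq
  rw [finsum_add, finsum_const_zmod, mul_one] at h
  linear_combination -h - hq + (∑ᶠ i, c (p (Sum.inl i)) + Nat.card (Quot r) -
    ∑ᶠ j, sg (q (Sum.inl j)) - Nat.card (Quot r) - ∑ᶠ i, c (p (Sum.inl i)) - Nat.card J -
    ∑ᶠ j, c (q (Sum.inl j))) * CharTwo.two_eq_zero (R := ZMod 2)

end Colouring

end Matching

/-! ### Special graph structures as unions of two matchings -/

namespace GraphData

open Matching

variable {I J : Type*} {G : GraphData.{u, v, w}}

/-- The graph is the union of a matching which consists of the framed edges, all leading from sign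
`0` to sign `1`, and a matching which consists of the other edges. -/
structure IsMatched (G : GraphData.{u, v, w}) (p : I ⊕ I ≃ G.V) (q : J ⊕ J ≃ G.V)
    (ε : I ⊕ J ≃ G.E) (φ : I → ZMod 2) : Prop where
  ends_left : ∀ i, G.ends (ε (Sum.inl i)) = {p (Sum.inl i), p (Sum.inr i)}
  ends_right : ∀ j, G.ends (ε (Sum.inr j)) = {q (Sum.inl j), q (Sum.inr j)}
  framed_iff : ∀ e, e ∈ G.framed ↔ ∃ i, e = ε (Sum.inl i)
  fr_eq : ∀ i h, G.fr ⟨ε (Sum.inl i), h⟩ = φ i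
  directed_iff : ∀ e, e ∈ G.directed ↔
    ∃ j, e = ε (Sum.inr j) ∧ G.sgn (q (Sum.inl j)) = G.sgn (q (Sum.inr j))
  head_eq : ∀ j h, G.head ⟨ε (Sum.inr j), h⟩ = q (Sum.inr j)
  sgn_inl : ∀ i, G.sgn (p (Sum.inl i)) = 0
  sgn_inr : ∀ i, G.sgn (p (Sum.inr i)) = 1

namespace IsMatched

variable {p : I ⊕ I ≃ G.V} {q : J ⊕ J ≃ G.V} {ε : I ⊕ J ≃ G.E} {φ : I → ZMod 2}

theorem mem_pair_iff {V K : Type*} (p : K ⊕ K ≃ V) (x : V) (i : K) :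
    x ∈ ({p (Sum.inl i), p (Sum.inr i)} : Set V) ↔ (p.symm x).elim id id = i := by
  obtain ⟨y, rfl⟩ := p.surjective x
  rcases y with k | k <;> simp

theorem mem_ends_left (h : G.IsMatched p q ε φ) (x : G.V) (i : I) :
    x ∈ G.ends (ε (Sum.inl i)) ↔ (p.symm x).elim id id = i := by
  rw [h.ends_left, mem_pair_iff]

theorem mem_ends_right (h : G.IsMatched p q ε φ) (x : G.V) (j : J) :
    x ∈ G.ends (ε (Sum.inr j)) ↔ (q.symm x).elim id id = j := by
  rw [h.ends_right, mem_pair_iff]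

theorem edges_at (h : G.IsMatched p q ε φ) (x : G.V) : {e | x ∈ G.ends e} =
    {ε (Sum.inl ((p.symm x).elim id id)), ε (Sum.inr ((q.symm x).elim id id))} := by
  ext e
  obtain ⟨y, rfl⟩ := ε.surjective e
  rcases y with i | j
  · simp [h.mem_ends_left, eq_comm]
  · simp [h.mem_ends_right, eq_comm]

theorem ncard_edges_at (h : G.IsMatched p q ε φ) (x : G.V) : {e | x ∈ G.ends e}.ncard = 2 := by
  rw [h.edges_at, Set.ncard_pair]
  simp

theorem bdry_eq_empty (h : G.IsMatched p q ε φ) : G.bdry = ∅ := by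
  ext x
  simp [bdry, h.ncard_edges_at]

theorem left_framed (h : G.IsMatched p q ε φ) (i : I) : ε (Sum.inl i) ∈ G.framed :=
  (h.framed_iff _).2 ⟨i, rfl⟩

theorem right_not_framed (h : G.IsMatched p q ε φ) (j : J) : ε (Sum.inr j) ∉ G.framed := by
  rw [h.framed_iff]
  rintro ⟨i, hi⟩
  simpa using ε.injective hi

theorem right_directed (h : G.IsMatched p q ε φ) (j : J) :
    ε (Sum.inr j) ∈ G.directed ↔ G.sgn (q (Sum.inl j)) = G.sgn (q (Sum.inr j)) := by
  rw [h.directed_iff]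
  constructor
  · rintro ⟨j', hj, hs⟩
    have : j = j' := by simpa using hj
    rwa [this]
  · exact fun hs => ⟨j, rfl, hs⟩

theorem isSpecial [Finite G.V] [Finite I] [Finite J] [Finite G.L] (h : G.IsMatched p q ε φ) :
    G.IsSpecial where
  finite_V := inferInstance
  finite_E := Finite.of_equiv _ ε
  finite_L := inferInstance
  two_ends e := by
    obtain ⟨y, rfl⟩ := ε.surjective e
    rcases y with i | j
    · rw [h.ends_left, Set.ncard_pair (by simp)]
    · rw [h.ends_right, Set.ncard_pair (by simp)]
  directed_sub e he := by
    obtain ⟨j, rfl, -⟩ := (h.directed_iff e).1 he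
    exact h.right_not_framed j
  head_mem := by
    rintro ⟨e, he⟩
    obtain ⟨j, rfl, -⟩ := (h.directed_iff e).1 he
    rw [h.head_eq, h.ends_right]
    simp
  valency x := Or.inr (h.ncard_edges_at x)
  bdry_framed x hx := by simp [h.bdry_eq_empty] at hx
  inner_edges x _ := ⟨⟨_, h.left_framed _, (h.mem_ends_left x _).2 rfl⟩,
    ⟨_, h.right_not_framed _, (h.mem_ends_right x _).2 rfl⟩⟩
  sgn_framed e he x hx y hy hxy := by
    obtain ⟨i, rfl⟩ := (h.framed_iff e).1 he
    rw [h.ends_left] at hx hy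
    rcases hx with rfl | rfl <;> rcases hy with rfl | rfl <;>
      simp_all [h.sgn_inl, h.sgn_inr]
  sgn_unframed e he x hx y hy hxy := by
    obtain ⟨z, rfl⟩ := ε.surjective e
    rcases z with i | j
    · exact absurd (h.left_framed i) he
    · rw [h.right_directed]
      rw [h.ends_right] at hx hy
      rcases hx with rfl | rfl <;> rcases hy with rfl | rfl
      · exact absurd rfl hxy
      · exact Iff.rfl
      · exact eq_comm
      · exact absurd rfl hxy

/-- An alternating colouring directs every edge: a framed edge from colour `0` to colour `1`, and
an unframed one from colour `1` to colour `0`. -/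
theorem nonempty_direction (h : G.IsMatched p q ε φ) : Nonempty G.Direction := by
  obtain ⟨c, hc⟩ := exists_isColouring p q
  obtain ⟨p', hp0, hp1, hpl, hpr⟩ := exists_reorient p c hc.left
  have hadd : ∀ a b : ZMod 2, a = 1 + b → 1 + a = 1 + (1 + b) := by decide
  obtain ⟨q', hq0, hq1, hql, hqr⟩ := exists_reorient q (fun x => 1 + c x)
    fun j => hadd _ _ (hc.right j)
  have hql' : ∀ j, c (q' (Sum.inl j)) = 1 := fun j =>
    (by decide : ∀ a : ZMod 2, 1 + a = 0 → a = 1) _ (hql j)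
  have hqr' : ∀ j, c (q' (Sum.inr j)) = 0 := fun j =>
    (by decide : ∀ a : ZMod 2, 1 + a = 1 → a = 0) _ (hqr j)
  have h01 : ∀ {x y : G.V}, c x = 0 → c y = 1 → x ≠ y := by
    rintro x y hx hy rfl
    rw [hx] at hy
    exact absurd hy (by decide)
  refine ⟨⟨fun e => (ε.symm e).elim (fun i => p' (Sum.inl i)) (fun j => q' (Sum.inl j)),
    fun e => (ε.symm e).elim (fun i => p' (Sum.inr i)) (fun j => q' (Sum.inr j)), ?_, ?_, ?_⟩⟩
  · intro e
    obtain ⟨z, rfl⟩ := ε.surjective e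
    rcases z with i | j
    · rw [h.ends_left]
      rcases zmod_two_cases (c (p (Sum.inl i))) with h' | h'
      · simp [hp0 i h']
      · simp [hp1 i h', Set.pair_comm]
    · rw [h.ends_right]
      rcases zmod_two_cases (1 + c (q (Sum.inl j))) with h' | h'
      · simp [hq0 j h']
      · simp [hq1 j h', Set.pair_comm]
  · intro x
    rcases zmod_two_cases (c x) with hx | hx
    · obtain ⟨y, rfl⟩ := p'.surjective x
      rcases y with i | i
      · refine ⟨ε (Sum.inl i), by simp, fun e he => ?_⟩
        obtain ⟨z, rfl⟩ := ε.surjective e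
        rcases z with i' | j'
        · simpa using he
        · exact absurd (by simpa using he.symm) (h01 hx (hql' j'))
      · exact absurd rfl (h01 hx (hpr i))
    · obtain ⟨y, rfl⟩ := q'.surjective x
      rcases y with j | j
      · refine ⟨ε (Sum.inr j), by simp, fun e he => ?_⟩
        obtain ⟨z, rfl⟩ := ε.surjective e
        rcases z with i' | j'
        · exact absurd (by simpa using he) (h01 (hpl i') hx)
        · simpa using he
      · exact absurd rfl (h01 (hqr' j) hx)
  · intro x
    rcases zmod_two_cases (c x) with hx | hx
    · obtain ⟨y, rfl⟩ := q'.surjective x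
      rcases y with j | j
      · exact absurd rfl (h01 hx (hql' j))
      · refine ⟨ε (Sum.inr j), by simp, fun e he => ?_⟩
        obtain ⟨z, rfl⟩ := ε.surjective e
        rcases z with i' | j'
        · exact absurd (by simpa using he.symm) (h01 hx (hpr i'))
        · simpa using he
    · obtain ⟨y, rfl⟩ := p'.surjective x
      rcases y with i | i
      · exact absurd rfl (h01 (hpl i) hx)
      · refine ⟨ε (Sum.inl i), by simp, fun e he => ?_⟩
        obtain ⟨z, rfl⟩ := ε.surjective e
        rcases z with i' | j'
        · simpa using he
        · exact absurd (by simpa using he) (h01 (hqr' j') hx)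

/-- A direction colours the vertices by the kind of the edge which leaves them. -/
theorem exists_colouring_of_direction (h : G.IsMatched p q ε φ) (t : G.Direction) :
    ∃ c, IsColouring p q c ∧ ∀ j, q (Sum.inr j) = t.tgt (ε (Sum.inr j)) ↔ c (q (Sum.inl j)) = 1 := by
  classical
  have hne : ∀ e, t.src e ≠ t.tgt e := by
    intro e he
    have h2 : (G.ends e).ncard = 2 := by
      obtain ⟨y, rfl⟩ := ε.surjective e
      rcases y with i | j
      · rw [h.ends_left, Set.ncard_pair (by simp)]
      · rw [h.ends_right, Set.ncard_pair (by simp)]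
    rw [t.ends_eq, he] at h2
    simp at h2
  have hsrc : ∀ e, t.src e ∈ G.ends e := fun e => by simp [t.ends_eq]
  have htgt : ∀ e, t.tgt e ∈ G.ends e := fun e => by simp [t.ends_eq]
  let c : G.V → ZMod 2 := fun x => if ∃ i, t.src (ε (Sum.inl i)) = x then 0 else 1
  have c1 : ∀ i, c (t.src (ε (Sum.inl i))) = 0 := fun i => if_pos ⟨i, rfl⟩
  have c2 : ∀ i, c (t.tgt (ε (Sum.inl i))) = 1 := by
    refine fun i => if_neg ?_
    rintro ⟨i', hi'⟩
    have h1 := hsrc (ε (Sum.inl i'))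
    have h2 := htgt (ε (Sum.inl i))
    rw [← hi', h.mem_ends_left] at h2
    rw [h.mem_ends_left, h2] at h1
    subst h1
    exact hne _ hi'
  have c3 : ∀ j, c (t.src (ε (Sum.inr j))) = 1 := by
    refine fun j => if_neg ?_
    rintro ⟨i, hi⟩
    simpa using (t.src_unique _).unique hi rfl
  have c4 : ∀ j, c (t.tgt (ε (Sum.inr j))) = 0 := by
    refine fun j => if_pos ?_
    set x := t.tgt (ε (Sum.inr j)) with hx
    have hm := (h.mem_ends_left x _).2 rfl
    rw [t.ends_eq] at hm
    rcases hm with hm | hm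
    · exact ⟨_, hm.symm⟩
    · simpa using (t.tgt_unique _).unique hm.symm hx.symm
  have pair : ∀ {a b a' b' : G.V}, a ≠ b → ({a, b} : Set G.V) = {a', b'} →
      (a = a' ∧ b = b') ∨ (a = b' ∧ b = a') := by
    intro a b a' b' _ hs
    exact Set.pair_eq_pair_iff.1 hs
  have h10 : (1 : ZMod 2) ≠ 0 := by decide
  have h11 : (0 : ZMod 2) = 1 + 1 := by decide
  refine ⟨c, ⟨fun i => ?_, fun j => ?_⟩, fun j => ?_⟩
  · rcases pair (by simp) ((h.ends_left i).symm.trans (t.ends_eq _)) with ⟨ha, hb⟩ | ⟨ha, hb⟩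
    · rw [ha, hb, c1, c2, add_zero]
    · rw [ha, hb, c1, c2, h11]
  · rcases pair (by simp) ((h.ends_right j).symm.trans (t.ends_eq _)) with ⟨ha, hb⟩ | ⟨ha, hb⟩
    · rw [ha, hb, c3, c4, h11]
    · rw [ha, hb, c3, c4, add_zero]
  · rcases pair (by simp) ((h.ends_right j).symm.trans (t.ends_eq _)) with ⟨ha, hb⟩ | ⟨ha, hb⟩
    · rw [ha, hb, c3]
      simp
    · rw [ha, hb, c4]
      exact ⟨fun H => absurd H (hne _), fun H => absurd H.symm h10⟩

theorem inComp_iff (t : G.Direction) (e : G.E) (K : G.Component) :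
    InComp e K ↔ (Quot.mk _ (t.src e) : G.Component) = K := by
  constructor
  · rintro ⟨x, hx, rfl⟩
    exact Quot.sound ⟨e, by simp [t.ends_eq], hx⟩
  · exact fun hK => ⟨t.src e, by simp [t.ends_eq], hK⟩

/-- The invariant `o`, expressed by the relative parity of the two matchings. -/
theorem o_eq [Finite G.V] [Finite I] [Finite J] (h : G.IsMatched p q ε φ) :
    G.o = Nat.card G.L + ∑ᶠ i, φ i + relPar p q + ∑ᶠ j, (1 + G.sgn (q (Sum.inl j))) := by
  classical
  have hE : Finite G.E := Finite.of_equiv _ ε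
  have hdir := h.nonempty_direction
  rw [o, dif_pos hdir]
  generalize hdir.some = t
  obtain ⟨c, hc, hct⟩ := h.exists_colouring_of_direction t
  have hF : ∑ᶠ K : G.Component, F K = ∑ᶠ i, φ i := by
    have : ∀ K : G.Component, F K =
        ∑ᶠ (e : G.framed) (_ : (Quot.mk _ (t.src e.1) : G.Component) = K), G.fr e := by
      intro K
      simp only [F, inComp_iff t]
    rw [finsum_congr this, finsum_fiber (fun e : G.framed => (Quot.mk _ (t.src e.1) : G.Component))]
    let eI : I ≃ G.framed := Equiv.ofBijective (fun i => ⟨ε (Sum.inl i), h.left_framed i⟩)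
      ⟨fun i i' hi => by simpa using hi, fun e => by
        obtain ⟨i, hi⟩ := (h.framed_iff _).1 e.2
        exact ⟨i, Subtype.ext hi.symm⟩⟩
    rw [← finsum_comp_equiv eI]
    exact finsum_congr fun i => h.fr_eq i _
  -- The factor in brackets is the indicator of equal signs, that is of a directed edge. Such an
  -- edge agrees with the direction exactly when its tail has colour `1`.
  have hD : ∑ᶠ K : G.Component, D t K = ∑ᶠ j, (1 + G.sgn (q (Sum.inl j)) +
      G.sgn (q (Sum.inr j))) * c (q (Sum.inl j)) := by
    have : ∀ K : G.Component, D t K =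
        ∑ᶠ (e : G.directed) (_ : (Quot.mk _ (t.src e.1) : G.Component) = K),
          if G.head e = t.tgt e.1 then (1 : ZMod 2) else 0 := by
      intro K
      rw [D, Set.ncard_eq_toFinset_card _ (Set.toFinite _)]
      have := Fintype.ofFinite G.directed
      simp only [inComp_iff t, finsum_eq_if, finsum_eq_sum_of_fintype]
      simp only [← Finset.sum_filter, ← ite_and]
      simp [Finset.filter_and]
    rw [finsum_congr this,
      finsum_fiber (fun e : G.directed => (Quot.mk _ (t.src e.1) : G.Component))]
    let eJ : {j | G.sgn (q (Sum.inl j)) = G.sgn (q (Sum.inr j))} ≃ G.directed :=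
      Equiv.ofBijective (fun j => ⟨ε (Sum.inr j.1), (h.right_directed _).2 j.2⟩)
      ⟨fun i i' hi => by
        apply Subtype.ext
        simpa using hi, fun e => by
        obtain ⟨j, hj, hs⟩ := (h.directed_iff _).1 e.2
        exact ⟨⟨j, hs⟩, Subtype.ext hj.symm⟩⟩
    rw [← finsum_comp_equiv eJ]
    have hval : ∀ j : {j | G.sgn (q (Sum.inl j)) = G.sgn (q (Sum.inr j))},
        (if G.head (eJ j) = t.tgt (eJ j).1 then (1 : ZMod 2) else 0) = c (q (Sum.inl j.1)) := by
      intro j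
      have h1 : G.head (eJ j) = q (Sum.inr j.1) := h.head_eq _ _
      rw [h1, show (eJ j).1 = ε (Sum.inr j.1) from rfl]
      split_ifs with h2
      · exact ((hct _).1 h2).symm
      · exact ((zmod_two_cases _).resolve_right fun h3 => h2 ((hct _).2 h3)).symm
    rw [finsum_congr hval, finsum_set_coe_eq_finsum_mem (f := fun j => c (q (Sum.inl j)))]
    refine finsum_congr fun j => ?_
    rw [finsum_eq_if]
    split_ifs with hs
    · rw [show G.sgn (q (Sum.inl j)) = G.sgn (q (Sum.inr j)) from hs, add_assoc,
        CharTwo.add_self_eq_zero, add_zero, one_mul]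
    · rw [(by decide : ∀ a b : ZMod 2, a ≠ b → 1 + a + b = 0) _ _ hs, zero_mul]
  have hcard : ∑ᶠ K : G.Component, (1 + F K + D t K) =
      Nat.card G.Component + ∑ᶠ i, φ i + ∑ᶠ j, (1 + G.sgn (q (Sum.inl j)) +
      G.sgn (q (Sum.inr j))) * c (q (Sum.inl j)) := by
    rw [finsum_add, finsum_add, hF, hD, finsum_const_zmod, mul_one]
  have hrel := relPar_eq_card_quot p q hc
    (r := fun x y : G.V => ∃ e, x ∈ G.ends e ∧ y ∈ G.ends e) (by
      rintro x y (⟨i, rfl, rfl⟩ | ⟨j, rfl, rfl⟩)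
      · exact .rel _ _ ⟨ε (Sum.inl i), by simp [h.ends_left]⟩
      · exact .rel _ _ ⟨ε (Sum.inr j), by simp [h.ends_right]⟩) (by
      rintro x y ⟨e, hx, hy⟩
      obtain ⟨z, rfl⟩ := ε.surjective e
      rcases z with i | j
      · rw [h.ends_left] at hx hy
        have hj : Joined p q (p (Sum.inl i)) (p (Sum.inr i)) := Or.inl ⟨i, rfl, rfl⟩
        rcases hx with rfl | rfl <;> rcases hy with rfl | rfl
        exacts [.refl _, .rel _ _ hj, .symm _ _ (.rel _ _ hj), .refl _]
      · rw [h.ends_right] at hx hy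
        have hj : Joined p q (q (Sum.inl j)) (q (Sum.inr j)) := Or.inr ⟨j, rfl, rfl⟩
        rcases hx with rfl | rfl <;> rcases hy with rfl | rfl
        exacts [.refl _, .rel _ _ hj, .symm _ _ (.rel _ _ hj), .refl _])
  -- Framed edges run from sign `0` to `1`, so the weight `1 + sgn` selects their tails. Comparison
  -- with the sum along `q` removes the dependence on the colouring.
  have hp := finsum_matching p (fun x => c x * (1 + G.sgn x))
  have hq := finsum_matching q (fun x => c x * (1 + G.sgn x))
  have hq' := finsum_matching q (fun x => G.sgn x)
  have hp' := finsum_matching p (fun x => G.sgn x)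
  have h11 : (1 + 1 : ZMod 2) = 0 := by decide
  simp only [h.sgn_inl, h.sgn_inr, h11, add_zero, mul_one, mul_zero, zero_add] at hp hp'
  obtain ⟨eIJ⟩ := nonempty_equiv p q
  rw [finsum_const_zmod, Nat.card_congr eIJ, mul_one] at hp'
  -- The number of directed edges is even: the signs of all vertices add up to the number of framed
  -- edges, which equals the number of unframed ones.
  have hzero : ∑ᶠ j, (1 + G.sgn (q (Sum.inl j)) + G.sgn (q (Sum.inr j))) = 0 := by
    simp only [add_assoc]
    rw [finsum_add, finsum_const_zmod, mul_one, ← hq', hp', CharTwo.add_self_eq_zero]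
  have key : ∑ᶠ i, c (p (Sum.inl i)) + ∑ᶠ j, (1 + c (q (Sum.inl j))) =
      ∑ᶠ j, (1 + G.sgn (q (Sum.inl j)) + G.sgn (q (Sum.inr j))) * c (q (Sum.inl j)) +
        ∑ᶠ j, (1 + G.sgn (q (Sum.inl j))) := by
    rw [← hp, hq, ← finsum_add, ← finsum_add, ← add_zero (finsum _), ← hzero, ← finsum_add]
    refine finsum_congr fun j => ?_
    rw [hc.right]
    generalize c (q (Sum.inl j)) = a
    generalize G.sgn (q (Sum.inl j)) = b
    generalize G.sgn (q (Sum.inr j)) = d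
    revert a b d
    decide
  rw [hcard, hrel]
  have h2 := CharTwo.add_self_eq_zero (∑ᶠ j, (1 + G.sgn (q (Sum.inl j))))
  linear_combination -key - h2

end IsMatched

end GraphData

/-! ### Intervals as matchings, and the cochain of a family of objects -/

namespace OneFlowCategory

open Matching

variable {C : OneFlowCategory.{u, v, w}}

instance finite_comp (a c : C.Ob) (h : C.gr a = C.gr c + 2) : Finite (C.Comp a c h) :=
  OneManifold.finite_connectedComponents _

/-- The interval components of a one-dimensional moduli space. -/
abbrev Interval {a c : C.Ob} (h : C.gr a = C.gr c + 2) : Type w :=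
  {K : C.Comp a c h // IsInterval K}

/-- The sum of the signs of the two points of a broken trajectory. -/
def bsg (s : C.SignAssignment) {a c : C.Ob} (z : C.Broken a c) : ZMod 2 :=
  s.sg z.2.1 + s.sg z.2.2

theorem exists_other_end {a c : C.Ob} (h : C.gr a = C.gr c + 2) (z : C.Broken a c) :
    ∃ z', z' ≠ z ∧ endComp h z' = endComp h z := by
  have hfin : ((modelWithCornersEuclideanHalfSpace 1).boundary (C.Mod a c h)).Finite := by
    have : Finite ↥((modelWithCornersEuclideanHalfSpace 1).boundary (C.Mod a c h)) :=
      Finite.of_equiv _ (C.bdryEquiv a c h)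
    exact Set.toFinite _
  obtain ⟨y, hy, hne, hmk⟩ := OneManifold.exists_ne_boundary hfin (C.bdryEquiv a c h z).2
  refine ⟨(C.bdryEquiv a c h).symm ⟨y, hy⟩, fun H => hne ?_, ?_⟩
  · rw [← H, Equiv.apply_symm_apply]
  · rw [endComp, Equiv.apply_symm_apply]
    exact hmk

theorem bsg_add_bsg (s : C.SignAssignment) {a c : C.Ob} (h : C.gr a = C.gr c + 2)
    {z z' : C.Broken a c} (hne : z ≠ z') (hz : endComp h z = endComp h z') :
    bsg s z + bsg s z' = 1 := by
  rw [bsg, bsg, ← s.interval h z z' hne hz]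
  ring

/-- Different ends of a component have signs with sum 1. Hence a component has at most one end of
each sign. -/
theorem end_unique (s : C.SignAssignment) {a c : C.Ob} (h : C.gr a = C.gr c + 2)
    {z z' : C.Broken a c} (hz : endComp h z = endComp h z') (hs : bsg s z = bsg s z') : z = z' := by
  by_contra hne
  have h1 := bsg_add_bsg s h hne hz
  rw [hs, CharTwo.add_self_eq_zero] at h1
  exact absurd h1 (by decide)

/-- The second end provided by the topology has the sign opposite to that of the first. -/
theorem exists_end (s : C.SignAssignment) {a c : C.Ob} (h : C.gr a = C.gr c + 2)
    (K : Interval h) (t : ZMod 2) : ∃ z : C.Broken a c, endComp h z = K.1 ∧ bsg s z = t := by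
  obtain ⟨z, hz⟩ := K.2
  obtain ⟨z', hne, hz'⟩ := exists_other_end h z
  have h1 := bsg_add_bsg s h hne hz'
  by_cases ht : bsg s z = t
  · exact ⟨z, hz, ht⟩
  · refine ⟨z', hz'.trans hz, ?_⟩
    revert h1 ht
    generalize bsg s z = x
    generalize bsg s z' = y
    revert x y t
    decide

/-- The matching of the boundary points of a one-dimensional moduli space by its intervals, which
are directed from sign `0` to sign `1`. -/
noncomputable def ivMatch (s : C.SignAssignment) {a c : C.Ob} (h : C.gr a = C.gr c + 2) :
    Interval h ⊕ Interval h ≃ C.Broken a c :=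
  Equiv.ofBijective
    (Sum.elim (fun K => (exists_end s h K 0).choose) (fun K => (exists_end s h K 1).choose)) (by
    have h0 := fun K => (exists_end s h K 0).choose_spec
    have h1 := fun K => (exists_end s h K 1).choose_spec
    constructor
    · have h01 : ∀ K K', (exists_end s h K 0).choose ≠ (exists_end s h K' 1).choose := by
        intro K K' H
        have := (h0 K).2
        rw [H, (h1 K').2] at this
        exact absurd this (by decide)
      rintro (K | K) (K' | K') H
      · exact congrArg _ (Subtype.ext ((h0 K).1.symm.trans ((congrArg _ H).trans (h0 K').1)))
      · exact absurd H (h01 K K')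
      · exact absurd H.symm (h01 K' K)
      · exact congrArg _ (Subtype.ext ((h1 K).1.symm.trans ((congrArg _ H).trans (h1 K').1)))
    · intro z
      rcases zmod_two_cases (bsg s z) with hz | hz
      · exact ⟨Sum.inl ⟨endComp h z, z, rfl⟩,
          end_unique s h (h0 _).1 ((h0 _).2.trans hz.symm)⟩
      · exact ⟨Sum.inr ⟨endComp h z, z, rfl⟩,
          end_unique s h (h1 _).1 ((h1 _).2.trans hz.symm)⟩)

section

variable (s : C.SignAssignment) {a c : C.Ob} (h : C.gr a = C.gr c + 2) (K : Interval h)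

theorem endComp_ivMatch_inl : endComp h (ivMatch s h (Sum.inl K)) = K.1 :=
  (exists_end s h K 0).choose_spec.1

theorem endComp_ivMatch_inr : endComp h (ivMatch s h (Sum.inr K)) = K.1 :=
  (exists_end s h K 1).choose_spec.1

theorem bsg_ivMatch_inl : bsg s (ivMatch s h (Sum.inl K)) = 0 :=
  (exists_end s h K 0).choose_spec.2

theorem bsg_ivMatch_inr : bsg s (ivMatch s h (Sum.inr K)) = 1 :=
  (exists_end s h K 1).choose_spec.2

theorem endComp_eq_iff (z : C.Broken a c) : endComp h z = K.1 ↔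
    z = ivMatch s h (Sum.inl K) ∨ z = ivMatch s h (Sum.inr K) := by
  constructor
  · intro hz
    rcases zmod_two_cases (bsg s z) with h0 | h0
    · exact Or.inl (end_unique s h (hz.trans (endComp_ivMatch_inl s h K).symm)
        (h0.trans (bsg_ivMatch_inl s h K).symm))
    · exact Or.inr (end_unique s h (hz.trans (endComp_ivMatch_inr s h K).symm)
        (h0.trans (bsg_ivMatch_inr s h K).symm))
  · rintro (rfl | rfl)
    exacts [endComp_ivMatch_inl s h K, endComp_ivMatch_inr s h K]

end

/-- Each interval contributes 0 + 1 through its two ends. -/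
theorem card_interval (s : C.SignAssignment) {a c : C.Ob} (h : C.gr a = C.gr c + 2) :
    (Nat.card (Interval h) : ZMod 2) = ∑ᶠ z : C.Broken a c, bsg s z := by
  rw [finsum_matching (ivMatch s h)]
  simp only [bsg_ivMatch_inl, bsg_ivMatch_inr]
  rw [finsum_const_zmod]
  ring

/-- The points of zero-dimensional moduli spaces from a given object. -/
abbrev Arrow {i j : ℤ} (h : j = i + 1) (a : C.Obj j) : Type (max u v) :=
  Σ b : C.Obj i, C.Pt a.1 b.1 (C.gr_eq a b 1 h)

theorem incidence_cast (s : C.SignAssignment) {a b : C.Ob} (h : C.gr a = C.gr b + 1) :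
    ((incidence s h : ℤ) : ZMod 2) = Nat.card (C.Pt a b h) := by
  have := Fintype.ofFinite (C.Pt a b h)
  rw [incidence, finsum_eq_sum_of_fintype]
  push_cast
  simp only [show (-1 : ZMod 2) = 1 from by decide, one_pow]
  simp

theorem delta_apply (s : C.SignAssignment) {i j : ℤ} (h : j = i + 1) (φ : C.Cochain i)
    (a : C.Obj j) : delta s i j h φ a = ∑ᶠ x : Arrow h a, φ x.1 := by
  rw [finsum_sigmaType]
  simp only [finsum_const_zmod]
  change ∑ᶠ b : C.Obj i, _ = _
  simp only [incidence_cast]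

section Family

variable {k : ℤ} {S : Type*} (g : S → C.Obj k)

/-- The disjoint union of the moduli spaces from `b` to the members of a family of objects. -/
abbrev PtFam (b : C.Obj (k + 1)) : Type _ :=
  Σ c : S, C.Pt b.1 (g c).1 (C.gr_eq b (g c) 1 rfl)

/-- The disjoint union of the boundaries of the moduli spaces from `a` to the members of a family
of objects. -/
abbrev VertFam (a : C.Obj (k + 2)) : Type _ := Σ c : S, C.Broken a.1 (g c).1

theorem add_two_eq (k : ℤ) : k + 2 = k + 1 + 1 := by ring

/-- The vertices, sorted by the point `A` of a vertex `(B, A)`. -/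
def vertEquiv (a : C.Obj (k + 2)) :
    (Σ x : Arrow (add_two_eq k) a, PtFam g x.1) ≃ VertFam g a where
  toFun y := ⟨y.2.1, ⟨y.1.1.1, C.gr_eq y.1.1 (g y.2.1) 1 rfl,
    C.gr_eq a y.1.1 1 (add_two_eq k)⟩, y.2.2, y.1.2⟩
  invFun z := ⟨⟨⟨z.2.1.1, z.2.1.2.1.trans (by rw [(g z.1).2])⟩, z.2.2.2⟩, z.1, z.2.2.1⟩
  left_inv _ := rfl
  right_inv _ := rfl

variable {g} {J : C.Obj (k + 1) → Type*} (p : ∀ b, J b ⊕ J b ≃ PtFam g b)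

/-- The matching of the vertices by intervals. -/
noncomputable def vertInterval (s : C.SignAssignment) (g : S → C.Obj k) (a : C.Obj (k + 2)) :
    (Σ c : S, Interval (C.gr_eq a (g c) 2 rfl)) ⊕ (Σ c : S, Interval (C.gr_eq a (g c) 2 rfl)) ≃
      VertFam g a :=
  sigmaMatch fun c => ivMatch s (C.gr_eq a (g c) 2 rfl)

/-- The matching of the vertices by a boundary matching. -/
def vertBoundary (a : C.Obj (k + 2)) :
    (Σ x : Arrow (add_two_eq k) a, J x.1) ⊕ (Σ x : Arrow (add_two_eq k) a, J x.1) ≃ VertFam g a :=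
  (sigmaMatch fun x : Arrow (add_two_eq k) a => p x.1).trans (vertEquiv g a)

variable [Finite S] [∀ b, Finite (J b)]

/-- The cochain `sq`, for a family of objects and an oriented matching of the points of the moduli
spaces to this family, in terms of relative parities of matchings. -/
noncomputable def sqFam (s : C.SignAssignment) (f : C.PreFraming) : C.Cochain (k + 2) := fun a =>
  ∑ᶠ c : S, ∑ᶠ K : C.Comp a.1 (g c).1 (C.gr_eq a (g c) 2 rfl), f.val K +
    relPar (vertInterval s g a) (vertBoundary p a) +
    ∑ᶠ x : Arrow (add_two_eq k) a, ∑ᶠ j : J x.1, (1 + (s.sg (p x.1 (Sum.inl j)).2 + s.sg x.2))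

end Family

/-! ### From the graph of a boundary matching to relative parities -/

section Graph

variable {k : ℤ} {φ : C.Cochain k}

/-- The pairs of a boundary matching as an oriented matching. -/
noncomputable def BoundaryMatching.toMatch (m : BoundaryMatching φ) (b : C.Obj (k + 1)) :
    m.pairs b ⊕ m.pairs b ≃ PtFam (Subtype.val : Supp φ → C.Obj k) b :=
  Equiv.ofBijective (Sum.elim (fun x => x.1.1) (fun x => x.1.2)) (by
    constructor
    · rintro (x | x) (y | y) h
      · refine congrArg _ (Subtype.ext ((m.partition b x.1.1).unique ⟨x.2, Or.inl rfl⟩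
          ⟨y.2, Or.inl h⟩))
      · have := (m.partition b x.1.1).unique ⟨x.2, Or.inl rfl⟩ ⟨y.2, Or.inr h⟩
        exact absurd (h.trans (congrArg Prod.snd this.symm)) (m.ne b _ x.2)
      · have := (m.partition b x.1.2).unique ⟨x.2, Or.inr rfl⟩ ⟨y.2, Or.inl h⟩
        exact absurd (h.trans (congrArg Prod.fst this.symm)).symm (m.ne b _ x.2)
      · refine congrArg _ (Subtype.ext ((m.partition b x.1.2).unique ⟨x.2, Or.inr rfl⟩
          ⟨y.2, Or.inr h⟩))
    · intro x
      obtain ⟨y, ⟨hy, hx | hx⟩, -⟩ := m.partition b x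
      · exact ⟨Sum.inl ⟨y, hy⟩, hx.symm⟩
      · exact ⟨Sum.inr ⟨y, hy⟩, hx.symm⟩)

/-- The unframed edges of the graph, sorted by the point `A`. -/
def matchEdgeEquiv (m : BoundaryMatching φ) (a : C.Obj (k + 2)) :
    (Σ x : Arrow (add_two_eq k) a, m.pairs x.1) ≃ MatchEdge m a where
  toFun y := ⟨y.1.1, y.2, y.1.2⟩
  invFun z := ⟨⟨z.1, z.2.2⟩, z.2.1⟩
  left_inv _ := rfl
  right_inv _ := rfl

instance (m : BoundaryMatching φ) (b : C.Obj (k + 1)) : Finite (m.pairs b) :=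
  Finite.of_injective (fun x => m.toMatch b (Sum.inl x))
    ((m.toMatch b).injective.comp Sum.inl_injective)

theorem graph_isMatched (s : C.SignAssignment) (f : C.PreFraming) (m : BoundaryMatching φ)
    (a : C.Obj (k + 2)) : (graph s f m a).IsMatched
      (vertInterval s (Subtype.val : Supp φ → C.Obj k) a) (vertBoundary m.toMatch a)
      ((Equiv.refl (IntervalEdge φ a)).sumCongr (matchEdgeEquiv m a))
      (fun i => f.val i.2.1) where
  ends_left := by
    rintro ⟨c, K⟩
    ext x
    change (∃ z : C.Broken a.1 c.1.1, _ ∧ _) ↔ _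
    simp only [endComp_eq_iff s]
    constructor
    · rintro ⟨z, rfl | rfl, rfl⟩
      exacts [Or.inl rfl, Or.inr rfl]
    · rintro (rfl | rfl)
      exacts [⟨_, Or.inl rfl, rfl⟩, ⟨_, Or.inr rfl, rfl⟩]
  ends_right _ := rfl
  framed_iff e := ⟨fun ⟨i, h⟩ => ⟨i, h.symm⟩, fun ⟨i, h⟩ => ⟨i, h.symm⟩⟩
  fr_eq _ _ := rfl
  directed_iff e := by
    have key : ∀ x : ZMod 2, ∀ y z, y = z ↔ y + x = z + x := by decide
    constructor
    · rintro ⟨q, rfl, h⟩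
      exact ⟨(matchEdgeEquiv m a).symm q, rfl, (key (s.sg q.2.2) _ _).1 h⟩
    · rintro ⟨j, rfl, h⟩
      exact ⟨matchEdgeEquiv m a j, rfl, (key (s.sg j.1.2) _ _).2 h⟩
  head_eq _ _ := rfl
  sgn_inl i := bsg_ivMatch_inl s _ i.2
  sgn_inr i := bsg_ivMatch_inr s _ i.2

/-- The loops of the graph account for the circles, so loops and framed edges together give the sum
of `f` over all components. -/
theorem finsum_comp_framing (f : C.PreFraming) {a c : C.Ob} (h : C.gr a = C.gr c + 2) :
    ∑ᶠ K : C.Comp a c h, f.val K =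
      Nat.card {K : C.Comp a c h // ¬ IsInterval K ∧ f.val K = 1} +
        ∑ᶠ K : Interval h, f.val K.1 := by
  classical
  have := Fintype.ofFinite (C.Comp a c h)
  have h1 : ∑ᶠ K : Interval h, f.val K.1 =
      ∑ᶠ K : C.Comp a c h, if IsInterval K then f.val K else 0 := by
    rw [finsum_congr fun K : C.Comp a c h => (finsum_eq_if (p := IsInterval K) (x := f.val K)).symm]
    exact finsum_set_coe_eq_finsum_mem (f := f.val) {K : C.Comp a c h | IsInterval K}
  have h2 : (Nat.card {K : C.Comp a c h // ¬ IsInterval K ∧ f.val K = 1} : ZMod 2) =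
      ∑ᶠ K : C.Comp a c h, if ¬ IsInterval K ∧ f.val K = 1 then 1 else 0 := by
    rw [Nat.card_eq_fintype_card, Fintype.card_subtype, finsum_eq_sum_of_fintype]
    simp
  rw [h1, h2, ← finsum_add]
  refine finsum_congr fun K => ?_
  rcases zmod_two_cases (f.val K) with h | h <;> by_cases hK : IsInterval K <;> simp [h, hK]

instance (f : C.PreFraming) (a : C.Obj (k + 2)) : Finite (Loop f φ a) := by
  unfold Loop
  infer_instance

/-- From here on the graph is no longer needed: `o_eq` gives the relative parity, and its first two
terms merge by `finsum_comp_framing`. -/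
theorem sq_eq_sqFam (s : C.SignAssignment) (f : C.PreFraming) (m : BoundaryMatching φ) :
    sq s f m = sqFam m.toMatch s f := by
  funext a
  have : Finite (graph s f m a).V := inferInstanceAs (Finite (Vert φ a))
  have h1 : (Nat.card (Loop f φ a) : ZMod 2) + ∑ᶠ i : IntervalEdge φ a, f.val i.2.1 =
      ∑ᶠ c : Supp φ, ∑ᶠ K : C.Comp a.1 c.1.1 (C.gr_eq a c.1 2 rfl), f.val K := by
    have := Fintype.ofFinite (Supp φ)
    rw [finsum_congr fun c : Supp φ => finsum_comp_framing f (C.gr_eq a c.1 2 rfl), finsum_add,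
      ← finsum_sigmaType (β := fun c : Supp φ => Interval (C.gr_eq a c.1 2 rfl))
        (fun i => f.val i.2.1), Nat.card_sigma, Nat.cast_sum, ← finsum_eq_sum_of_fintype]
  rw [sq, (graph_isMatched s f m a).o_eq]
  exact congrArg₂ (· + ·) (congrArg₂ (· + ·) h1 rfl) (finsum_sigmaType _)

theorem graph_isSpecial (s : C.SignAssignment) (f : C.PreFraming) (m : BoundaryMatching φ)
    (a : C.Obj (k + 2)) : (graph s f m a).IsSpecial := by
  have : Finite (graph s f m a).V := inferInstanceAs (Finite (Vert φ a))
  have : Finite (graph s f m a).L := inferInstanceAs (Finite (Loop f φ a))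
  exact (graph_isMatched s f m a).isSpecial

theorem finsum_supp (φ h : C.Cochain k) : ∑ᶠ c : Supp φ, h c.1 = ∑ᶠ c, φ c * h c := by
  classical
  rw [show ∑ᶠ c : Supp φ, h c.1 = ∑ᶠ (c) (_ : c ∈ {c | φ c = 1}), h c from
    finsum_set_coe_eq_finsum_mem (f := h) {c | φ c = 1}]
  refine finsum_congr fun c => ?_
  rcases zmod_two_cases (φ c) with h | h <;> simp [h]

/-- A matching exists as soon as all cardinalities are even. -/
theorem exists_matching {V : Type*} [Finite V] (h : (Nat.card V : ZMod 2) = 0) :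
    ∃ n, Nonempty (Fin n ⊕ Fin n ≃ V) := by
  obtain ⟨n, hn⟩ := (ZMod.natCast_eq_zero_iff_even).1 h
  exact ⟨n, Finite.card_eq.1 (by simp [hn])⟩

theorem card_ptTo (s : C.SignAssignment) (φ : C.Cochain k) (b : C.Obj (k + 1)) :
    (Nat.card (PtTo φ b) : ZMod 2) = delta s k (k + 1) rfl φ b := by
  have := Fintype.ofFinite (Supp φ)
  rw [Nat.card_sigma, Nat.cast_sum, ← finsum_eq_sum_of_fintype,
    finsum_supp φ fun c => (Nat.card (C.Pt b.1 c.1 (C.gr_eq b c 1 rfl)) : ZMod 2)]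
  change _ = ∑ᶠ c : C.Obj k, _
  simp only [incidence_cast, mul_comm]

/-- Modulo 2 the number of points from `b` to `φ` is the value of the coboundary of `φ` at `b`,
which is zero. -/
theorem nonempty_boundaryMatching (s : C.SignAssignment) (hφ : φ ∈ cocycles s k) :
    Nonempty (BoundaryMatching φ) := by
  have h : ∀ b, ∃ n, Nonempty (Fin n ⊕ Fin n ≃ PtTo φ b) := fun b => exists_matching (by
    rw [card_ptTo s, show delta s k (k + 1) rfl φ = 0 from hφ]
    rfl)
  choose n hn using h
  let p := fun b => (hn b).some
  refine ⟨⟨fun b => Set.range fun j => (p b (Sum.inl j), p b (Sum.inr j)), ?_, ?_⟩⟩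
  · rintro b _ ⟨j, rfl⟩
    simp
  · intro b x
    obtain ⟨y, rfl⟩ := (p b).surjective x
    rcases y with j | j
    · refine ⟨_, ⟨⟨j, rfl⟩, Or.inl rfl⟩, ?_⟩
      rintro _ ⟨⟨j', rfl⟩, h | h⟩ <;> simp at h
      rw [h]
    · refine ⟨_, ⟨⟨j, rfl⟩, Or.inr rfl⟩, ?_⟩
      rintro _ ⟨⟨j', rfl⟩, h | h⟩ <;> simp at h
      rw [h]

end Graph

end OneFlowCategory

namespace Matching

variable {V V' I J : Type*} [Finite V] [Finite V'] [Finite I] [Finite J]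

theorem relPar_trans_equiv (p : I ⊕ I ≃ V) (q : J ⊕ J ≃ V) (E : V ≃ V') :
    relPar (p.trans E) (q.trans E) = relPar p q :=
  (relPar_congr p q _ _ E (Equiv.refl I) (Equiv.refl J) (fun x => by simp) fun x => by simp).symm

end Matching

/-! ### Independence of the matching, additivity, and dependence on multiplicities only -/

namespace OneFlowCategory

open Matching

variable {C : OneFlowCategory.{u, v, w}} {k : ℤ} {S S' Z : Type*} [Finite S] [Finite S'] [Finite Z]

section

variable {g : S → C.Obj k} {J J' : C.Obj (k + 1) → Type*} [∀ b, Finite (J b)]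
  [∀ b, Finite (J' b)] (s : C.SignAssignment) (f : C.PreFraming)

/-- The cochain which relates the cochains of two matchings. -/
noncomputable def compareCochain (p : ∀ b, J b ⊕ J b ≃ PtFam g b)
    (p' : ∀ b, J' b ⊕ J' b ≃ PtFam g b) : C.Cochain (k + 1) := fun b =>
  relPar (p b) (p' b) + ∑ᶠ j, s.sg (p b (Sum.inl j)).2 + ∑ᶠ j, s.sg (p' b (Sum.inl j)).2

/-- `relPar_trans` through the interval matching leaves the parity between the two boundary
matchings, which splits over the points `A`. The terms 1 + sign(A) cancel because both matchings
have equally many edges. -/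
theorem sqFam_add_sqFam (p : ∀ b, J b ⊕ J b ≃ PtFam g b) (p' : ∀ b, J' b ⊕ J' b ≃ PtFam g b) :
    sqFam p s f + sqFam p' s f =
      delta s (k + 1) (k + 2) (add_two_eq k) (compareCochain s p p') := by
  funext a
  have hrel : relPar (vertInterval s g a) (vertBoundary p a) +
      relPar (vertInterval s g a) (vertBoundary p' a) =
        ∑ᶠ x : Arrow (add_two_eq k) a, relPar (p x.1) (p' x.1) := by
    rw [relPar_comm _ (vertBoundary p a), relPar_trans, vertBoundary, vertBoundary,
      relPar_trans_equiv, relPar_sigmaMatch]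
  have hsum : ∀ x : Arrow (add_two_eq k) a,
      ∑ᶠ j : J x.1, (1 + (s.sg (p x.1 (Sum.inl j)).2 + s.sg x.2)) +
        ∑ᶠ j : J' x.1, (1 + (s.sg (p' x.1 (Sum.inl j)).2 + s.sg x.2)) =
      ∑ᶠ j, s.sg (p x.1 (Sum.inl j)).2 + ∑ᶠ j, s.sg (p' x.1 (Sum.inl j)).2 := by
    intro x
    obtain ⟨e⟩ := nonempty_equiv (p x.1) (p' x.1)
    simp only [finsum_add, finsum_const_zmod, Nat.card_congr e]
    linear_combination (Nat.card (J' x.1) * (1 + s.sg x.2) : ZMod 2) *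
      CharTwo.two_eq_zero (R := ZMod 2)
  rw [delta_apply]
  simp only [compareCochain, sqFam, Pi.add_apply]
  rw [finsum_congr fun x : Arrow (add_two_eq k) a => add_assoc _ _ _, finsum_add,
    ← finsum_congr hsum, finsum_add, ← hrel]
  linear_combination (∑ᶠ c : S, ∑ᶠ K : C.Comp a.1 (g c).1 (C.gr_eq a (g c) 2 rfl), f.val K) *
    CharTwo.two_eq_zero (R := ZMod 2)

variable {g' : S' → C.Obj k}

/-- The matching for the union of two families. -/
def unionMatch (p : ∀ b, J b ⊕ J b ≃ PtFam g b) (p' : ∀ b, J' b ⊕ J' b ≃ PtFam g' b)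
    (b : C.Obj (k + 1)) : (J b ⊕ J' b) ⊕ (J b ⊕ J' b) ≃ PtFam (Sum.elim g g') b :=
  (sumMatch (p b) (p' b)).trans (Equiv.sumSigmaDistrib
    fun c => C.Pt b.1 (Sum.elim g g' c).1 (C.gr_eq b (Sum.elim g g' c) 1 rfl)).symm

theorem sqFam_unionMatch (p : ∀ b, J b ⊕ J b ≃ PtFam g b) (p' : ∀ b, J' b ⊕ J' b ≃ PtFam g' b) :
    sqFam (unionMatch p p') s f = sqFam p s f + sqFam p' s f := by
  funext a
  have hrel : relPar (vertInterval s (Sum.elim g g') a) (vertBoundary (unionMatch p p') a) =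
      relPar (vertInterval s g a) (vertBoundary p a) +
        relPar (vertInterval s g' a) (vertBoundary p' a) := by
    rw [← relPar_sumMatch]
    refine relPar_congr _ _ _ _
      (Equiv.sumSigmaDistrib fun c => C.Broken a.1 (Sum.elim g g' c).1)
      (Equiv.sumSigmaDistrib fun c => Interval (C.gr_eq a (Sum.elim g g' c) 2 rfl))
      (Equiv.sigmaSumDistrib _ _) ?_ ?_
    · rintro (⟨c | c, K⟩ | ⟨c | c, K⟩) <;> rfl
    · rintro (⟨x, j | j⟩ | ⟨x, j | j⟩) <;> rfl
  have hsum : ∀ x : Arrow (add_two_eq k) a,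
      ∑ᶠ j : J x.1 ⊕ J' x.1, (1 + (s.sg (unionMatch p p' x.1 (Sum.inl j)).2 + s.sg x.2)) =
      ∑ᶠ j : J x.1, (1 + (s.sg (p x.1 (Sum.inl j)).2 + s.sg x.2)) +
        ∑ᶠ j : J' x.1, (1 + (s.sg (p' x.1 (Sum.inl j)).2 + s.sg x.2)) := by
    intro x
    rw [finsum_sumType]
    rfl
  have hf : ∑ᶠ c : S ⊕ S', ∑ᶠ K : C.Comp a.1 (Sum.elim g g' c).1 (C.gr_eq a (Sum.elim g g' c) 2 rfl),
      f.val K = ∑ᶠ c : S, ∑ᶠ K : C.Comp a.1 (g c).1 (C.gr_eq a (g c) 2 rfl), f.val K +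
        ∑ᶠ c : S', ∑ᶠ K : C.Comp a.1 (g' c).1 (C.gr_eq a (g' c) 2 rfl), f.val K :=
    finsum_sumType _
  simp only [sqFam, Pi.add_apply]
  rw [hrel, hf, finsum_congr hsum, finsum_add]
  ring

end

section

variable (s : C.SignAssignment) (f : C.PreFraming)

/-- The matching of two copies of a family with each other. -/
def diagMatch (h : Z → C.Obj k) (b : C.Obj (k + 1)) :
    PtFam h b ⊕ PtFam h b ≃ PtFam (Sum.elim h h) b :=
  (Equiv.sumSigmaDistrib
    fun c => C.Pt b.1 (Sum.elim h h c).1 (C.gr_eq b (Sum.elim h h c) 1 rfl)).symm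

/-- Two copies of a type as a product. -/
def doubleEquiv (X : Type*) : X ⊕ X ≃ (Unit ⊕ Unit) × X :=
  ((Equiv.punitProd X).symm.sumCongr (Equiv.punitProd X).symm).trans
    (Equiv.sumProdDistrib Unit Unit X).symm

theorem finsum_bsg {a : C.Obj (k + 2)} (h : Z → C.Obj k) :
    ∑ᶠ y : (Σ x : Arrow (add_two_eq k) a, PtFam h x.1), (1 + (s.sg y.2.2 + s.sg y.1.2)) =
      Nat.card (Σ c : Z, Interval (C.gr_eq a (h c) 2 rfl)) := by
  have h1 : ∀ y : (Σ x : Arrow (add_two_eq k) a, PtFam h x.1),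
      1 + (s.sg y.2.2 + s.sg y.1.2) = (fun v : VertFam h a => 1 + bsg s v.2) (vertEquiv h a y) :=
    fun y => rfl
  have h2 : ∀ i : (Σ c : Z, Interval (C.gr_eq a (h c) 2 rfl)),
      (1 + bsg s (vertInterval s h a (Sum.inl i)).2) +
        (1 + bsg s (vertInterval s h a (Sum.inr i)).2) = 1 := by
    rintro ⟨c, K⟩
    rw [show bsg s (vertInterval s h a (Sum.inl ⟨c, K⟩)).2 = 0 from bsg_ivMatch_inl s _ K,
      show bsg s (vertInterval s h a (Sum.inr ⟨c, K⟩)).2 = 1 from bsg_ivMatch_inr s _ K]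
    decide
  rw [finsum_congr h1, finsum_comp_equiv (vertEquiv h a) (f := fun v : VertFam h a => 1 + bsg s v.2),
    finsum_matching (vertInterval s h a), finsum_congr h2, finsum_const_zmod, mul_one]

/-- The framing sums of the two copies cancel. The relative parity and the sum of signs are both the
number of intervals of one copy. -/
theorem sqFam_diagMatch (h : Z → C.Obj k) : sqFam (diagMatch h) s f = 0 := by
  funext a
  have hrel : relPar (vertInterval s (Sum.elim h h) a) (vertBoundary (diagMatch h) a) =
      Nat.card (Σ c : Z, Interval (C.gr_eq a (h c) 2 rfl)) := by
    let q := vertInterval s h a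
    -- Two copies of the vertices are a product with a two-point set, matched by its single edge;
    -- the product formula gives one times the number of intervals.
    have hprod := relPar_prod (Equiv.refl (Unit ⊕ Unit)) q
      (Equiv.sumProdDistrib Unit Unit (VertFam h a)).symm
      ((Equiv.prodSumDistrib (Unit ⊕ Unit) _ _).symm.trans ((Equiv.refl _).prodCongr q))
      (fun _ _ => rfl) (fun _ _ => rfl) (fun _ _ => rfl) (fun _ _ => rfl)
    rw [relPar_comm] at hprod
    refine (relPar_congr _ _ _ _ ((Equiv.sumSigmaDistrib
      fun c => C.Broken a.1 (Sum.elim h h c).1).trans (doubleEquiv (VertFam h a)))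
      ((Equiv.sumSigmaDistrib fun c => Interval (C.gr_eq a (Sum.elim h h c) 2 rfl)).trans
        (doubleEquiv _)) ((vertEquiv h a).trans (Equiv.punitProd _).symm) ?_ ?_).trans
      (hprod.trans ?_)
    · rintro (⟨c | c, K⟩ | ⟨c | c, K⟩) <;> rfl
    · rintro (⟨x, j⟩ | ⟨x, j⟩) <;> rfl
    · simp
  have hf : ∑ᶠ c : Z ⊕ Z, ∑ᶠ K : C.Comp a.1 (Sum.elim h h c).1 (C.gr_eq a (Sum.elim h h c) 2 rfl),
      f.val K = ∑ᶠ c : Z, ∑ᶠ K : C.Comp a.1 (h c).1 (C.gr_eq a (h c) 2 rfl), f.val K +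
        ∑ᶠ c : Z, ∑ᶠ K : C.Comp a.1 (h c).1 (C.gr_eq a (h c) 2 rfl), f.val K :=
    finsum_sumType _
  have hsum : ∑ᶠ x : Arrow (add_two_eq k) a, ∑ᶠ j : PtFam h x.1,
      (1 + (s.sg (diagMatch h x.1 (Sum.inl j)).2 + s.sg x.2)) =
        Nat.card (Σ c : Z, Interval (C.gr_eq a (h c) 2 rfl)) := by
    rw [← finsum_bsg s h]
    exact (finsum_sigmaType fun y : (Σ x : Arrow (add_two_eq k) a, PtFam h x.1) =>
      1 + (s.sg y.2.2 + s.sg y.1.2)).symm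
  rw [sqFam, hrel, hf, hsum, CharTwo.add_self_eq_zero, zero_add, CharTwo.add_self_eq_zero]
  rfl

variable {J J' : C.Obj (k + 1) → Type*} [∀ b, Finite (J b)] [∀ b, Finite (J' b)]

/-- The matching for a reindexed family. -/
def congrMatch (e : S' ≃ S) (g : S → C.Obj k) (p : ∀ b, J b ⊕ J b ≃ PtFam (g ∘ e) b)
    (b : C.Obj (k + 1)) : J b ⊕ J b ≃ PtFam g b :=
  (p b).trans (e.sigmaCongrLeft (β := fun c => C.Pt b.1 (g c).1 (C.gr_eq b (g c) 1 rfl)))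

theorem sqFam_congrMatch (e : S' ≃ S) (g : S → C.Obj k) (p : ∀ b, J b ⊕ J b ≃ PtFam (g ∘ e) b) :
    sqFam (congrMatch e g p) s f = sqFam p s f := by
  funext a
  have hrel : relPar (vertInterval s (g ∘ e) a) (vertBoundary p a) =
      relPar (vertInterval s g a) (vertBoundary (congrMatch e g p) a) := by
    refine relPar_congr _ _ _ _ (e.sigmaCongrLeft (β := fun c => C.Broken a.1 (g c).1))
      (e.sigmaCongrLeft (β := fun c => Interval (C.gr_eq a (g c) 2 rfl))) (Equiv.refl _) ?_ ?_
    · rintro (⟨c, K⟩ | ⟨c, K⟩) <;> rfl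
    · rintro (⟨x, j⟩ | ⟨x, j⟩) <;> rfl
  have hf : ∑ᶠ c : S', ∑ᶠ K : C.Comp a.1 (g (e c)).1 (C.gr_eq a (g (e c)) 2 rfl), f.val K =
      ∑ᶠ c : S, ∑ᶠ K : C.Comp a.1 (g c).1 (C.gr_eq a (g c) 2 rfl), f.val K :=
    finsum_comp_equiv e
      (f := fun c : S => ∑ᶠ K : C.Comp a.1 (g c).1 (C.gr_eq a (g c) 2 rfl), f.val K)
  rw [sqFam, sqFam, ← hrel, ← hf]
  rfl

/-- The multiplicities of the objects in a family, modulo `2`. -/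
noncomputable def multiplicity (g : S → C.Obj k) : C.Cochain k :=
  fun c => Nat.card {x // g x = c}

theorem exists_doubling (g : S → C.Obj k) (hg : multiplicity g = 0) :
    ∃ (n : C.Obj k → ℕ) (e : (Σ c, Fin (n c)) ⊕ (Σ c, Fin (n c)) ≃ S),
      g ∘ e = Sum.elim Sigma.fst Sigma.fst := by
  choose n hn using fun c => exists_matching (congrFun hg c)
  refine ⟨n, (sigmaMatch fun c => (hn c).some).trans (Equiv.sigmaFiberEquiv g), ?_⟩
  ext1 x
  rcases x with ⟨c, i⟩ | ⟨c, i⟩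
  · exact ((hn c).some (Sum.inl i)).2
  · exact ((hn c).some (Sum.inr i)).2

/-- The equation is kept as a hypothesis because `exists_doubling` yields the doubled family only up
to propositional equality. -/
theorem exists_sqFam_eq_zero (h : Z → C.Obj k) (g : Z ⊕ Z → C.Obj k) (hg : g = Sum.elim h h) :
    ∃ p : ∀ b, PtFam h b ⊕ PtFam h b ≃ PtFam g b, sqFam p s f = 0 := by
  subst hg
  exact ⟨_, sqFam_diagMatch s f h⟩

theorem multiplicity_elim (g : S → C.Obj k) (g' : S' → C.Obj k) :
    multiplicity (Sum.elim g g') = multiplicity g + multiplicity g' := by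
  funext c
  simp only [multiplicity, Pi.add_apply, ← Nat.cast_add, ← Nat.card_sum]
  exact congrArg _ (Nat.card_congr (Equiv.subtypeSum (p := fun x => Sum.elim g g' x = c)))

/-- Up to coboundaries, the cochain `sq` of a family only depends on the multiplicities modulo `2`
of the objects in the family. -/
theorem sqFam_add_sqFam_mem (g : S → C.Obj k) (g' : S' → C.Obj k)
    (p : ∀ b, J b ⊕ J b ≃ PtFam g b) (p' : ∀ b, J' b ⊕ J' b ≃ PtFam g' b)
    (h : multiplicity g = multiplicity g') :
    ∃ ψ, sqFam p s f + sqFam p' s f = delta s (k + 1) (k + 2) (add_two_eq k) ψ := by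
  have h0 : multiplicity (Sum.elim g g') = 0 := by
    rw [multiplicity_elim, h]
    funext c
    exact CharTwo.add_self_eq_zero (multiplicity g' c)
  -- Every object occurs an even number of times in the union, so the union is a reindexed double
  -- with a boundary matching of vanishing `sqFam`, to which any other matching can be compared.
  obtain ⟨n, e, he⟩ := exists_doubling _ h0
  obtain ⟨q, hq⟩ := exists_sqFam_eq_zero s f _ _ he
  rw [← sqFam_unionMatch, ← add_zero (sqFam _ s f), ← hq, ← sqFam_congrMatch s f e]
  exact ⟨_, sqFam_add_sqFam s f _ _⟩

theorem multiplicity_supp (φ : C.Cochain k) : multiplicity (Subtype.val : Supp φ → C.Obj k) = φ := by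
  funext c
  rcases zmod_two_cases (φ c) with h | h
  · have : IsEmpty {x : Supp φ // x.1 = c} := ⟨fun x => by
      have := x.1.2
      rw [x.2, h] at this
      exact absurd this (by decide)⟩
    rw [h, multiplicity]
    simp
  · have : Unique {x : Supp φ // x.1 = c} :=
      { default := ⟨⟨c, h⟩, rfl⟩
        uniq := fun x => Subtype.ext (Subtype.ext x.2) }
    rw [h, multiplicity]
    simp

end

end OneFlowCategory

/-! ### The framing condition in terms of triples of points -/

namespace OneFlowCategory

open Matching

variable {C : OneFlowCategory.{u, v, w}}

section Triples

variable {i₀ i₁ i₂ i₃ : ℤ} (h₁ : i₁ = i₀ + 1) (h₂ : i₂ = i₁ + 1) (h₃ : i₃ = i₂ + 1)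

/-- The points of zero-dimensional moduli spaces to a given object. -/
abbrev Coarrow (d : C.Obj i₀) : Type (max u v) :=
  Σ c : C.Obj i₁, C.Pt c.1 d.1 (C.gr_eq c d 1 h₁)

theorem add_two_of_eq {i j l : ℤ} (h : j = i + 1) (h' : l = j + 1) : l = i + 2 := by
  rw [h', h, add_assoc]
  rfl

/-- The triples `(P, Q, R)`, sorted by `R` and by `P`. -/
def tripleEquiv (a : C.Obj i₃) (d : C.Obj i₀) :
    (Σ y : Arrow h₃ a, C.Broken y.1.1 d.1) ≃ Σ x : Coarrow h₁ d, C.Broken a.1 x.1.1 where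
  toFun t := ⟨⟨⟨t.2.1.1, t.2.1.2.1.trans (by rw [d.2, h₁])⟩, t.2.2.1⟩,
    ⟨t.1.1.1, t.2.1.2.2, C.gr_eq a t.1.1 1 h₃⟩, t.2.2.2, t.1.2⟩
  invFun t := ⟨⟨⟨t.2.1.1, t.2.1.2.1.trans (by rw [t.1.1.2, h₂])⟩, t.2.2.2⟩,
    ⟨t.1.1.1, C.gr_eq t.1.1 d 1 h₁, t.2.1.2.1⟩, t.1.2, t.2.2.1⟩
  left_inv _ := rfl
  right_inv _ := rfl

variable (s : C.SignAssignment) (f : C.PreFraming) (a : C.Obj i₃) (d : C.Obj i₀)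

/-- The matching of the triples `(P, Q, R)` by intervals with boundary points `(P, Q)`. -/
noncomputable def leftMatch :
    (Σ y : Arrow h₃ a, Interval (C.gr_eq y.1 d 2 (add_two_of_eq h₁ h₂))) ⊕
      (Σ y : Arrow h₃ a, Interval (C.gr_eq y.1 d 2 (add_two_of_eq h₁ h₂))) ≃
        Σ x : Coarrow h₁ d, C.Broken a.1 x.1.1 :=
  (sigmaMatch fun y : Arrow h₃ a => ivMatch s (C.gr_eq y.1 d 2 (add_two_of_eq h₁ h₂))).trans
    (tripleEquiv h₁ h₂ h₃ a d)

/-- The matching of the triples `(P, Q, R)` by intervals with boundary points `(Q, R)`. -/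
noncomputable def rightMatch :
    (Σ x : Coarrow h₁ d, Interval (C.gr_eq a x.1 2 (add_two_of_eq h₂ h₃))) ⊕
      (Σ x : Coarrow h₁ d, Interval (C.gr_eq a x.1 2 (add_two_of_eq h₂ h₃))) ≃
        Σ x : Coarrow h₁ d, C.Broken a.1 x.1.1 :=
  sigmaMatch fun x : Coarrow h₁ d => ivMatch s (C.gr_eq a x.1 2 (add_two_of_eq h₂ h₃))

/-- The components of the boundary, in terms of pieces, as classes of triples. -/
theorem finsum_bdryFraming :
    ∑ᶠ K : C.BdryComp a.1 d.1, (1 + bdryFraming s f K) =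
      Nat.card (C.BdryComp a.1 d.1) + ∑ᶠ p : C.Piece a.1 d.1, pieceFraming s f p := by
  rw [finsum_add, finsum_const_zmod, mul_one]
  exact congrArg _ (finsum_fiber (fun p => (Quot.mk _ p : C.BdryComp a.1 d.1)) _)

/-- The pieces which are not circles. -/
def IsPolygonal {a d : C.Ob} : C.Piece a d → Prop
  | Sum.inl ⟨_, K, _⟩ => IsInterval K
  | Sum.inr ⟨_, _, K⟩ => IsInterval K

/-- Two triples share an interval. -/
inductive Linked (a : C.Obj i₃) (d : C.Obj i₀) : (Σ x : Coarrow h₁ d, C.Broken a.1 x.1.1) →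
    (Σ x : Coarrow h₁ d, C.Broken a.1 x.1.1) → Prop
  | left (y : Arrow h₃ a) (z z' : C.Broken y.1.1 d.1)
      (h : endComp (C.gr_eq y.1 d 2 (add_two_of_eq h₁ h₂)) z =
        endComp (C.gr_eq y.1 d 2 (add_two_of_eq h₁ h₂)) z') :
      Linked a d (tripleEquiv h₁ h₂ h₃ a d ⟨y, z⟩) (tripleEquiv h₁ h₂ h₃ a d ⟨y, z'⟩)
  | right (x : Coarrow h₁ d) (z z' : C.Broken a.1 x.1.1)
      (h : endComp (C.gr_eq a x.1 2 (add_two_of_eq h₂ h₃)) z =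
        endComp (C.gr_eq a x.1 2 (add_two_of_eq h₂ h₃)) z') : Linked a d ⟨x, z⟩ ⟨x, z'⟩

variable {a d}

open Classical in
/-- The class of triples in a piece, or the piece itself if it is a circle. -/
noncomputable def pieceClass : C.Piece a.1 d.1 →
    Quot (Linked h₁ h₂ h₃ a d) ⊕ {p : C.Piece a.1 d.1 // ¬ IsPolygonal p}
  | Sum.inl ⟨b, K, R⟩ => if h : IsInterval K then
      Sum.inl (Quot.mk _ (tripleEquiv h₁ h₂ h₃ a d
        ⟨⟨⟨b.1, b.2.1.trans (by rw [d.2, add_two_of_eq h₁ h₂])⟩, R⟩, h.choose⟩))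
      else Sum.inr ⟨Sum.inl ⟨b, K, R⟩, h⟩
  | Sum.inr ⟨c, P, K⟩ => if h : IsInterval K then
      Sum.inl (Quot.mk _ ⟨⟨⟨c.1, c.2.1.trans (by rw [d.2, h₁])⟩, P⟩, h.choose⟩)
      else Sum.inr ⟨Sum.inr ⟨c, P, K⟩, h⟩

/-- `pieceClass` uses a chosen end of the interval. Triples at ends of the same interval are
`Linked`, so any end gives the same class. -/
theorem pieceClass_inl (y : Arrow h₃ a) (hb : C.gr y.1.1 = C.gr d.1 + 2 ∧ C.gr a.1 = C.gr y.1.1 + 1)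
    (z : C.Broken y.1.1 d.1) :
    pieceClass h₁ h₂ h₃ (Sum.inl ⟨⟨y.1.1, hb⟩, endComp hb.1 z, y.2⟩) =
      Sum.inl (Quot.mk _ (tripleEquiv h₁ h₂ h₃ a d ⟨y, z⟩)) := by
  have h : IsInterval (endComp hb.1 z) := ⟨z, rfl⟩
  exact (dif_pos h).trans (congrArg Sum.inl (Quot.sound (.left y _ _ h.choose_spec)))

theorem pieceClass_inr (x : Coarrow h₁ d)
    (hc : C.gr x.1.1 = C.gr d.1 + 1 ∧ C.gr a.1 = C.gr x.1.1 + 2) (z : C.Broken a.1 x.1.1) :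
    pieceClass h₁ h₂ h₃ (Sum.inr ⟨⟨x.1.1, hc⟩, x.2, endComp hc.2 z⟩) =
      Sum.inl (Quot.mk _ ⟨x, z⟩) := by
  have h : IsInterval (endComp hc.2 z) := ⟨z, rfl⟩
  exact (dif_pos h).trans (congrArg Sum.inl (Quot.sound (.right x _ _ h.choose_spec)))

/-- The boundary component of a triple. -/
def tripleClass (t : Σ x : Coarrow h₁ d, C.Broken a.1 x.1.1) : C.BdryComp a.1 d.1 :=
  Quot.mk _ (Sum.inr ⟨⟨t.1.1.1, C.gr_eq t.1.1 d 1 h₁, C.gr_eq a t.1.1 2 (add_two_of_eq h₂ h₃)⟩,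
    t.1.2, endComp _ t.2⟩)

theorem tripleClass_tripleEquiv (y : Arrow h₃ a) (z : C.Broken y.1.1 d.1) :
    tripleClass h₁ h₂ h₃ (tripleEquiv h₁ h₂ h₃ a d ⟨y, z⟩) =
      Quot.mk _ (Sum.inl ⟨⟨y.1.1, C.gr_eq y.1 d 2 (add_two_of_eq h₁ h₂), C.gr_eq a y.1 1 h₃⟩,
        endComp _ z, y.2⟩) :=
  (Quot.sound (Meet.corner y.1.1 z.1.1 _ _ _ _ _ z.2.1 z.2.2 y.2)).symm

theorem tripleClass_eq {t t' : Σ x : Coarrow h₁ d, C.Broken a.1 x.1.1}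
    (h : Linked h₁ h₂ h₃ a d t t') : tripleClass h₁ h₂ h₃ t = tripleClass h₁ h₂ h₃ t' := by
  cases h with
  | left y z z' h => rw [tripleClass_tripleEquiv, tripleClass_tripleEquiv, h]
  | right x z z' h => rw [tripleClass, tripleClass, h]

/-- The components of the boundary are classes of triples and circles. -/
noncomputable def bdryCompEquiv : C.BdryComp a.1 d.1 ≃
    Quot (Linked h₁ h₂ h₃ a d) ⊕ {p : C.Piece a.1 d.1 // ¬ IsPolygonal p} where
  toFun := Quot.lift (pieceClass h₁ h₂ h₃) (by
    rintro _ _ ⟨b, c, hab, hbc, hcd, hbd, hac, P, Q, R⟩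
    have hb : C.gr b = i₂ := hbd.trans (by rw [d.2, add_two_of_eq h₁ h₂])
    have hc : C.gr c = i₁ := hcd.trans (by rw [d.2, h₁])
    exact (pieceClass_inl h₁ h₂ h₃ ⟨⟨b, hb⟩, R⟩ ⟨hbd, hab⟩ ⟨⟨c, hcd, hbc⟩, P, Q⟩).trans
      (pieceClass_inr h₁ h₂ h₃ ⟨⟨c, hc⟩, P⟩ ⟨hcd, hac⟩ ⟨⟨b, hbc, hab⟩, Q, R⟩).symm)
  invFun := Sum.elim (Quot.lift (tripleClass h₁ h₂ h₃) fun _ _ h => tripleClass_eq h₁ h₂ h₃ h)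
    fun p => Quot.mk _ p.1
  left_inv := by
    rintro ⟨⟨b, K, R⟩ | ⟨c, P, K⟩⟩
    · by_cases h : IsInterval K
      · obtain ⟨z, rfl⟩ := h
        have hb : C.gr b.1 = i₂ := b.2.1.trans (by rw [d.2, add_two_of_eq h₁ h₂])
        refine (congrArg _ (pieceClass_inl h₁ h₂ h₃ ⟨⟨b.1, hb⟩, R⟩ b.2 z)).trans ?_
        exact tripleClass_tripleEquiv h₁ h₂ h₃ ⟨⟨b.1, hb⟩, R⟩ z
      · exact congrArg (Sum.elim _ _) (dif_neg h)
    · by_cases h : IsInterval K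
      · obtain ⟨z, rfl⟩ := h
        have hc : C.gr c.1 = i₁ := c.2.1.trans (by rw [d.2, h₁])
        exact congrArg _ (pieceClass_inr h₁ h₂ h₃ ⟨⟨c.1, hc⟩, P⟩ c.2 z)
      · exact congrArg (Sum.elim _ _) (dif_neg h)
  right_inv := by
    rintro (⟨x, z⟩ | ⟨⟨b, K, R⟩ | ⟨c, P, K⟩, h⟩)
    · exact pieceClass_inr h₁ h₂ h₃ x _ z
    · exact dif_neg h
    · exact dif_neg h

-- The components are the classes of triples together with the circles; the 1 that each circle
-- component adds is moved into the sum over pieces.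
open Classical in
theorem framing_card (s : C.SignAssignment) (f : C.PreFraming) (hf : IsFraming s f) :
    (Nat.card (Quot (Linked h₁ h₂ h₃ a d)) : ZMod 2) +
      ∑ᶠ p : C.Piece a.1 d.1, ((if IsPolygonal p then 0 else 1) + pieceFraming s f p) = 0 := by
  have := Fintype.ofFinite (C.Piece a.1 d.1)
  have h := hf a.1 d.1 (C.gr_eq a d 3 (by rw [h₃, h₂, h₁]; ring))
  rw [finsum_bdryFraming, Nat.card_congr (bdryCompEquiv h₁ h₂ h₃), Nat.card_sum] at h
  have hcirc : (Nat.card {p : C.Piece a.1 d.1 // ¬ IsPolygonal p} : ZMod 2) =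
      ∑ᶠ p : C.Piece a.1 d.1, if IsPolygonal p then 0 else 1 := by
    rw [Nat.card_eq_fintype_card, Fintype.card_subtype, finsum_eq_sum_of_fintype]
    simp [Finset.sum_ite]
  rw [finsum_add, ← hcirc, ← h]
  push_cast
  ring

/-- The pieces, sorted by the points `R` and `P`. -/
def pieceEquiv : C.Piece a.1 d.1 ≃
    (Σ y : Arrow h₃ a, C.Comp y.1.1 d.1 (C.gr_eq y.1 d 2 (add_two_of_eq h₁ h₂))) ⊕
      Σ x : Coarrow h₁ d, C.Comp a.1 x.1.1 (C.gr_eq a x.1 2 (add_two_of_eq h₂ h₃)) :=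
  Equiv.sumCongr
    { toFun := fun p => ⟨⟨⟨p.1.1, p.1.2.1.trans (by rw [d.2, add_two_of_eq h₁ h₂])⟩, p.2.2⟩, p.2.1⟩
      invFun := fun y => ⟨⟨y.1.1.1, C.gr_eq y.1.1 d 2 (add_two_of_eq h₁ h₂),
        C.gr_eq a y.1.1 1 h₃⟩, y.2, y.1.2⟩
      left_inv := fun _ => rfl
      right_inv := fun _ => rfl }
    { toFun := fun p => ⟨⟨⟨p.1.1, p.1.2.1.trans (by rw [d.2, h₁])⟩, p.2.1⟩, p.2.2⟩
      invFun := fun x => ⟨⟨x.1.1.1, C.gr_eq x.1.1 d 1 h₁,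
        C.gr_eq a x.1.1 2 (add_two_of_eq h₂ h₃)⟩, x.1.2, x.2⟩
      left_inv := fun _ => rfl
      right_inv := fun _ => rfl }

-- For a circle the extra 1 cancels the 1 in its framing value. Every component thus contributes
-- `f`, and each interval at a point `P` contributes in addition 1 + sign(P).
open Classical in
theorem finsum_pieces (s : C.SignAssignment) (f : C.PreFraming) :
    ∑ᶠ p : C.Piece a.1 d.1, ((if IsPolygonal p then 0 else 1) + pieceFraming s f p) =
      ∑ᶠ y : Arrow h₃ a, ∑ᶠ K : C.Comp y.1.1 d.1 (C.gr_eq y.1 d 2 (add_two_of_eq h₁ h₂)), f.val K +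
      ∑ᶠ x : Coarrow h₁ d,
        (∑ᶠ K : C.Comp a.1 x.1.1 (C.gr_eq a x.1 2 (add_two_of_eq h₂ h₃)), f.val K +
          Nat.card (Interval (C.gr_eq a x.1 2 (add_two_of_eq h₂ h₃))) * (1 + s.sg x.2)) := by
  have h11 : (1 + 1 : ZMod 2) = 0 := by decide
  rw [← finsum_comp_equiv (pieceEquiv h₁ h₂ h₃).symm, finsum_sumType,
    finsum_sigmaType (I := Arrow h₃ a),
    finsum_sigmaType (I := Coarrow h₁ d)]
  refine congrArg₂ (· + ·) (finsum_congr fun y => finsum_congr fun K => ?_)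
    (finsum_congr fun x => ?_)
  · change (if IsInterval K then 0 else 1) + (if IsInterval K then f.val K else 1 + f.val K) = _
    split_ifs
    · rw [zero_add]
    · rw [← add_assoc, h11, zero_add]
  · have h1 : ∑ᶠ K : C.Comp a.1 x.1.1 (C.gr_eq a x.1 2 (add_two_of_eq h₂ h₃)),
        (if IsInterval K then 1 + s.sg x.2 else 0) =
          Nat.card (Interval (C.gr_eq a x.1 2 (add_two_of_eq h₂ h₃))) * (1 + s.sg x.2) := by
      rw [← finsum_const_zmod]
      exact ((finsum_set_coe_eq_finsum_mem (f := fun _ => 1 + s.sg x.2)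
        {K : C.Comp a.1 x.1.1 (C.gr_eq a x.1 2 (add_two_of_eq h₂ h₃)) | IsInterval K}).trans
        (finsum_congr fun K => finsum_eq_if)).symm
    rw [← h1, ← finsum_add]
    refine finsum_congr fun K => ?_
    change (if IsInterval K then 0 else 1) +
      (if IsInterval K then 1 + s.sg x.2 + f.val K else 1 + f.val K) = _
    split_ifs
    · ring
    · rw [← add_assoc, h11, zero_add, add_zero]

/-- The sign of a triple of points. -/
def tripleSign (s : C.SignAssignment) (t : Σ x : Coarrow h₁ d, C.Broken a.1 x.1.1) : ZMod 2 :=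
  s.sg t.1.2 + bsg s t.2

theorem tripleSign_tripleEquiv (s : C.SignAssignment) (y : Arrow h₃ a) (z : C.Broken y.1.1 d.1) :
    tripleSign h₁ s (tripleEquiv h₁ h₂ h₃ a d ⟨y, z⟩) = bsg s z + s.sg y.2 :=
  (add_assoc _ _ _).symm

theorem leftMatch_inl (y : Arrow h₃ a)
    (K : Interval (C.gr_eq y.1 d 2 (add_two_of_eq h₁ h₂))) :
    leftMatch h₁ h₂ h₃ s a d (Sum.inl ⟨y, K⟩) = tripleEquiv h₁ h₂ h₃ a d
      ⟨y, ivMatch s (C.gr_eq y.1 d 2 (add_two_of_eq h₁ h₂)) (Sum.inl K)⟩ := rfl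

theorem leftMatch_inr (y : Arrow h₃ a)
    (K : Interval (C.gr_eq y.1 d 2 (add_two_of_eq h₁ h₂))) :
    leftMatch h₁ h₂ h₃ s a d (Sum.inr ⟨y, K⟩) = tripleEquiv h₁ h₂ h₃ a d
      ⟨y, ivMatch s (C.gr_eq y.1 d 2 (add_two_of_eq h₁ h₂)) (Sum.inr K)⟩ := rfl

theorem rightMatch_inl (x : Coarrow h₁ d)
    (K : Interval (C.gr_eq a x.1 2 (add_two_of_eq h₂ h₃))) :
    rightMatch h₁ h₂ h₃ s a d (Sum.inl ⟨x, K⟩) =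
      ⟨x, ivMatch s (C.gr_eq a x.1 2 (add_two_of_eq h₂ h₃)) (Sum.inl K)⟩ := rfl

theorem rightMatch_inr (x : Coarrow h₁ d)
    (K : Interval (C.gr_eq a x.1 2 (add_two_of_eq h₂ h₃))) :
    rightMatch h₁ h₂ h₃ s a d (Sum.inr ⟨x, K⟩) =
      ⟨x, ivMatch s (C.gr_eq a x.1 2 (add_two_of_eq h₂ h₃)) (Sum.inr K)⟩ := rfl

theorem tripleSign_leftMatch_inl (y : Arrow h₃ a)
    (K : Interval (C.gr_eq y.1 d 2 (add_two_of_eq h₁ h₂))) :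
    tripleSign h₁ s (leftMatch h₁ h₂ h₃ s a d (Sum.inl ⟨y, K⟩)) = s.sg y.2 := by
  rw [leftMatch_inl, tripleSign_tripleEquiv, bsg_ivMatch_inl, zero_add]

theorem tripleSign_rightMatch_inl (x : Coarrow h₁ d)
    (K : Interval (C.gr_eq a x.1 2 (add_two_of_eq h₂ h₃))) :
    tripleSign h₁ s (rightMatch h₁ h₂ h₃ s a d (Sum.inl ⟨x, K⟩)) = s.sg x.2 := by
  rw [rightMatch_inl, tripleSign, bsg_ivMatch_inl, add_zero]

/-- Along an interval one of the three points stays fixed while the total sign of the other two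
changes. -/
theorem isColouring_tripleSign :
    IsColouring (leftMatch h₁ h₂ h₃ s a d) (rightMatch h₁ h₂ h₃ s a d) (tripleSign h₁ s) where
  left := by
    rintro ⟨y, K⟩
    rw [tripleSign_leftMatch_inl, leftMatch_inr, tripleSign_tripleEquiv, bsg_ivMatch_inr]
  right := by
    rintro ⟨x, K⟩
    rw [tripleSign_rightMatch_inl, rightMatch_inr, tripleSign, bsg_ivMatch_inr]
    exact add_comm _ _

theorem linked_of_joined (t t' : Σ x : Coarrow h₁ d, C.Broken a.1 x.1.1)
    (h : Joined (leftMatch h₁ h₂ h₃ s a d) (rightMatch h₁ h₂ h₃ s a d) t t') :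
    Linked h₁ h₂ h₃ a d t t' := by
  rcases h with ⟨⟨y, K⟩, rfl, rfl⟩ | ⟨⟨x, K⟩, rfl, rfl⟩
  · exact .left y _ _ ((endComp_ivMatch_inl s _ K).trans (endComp_ivMatch_inr s _ K).symm)
  · exact .right x _ _ ((endComp_ivMatch_inl s _ K).trans (endComp_ivMatch_inr s _ K).symm)

theorem joined_of_linked (t t' : Σ x : Coarrow h₁ d, C.Broken a.1 x.1.1)
    (h : Linked h₁ h₂ h₃ a d t t') : Relation.EqvGen
      (Joined (leftMatch h₁ h₂ h₃ s a d) (rightMatch h₁ h₂ h₃ s a d)) t t' := by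
  rcases h with ⟨y, z, z', h⟩ | ⟨x, z, z', h⟩
  · let K : Interval (C.gr_eq y.1 d 2 (add_two_of_eq h₁ h₂)) := ⟨endComp _ z', z', rfl⟩
    have hj : Relation.EqvGen (Joined (leftMatch h₁ h₂ h₃ s a d) (rightMatch h₁ h₂ h₃ s a d))
        (leftMatch h₁ h₂ h₃ s a d (Sum.inl ⟨y, K⟩)) (leftMatch h₁ h₂ h₃ s a d (Sum.inr ⟨y, K⟩)) :=
      .rel _ _ (Or.inl ⟨⟨y, K⟩, rfl, rfl⟩)
    rw [leftMatch_inl, leftMatch_inr] at hj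
    rcases (endComp_eq_iff s _ K z).1 h with h | h <;>
      rcases (endComp_eq_iff s _ K z').1 rfl with h' | h' <;> rw [h, h']
    exacts [.refl _, hj, .symm _ _ hj, .refl _]
  · let K : Interval (C.gr_eq a x.1 2 (add_two_of_eq h₂ h₃)) := ⟨endComp _ z', z', rfl⟩
    have hj : Relation.EqvGen (Joined (leftMatch h₁ h₂ h₃ s a d) (rightMatch h₁ h₂ h₃ s a d))
        (rightMatch h₁ h₂ h₃ s a d (Sum.inl ⟨x, K⟩)) (rightMatch h₁ h₂ h₃ s a d (Sum.inr ⟨x, K⟩)) :=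
      .rel _ _ (Or.inr ⟨⟨x, K⟩, rfl, rfl⟩)
    rw [rightMatch_inl, rightMatch_inr] at hj
    rcases (endComp_eq_iff s _ K z).1 h with h | h <;>
      rcases (endComp_eq_iff s _ K z').1 rfl with h' | h' <;> rw [h, h']
    exacts [.refl _, hj, .symm _ _ hj, .refl _]

theorem finsum_tripleSign_leftMatch :
    ∑ᶠ i, tripleSign h₁ s (leftMatch h₁ h₂ h₃ s a d (Sum.inl i)) = ∑ᶠ y : Arrow h₃ a,
      (Nat.card (Interval (C.gr_eq y.1 d 2 (add_two_of_eq h₁ h₂))) : ZMod 2) * s.sg y.2 := by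
  rw [finsum_sigmaType (I := Arrow h₃ a)]
  refine finsum_congr fun y => ?_
  rw [← finsum_const_zmod]
  exact finsum_congr fun K => tripleSign_leftMatch_inl h₁ h₂ h₃ s y K

theorem finsum_tripleSign_rightMatch :
    ∑ᶠ i, tripleSign h₁ s (rightMatch h₁ h₂ h₃ s a d (Sum.inl i)) = ∑ᶠ x : Coarrow h₁ d,
      (Nat.card (Interval (C.gr_eq a x.1 2 (add_two_of_eq h₂ h₃))) : ZMod 2) * s.sg x.2 := by
  rw [finsum_sigmaType (I := Coarrow h₁ d)]
  refine finsum_congr fun x => ?_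
  rw [← finsum_const_zmod]
  exact finsum_congr fun K => tripleSign_rightMatch_inl h₁ h₂ h₃ s x K

theorem natCard_sigma_zmod {I : Type*} [Finite I] (N : I → Type*) [∀ i, Finite (N i)] :
    (Nat.card (Σ i, N i) : ZMod 2) = ∑ᶠ i, (Nat.card (N i) : ZMod 2) := by
  have := Fintype.ofFinite I
  rw [Nat.card_sigma, Nat.cast_sum, finsum_eq_sum_of_fintype]

/-- The framing condition, expressed by the relative parity of the two matchings of triples. -/
theorem relPar_leftMatch_rightMatch (hf : IsFraming s f) (a : C.Obj i₃) (d : C.Obj i₀) :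
    relPar (leftMatch h₁ h₂ h₃ s a d) (rightMatch h₁ h₂ h₃ s a d) =
      ∑ᶠ y : Arrow h₃ a,
        (∑ᶠ K : C.Comp y.1.1 d.1 (C.gr_eq y.1 d 2 (add_two_of_eq h₁ h₂)), f.val K +
          Nat.card (Interval (C.gr_eq y.1 d 2 (add_two_of_eq h₁ h₂))) * s.sg y.2) +
      ∑ᶠ x : Coarrow h₁ d,
        ∑ᶠ K : C.Comp a.1 x.1.1 (C.gr_eq a x.1 2 (add_two_of_eq h₂ h₃)), f.val K := by
  have hcard := card_quot_of_sign _ _ _ (isColouring_tripleSign (a := a) (d := d) h₁ h₂ h₃ s)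
    (fun t t' h => .rel _ _ (linked_of_joined h₁ h₂ h₃ s t t' h))
    (joined_of_linked h₁ h₂ h₃ s)
  have hframe := framing_card h₁ h₂ h₃ (a := a) (d := d) s f hf
  rw [finsum_pieces h₁ h₂ h₃, hcard, finsum_tripleSign_leftMatch, finsum_tripleSign_rightMatch,
    natCard_sigma_zmod] at hframe
  simp only [mul_add, mul_one] at hframe
  rw [finsum_add, finsum_add] at hframe
  rw [finsum_add]
  -- The terms `x` and `c`, coming from 1 + sign(P) on the intervals with ends `(Q, R)`, occur both
  -- in the component count and in the framing sum, and cancel.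
  have key : ∀ r y x c v w : ZMod 2, r + y + x + c + (v + (w + (c + x))) = 0 → r = v + y + w := by
    decide
  exact key _ _ _ _ _ _ hframe

end Triples

end OneFlowCategory

/-! ### The square of a coboundary -/

namespace OneFlowCategory

open Matching

variable {C : OneFlowCategory.{u, v, w}}

theorem finsum_swap {I J R : Type*} [AddCommMonoid R] [Finite I] [Finite J] (g : I → J → R) :
    ∑ᶠ i, ∑ᶠ j, g i j = ∑ᶠ j, ∑ᶠ i, g i j := by
  have := Fintype.ofFinite I
  have := Fintype.ofFinite J
  simp only [finsum_eq_sum_of_fintype]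
  exact Finset.sum_comm

section Coboundary

variable {j k : ℤ} (hj : k = j + 1) {Z : Type*} [Finite Z] (e : Z → C.Obj j)

/-- The family of objects which represents the coboundary of the sum of a family. -/
def cobFam (x : Σ z : Z, Coarrow hj (e z)) : C.Obj k := x.2.1

/-- The points of the moduli spaces to the coboundary, as boundary points. -/
def cobEquiv (b : C.Obj (k + 1)) : (Σ z : Z, C.Broken b.1 (e z).1) ≃ PtFam (cobFam hj e) b where
  toFun y := ⟨⟨y.1, ⟨y.2.1.1, y.2.1.2.1.trans (by rw [(e y.1).2, hj])⟩, y.2.2.1⟩, y.2.2.2⟩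
  invFun x := ⟨x.1.1, ⟨x.1.2.1.1, C.gr_eq x.1.2.1 (e x.1.1) 1 hj, C.gr_eq b x.1.2.1 1 rfl⟩,
    x.1.2.2, x.2⟩
  left_inv _ := rfl
  right_inv _ := rfl

/-- The matching of the points of the moduli spaces to the coboundary by intervals. -/
noncomputable def cobMatch (s : C.SignAssignment) (b : C.Obj (k + 1)) :
    (Σ z : Z, Interval (C.gr_eq b (e z) 2 (add_two_of_eq hj rfl))) ⊕
      (Σ z : Z, Interval (C.gr_eq b (e z) 2 (add_two_of_eq hj rfl))) ≃ PtFam (cobFam hj e) b :=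
  (sigmaMatch fun z => ivMatch s (C.gr_eq b (e z) 2 (add_two_of_eq hj rfl))).trans
    (cobEquiv hj e b)

/-- The cochain whose coboundary is the cochain `sq` of a coboundary. -/
noncomputable def cobCochain (s : C.SignAssignment) (f : C.PreFraming) : C.Cochain (k + 1) :=
  fun b => ∑ᶠ z : Z, ∑ᶠ K : C.Comp b.1 (e z).1 (C.gr_eq b (e z) 2 (add_two_of_eq hj rfl)), f.val K +
    ∑ᶠ i, (1 + s.sg (cobMatch hj e s b (Sum.inl i)).2)

/-- Interchanging the indices of a double family. -/
def sigmaSwap {X Y : Type*} (N : X → Y → Type*) : (Σ x, Σ y, N x y) ≃ Σ y, Σ x, N x y where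
  toFun t := ⟨t.2.1, t.1, t.2.2⟩
  invFun t := ⟨t.2.1, t.1, t.2.2⟩
  left_inv _ := rfl
  right_inv _ := rfl

/-- For the coboundary family the vertices over `a` are triples. The boundary edges become the left
matching and the interval edges the right one. -/
theorem relPar_cobMatch (s : C.SignAssignment) (a : C.Obj (k + 2)) :
    relPar (vertInterval s (cobFam hj e) a) (vertBoundary (cobMatch hj e s) a) =
      ∑ᶠ z : Z, relPar (leftMatch hj rfl (add_two_eq k) s a (e z))
        (rightMatch hj rfl (add_two_eq k) s a (e z)) := by
  rw [← relPar_sigmaMatch, relPar_comm]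
  refine relPar_congr _ _ _ _
    (Equiv.sigmaAssoc fun (z : Z) (x : Coarrow hj (e z)) => C.Broken a.1 x.1.1)
    (sigmaSwap fun (y : Arrow (add_two_eq k) a) (z : Z) =>
      Interval (C.gr_eq y.1 (e z) 2 (add_two_of_eq hj rfl)))
    (Equiv.sigmaAssoc fun (z : Z) (x : Coarrow hj (e z)) =>
      Interval (C.gr_eq a x.1 2 (add_two_of_eq rfl (add_two_eq k)))) ?_ ?_
  · rintro (⟨y, z, K⟩ | ⟨y, z, K⟩) <;> rfl
  · rintro (⟨⟨z, x⟩, K⟩ | ⟨⟨z, x⟩, K⟩) <;> rfl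

/-- After the framing identity is inserted, the framings of the right intervals occur twice, and so
do the signs of `R`. What is left is a sum over `R` of a function of the target of `R`. -/
theorem sqFam_cobMatch (s : C.SignAssignment) (f : C.PreFraming) (hf : IsFraming s f) :
    sqFam (cobMatch hj e s) s f =
      delta s (k + 1) (k + 2) (add_two_eq k) (cobCochain hj e s f) := by
  funext a
  rw [delta_apply, sqFam, relPar_cobMatch]
  simp only [cobCochain]
  rw [finsum_congr fun z => relPar_leftMatch_rightMatch hj rfl (add_two_eq k) s f hf a (e z),
    finsum_add, finsum_swap]
  have h1 : ∀ x : Arrow (add_two_eq k) a,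
      ∑ᶠ i, (1 + (s.sg (cobMatch hj e s x.1 (Sum.inl i)).2 + s.sg x.2)) =
      ∑ᶠ i, (1 + s.sg (cobMatch hj e s x.1 (Sum.inl i)).2) + ∑ᶠ z : Z,
        (Nat.card (Interval (C.gr_eq x.1 (e z) 2 (add_two_of_eq hj rfl))) : ZMod 2) * s.sg x.2 := by
    intro x
    rw [finsum_congr fun z : Z => (finsum_const_zmod (I := Interval (C.gr_eq x.1 (e z) 2
      (add_two_of_eq hj rfl))) (s.sg x.2)).symm, ← finsum_sigmaType (I := Z) fun _ => s.sg x.2,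
      ← finsum_add]
    exact finsum_congr fun i => (add_assoc _ _ _).symm
  have h2 : ∑ᶠ c : (Σ z : Z, Coarrow hj (e z)),
      ∑ᶠ K : C.Comp a.1 (cobFam hj e c).1 (C.gr_eq a (cobFam hj e c) 2 rfl), f.val K =
      ∑ᶠ z : Z, ∑ᶠ x : Coarrow hj (e z), ∑ᶠ K : C.Comp a.1 x.1.1
        (C.gr_eq a x.1 2 (add_two_of_eq rfl (add_two_eq k))), f.val K :=
    finsum_sigmaType _
  rw [finsum_congr h1, h2]
  simp only [finsum_add]
  have key : ∀ a b c d : ZMod 2, a + ((b + c) + a) + (d + c) = b + d := by decide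
  exact key _ _ _ _

/-- An object occurs once for every point from it to the support of `ψ`, and signs are invisible
modulo 2. -/
theorem multiplicity_cobFam (s : C.SignAssignment) (ψ : C.Cochain j) :
    multiplicity (cobFam hj (Subtype.val : Supp ψ → C.Obj j)) = delta s j k hj ψ := by
  funext c
  let E : (Σ d : Supp ψ, C.Pt c.1 d.1.1 (C.gr_eq c d.1 1 hj)) ≃
      {x // cobFam hj (Subtype.val : Supp ψ → C.Obj j) x = c} :=
    Equiv.ofBijective (fun y => ⟨⟨y.1, c, y.2⟩, rfl⟩) (by
      constructor
      · rintro ⟨d, P⟩ ⟨d', P'⟩ h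
        cases h
        rfl
      · rintro ⟨⟨d, c, P⟩, rfl⟩
        exact ⟨⟨d, P⟩, rfl⟩)
  have h := finsum_supp ψ fun d => (Nat.card (C.Pt c.1 d.1 (C.gr_eq c d 1 hj)) : ZMod 2)
  rw [multiplicity, Nat.card_congr E.symm, natCard_sigma_zmod, h]
  change _ = ∑ᶠ d : C.Obj j, _
  simp only [incidence_cast, mul_comm]

end Coboundary

end OneFlowCategory

/-! ### The cocycle property -/

namespace OneFlowCategory

open Matching

variable {C : OneFlowCategory.{u, v, w}}

section Cocycle

variable {k : ℤ} {S : Type*} [Finite S] {g : S → C.Obj k} {J : C.Obj (k + 1) → Type*}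
  [∀ b, Finite (J b)] (p : ∀ b, J b ⊕ J b ≃ PtFam g b) (s : C.SignAssignment) (f : C.PreFraming)
  (a : C.Obj (k + 2 + 1))

/-- The triples `(P, Q, R)` where `P` is a point of a moduli space to a member of the family. -/
abbrev TripleFam (g : S → C.Obj k) (a : C.Obj (k + 2 + 1)) : Type _ :=
  Σ c : S, Σ x : Coarrow (rfl : k + 1 = k + 1) (g c), C.Broken a.1 x.1.1

/-- The triples, sorted by `R`. -/
def tripleFamEquiv (g : S → C.Obj k) (a : C.Obj (k + 2 + 1)) :
    (Σ y : Arrow rfl a, VertFam g y.1) ≃ TripleFam g a :=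
  (sigmaSwap fun (y : Arrow rfl a) (c : S) => C.Broken y.1.1 (g c).1).trans
    (Equiv.sigmaCongrRight fun c => tripleEquiv rfl (add_two_eq k) rfl a (g c))

/-- The triples, sorted by the source of `P`. -/
def tripleFamProd (g : S → C.Obj k) (a : C.Obj (k + 2 + 1)) :
    TripleFam g a ≃ Σ b : C.Obj (k + 1), PtFam g b × C.Broken a.1 b.1 where
  toFun t := ⟨t.2.1.1, ⟨t.1, t.2.1.2⟩, t.2.2⟩
  invFun t := ⟨t.2.1.1, ⟨t.1, t.2.1.2⟩, t.2.2⟩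
  left_inv _ := rfl
  right_inv _ := rfl

/-- The pairs of vertices in a boundary matching times the points `R`. -/
def edgeFamProd (J : C.Obj (k + 1) → Type*) (a : C.Obj (k + 2 + 1)) :
    (Σ y : Arrow rfl a, Σ x : Arrow (add_two_eq k) y.1, J x.1) ≃
      Σ b : C.Obj (k + 1), J b × C.Broken a.1 b.1 where
  toFun t := ⟨t.2.1.1, t.2.2, ⟨t.1.1.1, C.gr_eq t.1.1 t.2.1.1 1 (add_two_eq k),
    C.gr_eq a t.1.1 1 rfl⟩, t.2.1.2, t.1.2⟩
  invFun t := ⟨⟨⟨t.2.2.1.1, t.2.2.1.2.1.trans (by rw [t.1.2, add_two_eq])⟩, t.2.2.2.2⟩,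
    ⟨t.1, t.2.2.2.1⟩, t.2.1⟩
  left_inv _ := rfl
  right_inv _ := rfl

/-- The intervals with boundary points `(Q, R)` times the points `P`. -/
def intervalFamProd (g : S → C.Obj k) (a : C.Obj (k + 2 + 1)) :
    (Σ c : S, Σ x : Coarrow (rfl : k + 1 = k + 1) (g c),
      Interval (C.gr_eq a x.1 2 (add_two_of_eq (add_two_eq k) rfl))) ≃
    Σ b : C.Obj (k + 1), PtFam g b × Interval (C.gr_eq a b 2 (add_two_of_eq (add_two_eq k) rfl)) where
  toFun t := ⟨t.2.1.1, ⟨t.1, t.2.1.2⟩, t.2.2⟩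
  invFun t := ⟨t.2.1.1, ⟨t.1, t.2.1.2⟩, t.2.2⟩
  left_inv _ := rfl
  right_inv _ := rfl

/-- Sorted by the source `b` of `P`, the triples form products in which boundary edges act on `P`
and intervals on `(Q, R)`, so `relPar_prod` applies for each `b`. -/
theorem relPar_boundary_right :
    relPar (sigmaMatch fun c : S => rightMatch (rfl : k + 1 = k + 1) (add_two_eq k) rfl s a (g c))
      ((sigmaMatch fun y : Arrow rfl a => vertBoundary p y.1).trans (tripleFamEquiv g a)) =
      ∑ᶠ b : C.Obj (k + 1), (Nat.card (J b) : ZMod 2) *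
        Nat.card (Interval (C.gr_eq a b 2 (add_two_of_eq (add_two_eq k) rfl))) := by
  let P (b : C.Obj (k + 1)) := (Equiv.sumProdDistrib (J b) (J b) (C.Broken a.1 b.1)).symm.trans
    ((p b).prodCongr (Equiv.refl _))
  let q (b : C.Obj (k + 1)) := ivMatch s (C.gr_eq a b 2 (add_two_of_eq (add_two_eq k) rfl))
  let Q (b : C.Obj (k + 1)) := (Equiv.prodSumDistrib (PtFam g b) _ _).symm.trans
    ((Equiv.refl _).prodCongr (q b))
  rw [← finsum_congr fun b => relPar_prod (p b) (q b) (P b) (Q b) (fun _ _ => rfl)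
    (fun _ _ => rfl) (fun _ _ => rfl) (fun _ _ => rfl), ← relPar_sigmaMatch, relPar_comm]
  refine relPar_congr _ _ _ _ (tripleFamProd g a) (edgeFamProd J a) (intervalFamProd g a) ?_ ?_
  · rintro (⟨y, x, i⟩ | ⟨y, x, i⟩) <;> rfl
  · rintro (⟨c, x, K⟩ | ⟨c, x, K⟩) <;> rfl

theorem card_zmod_eq_zero {I V : Type*} [Finite I] (p : I ⊕ I ≃ V) :
    (Nat.card V : ZMod 2) = 0 := by
  rw [← Nat.card_congr p, Nat.card_sum]
  push_cast
  exact CharTwo.add_self_eq_zero _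

/-- The summand depends only on the source of `P`, and `p` pairs up the points with a given source.
-/
theorem finsum_coarrow_eq_zero (F : C.Obj (k + 1) → ZMod 2) (p : ∀ b, J b ⊕ J b ≃ PtFam g b) :
    ∑ᶠ c : S, ∑ᶠ x : Coarrow (rfl : k + 1 = k + 1) (g c), F x.1 = 0 := by
  let E : (Σ c : S, Coarrow (rfl : k + 1 = k + 1) (g c)) ≃ Σ b, PtFam g b :=
    { toFun := fun t => ⟨t.2.1, t.1, t.2.2⟩
      invFun := fun t => ⟨t.2.1, t.1, t.2.2⟩
      left_inv := fun _ => rfl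
      right_inv := fun _ => rfl }
  rw [← finsum_sigmaType fun t : (Σ c : S, Coarrow (rfl : k + 1 = k + 1) (g c)) => F t.2.1]
  refine (finsum_comp_equiv E (f := fun t => F t.1)).trans ?_
  rw [finsum_sigmaType, ← finsum_zero (α := C.Obj (k + 1))]
  refine finsum_congr fun b => ?_
  exact (finsum_const_zmod (F b)).trans (by rw [card_zmod_eq_zero (p b), zero_mul])

theorem finsum_edgeFam (G : (Σ b : C.Obj (k + 1), J b × C.Broken a.1 b.1) → ZMod 2) :
    ∑ᶠ y : Arrow rfl a, ∑ᶠ x : Arrow (add_two_eq k) y.1, ∑ᶠ j : J x.1,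
      G (edgeFamProd J a ⟨y, x, j⟩) = ∑ᶠ b : C.Obj (k + 1), ∑ᶠ j : J b, ∑ᶠ z, G ⟨b, j, z⟩ := by
  rw [← finsum_congr fun b => finsum_prodType fun w => G ⟨b, w⟩, ← finsum_sigmaType,
    ← finsum_comp_equiv (edgeFamProd J a), finsum_sigmaType (I := Arrow rfl a)]
  exact finsum_congr fun y => (finsum_sigmaType fun t => G (edgeFamProd J a ⟨y, t⟩)).symm

/-- The number of intervals to the members of the family is the number of edges of the
boundary matching. -/
theorem finsum_card_interval (p : ∀ b, J b ⊕ J b ≃ PtFam g b)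
    (y : Arrow (rfl : k + 2 + 1 = k + 2 + 1) a) :
    ∑ᶠ c : S, (Nat.card (Interval (C.gr_eq y.1 (g c) 2 rfl)) : ZMod 2) * s.sg y.2 =
      ∑ᶠ x : Arrow (add_two_eq k) y.1, ∑ᶠ _j : J x.1, s.sg y.2 := by
  obtain ⟨e⟩ := nonempty_equiv (vertInterval s g y.1) (vertBoundary p y.1)
  rw [← finsum_sigmaType (I := Arrow (add_two_eq k) y.1) (β := fun x => J x.1) fun _ => s.sg y.2,
    finsum_const_zmod, ← Nat.card_congr e, ← finsum_const_zmod, finsum_sigmaType (I := S)]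
  exact finsum_congr fun c => (finsum_const_zmod _).symm

/-- On triples the sum is the parity between left intervals and boundary edges. Passing through the
right intervals splits it into the framing identity and `relPar_boundary_right`; the framings of the
right intervals drop out by `finsum_coarrow_eq_zero`. -/
theorem finsum_relPar_vert (hf : IsFraming s f) :
    ∑ᶠ y : Arrow rfl a, relPar (vertInterval s g y.1) (vertBoundary p y.1) =
      ∑ᶠ y : Arrow rfl a, ∑ᶠ c : S,
        ∑ᶠ K : C.Comp y.1.1 (g c).1 (C.gr_eq y.1 (g c) 2 rfl), f.val K +
      ∑ᶠ y : Arrow rfl a, ∑ᶠ x : Arrow (add_two_eq k) y.1, ∑ᶠ _j : J x.1, s.sg y.2 +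
      ∑ᶠ b : C.Obj (k + 1), (Nat.card (J b) : ZMod 2) *
        Nat.card (Interval (C.gr_eq a b 2 (add_two_of_eq (add_two_eq k) rfl))) := by
  have hleft : relPar ((sigmaMatch fun y : Arrow rfl a => vertInterval s g y.1).trans
      (tripleFamEquiv g a)) ((sigmaMatch fun y : Arrow rfl a => vertBoundary p y.1).trans
        (tripleFamEquiv g a)) =
      relPar (sigmaMatch fun c : S => leftMatch (rfl : k + 1 = k + 1) (add_two_eq k) rfl s a (g c))
        ((sigmaMatch fun y : Arrow rfl a => vertBoundary p y.1).trans (tripleFamEquiv g a)) := by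
    refine relPar_congr _ _ _ _ (Equiv.refl _)
      (sigmaSwap fun (y : Arrow rfl a) (c : S) => Interval (C.gr_eq y.1 (g c) 2 rfl))
      (Equiv.refl _) ?_ ?_
    · rintro (⟨y, c, K⟩ | ⟨y, c, K⟩) <;> rfl
    · rintro (⟨y, i⟩ | ⟨y, i⟩) <;> rfl
  rw [← relPar_sigmaMatch, ← relPar_trans_equiv _ _ (tripleFamEquiv g a), hleft,
    ← relPar_trans _ (sigmaMatch fun c : S =>
      rightMatch (rfl : k + 1 = k + 1) (add_two_eq k) rfl s a (g c)),
    relPar_boundary_right, relPar_sigmaMatch]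
  congr 1
  rw [finsum_congr fun c : S => relPar_leftMatch_rightMatch rfl (add_two_eq k) rfl s f hf a (g c),
    finsum_add, finsum_coarrow_eq_zero (fun b => ∑ᶠ K : C.Comp a.1 b.1
      (C.gr_eq a b 2 (add_two_of_eq (add_two_eq k) rfl)), f.val K) p, add_zero, finsum_swap]
  simp only [finsum_add]
  exact congrArg _ (finsum_congr fun y => finsum_card_interval s a p y)

/-- The cochain `sq` is a cocycle. -/
theorem delta_sqFam (hf : IsFraming s f) : delta s (k + 2) (k + 2 + 1) rfl (sqFam p s f) = 0 := by
  funext a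
  rw [delta_apply]
  simp only [sqFam]
  rw [finsum_add, finsum_add, finsum_relPar_vert p s f a hf]
  -- The summand ignores `z`, and the broken trajectories from `a` to `b` are even in number, being
  -- matched by intervals.
  have hJ : ∀ b, ∑ᶠ j : J b, ∑ᶠ z : C.Broken a.1 b.1, (1 + s.sg (p b (Sum.inl j)).2) = 0 := by
    intro b
    rw [← finsum_zero (α := J b)]
    refine finsum_congr fun j => ?_
    rw [finsum_const_zmod, card_zmod_eq_zero
      (ivMatch s (C.gr_eq a b 2 (add_two_of_eq (add_two_eq k) rfl))), zero_mul]
  have h1 := finsum_edgeFam (J := J) a fun t => (1 + s.sg (p t.1 (Sum.inl t.2.1)).2) + s.sg t.2.2.2.1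
  have h2 := finsum_edgeFam (J := J) a fun t => s.sg t.2.2.2.2
  have h1' : ∑ᶠ y : Arrow rfl a, ∑ᶠ x : Arrow (add_two_eq k) y.1, ∑ᶠ j : J x.1,
      (1 + (s.sg (p x.1 (Sum.inl j)).2 + s.sg x.2)) = ∑ᶠ b : C.Obj (k + 1),
        (Nat.card (J b) : ZMod 2) * ∑ᶠ z : C.Broken a.1 b.1, s.sg z.2.1 := by
    refine (finsum_congr fun y => finsum_congr fun x => finsum_congr fun j =>
      (add_assoc _ _ _).symm).trans (h1.trans (finsum_congr fun b => ?_))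
    simp only [finsum_add]
    simp only [finsum_add] at hJ
    rw [hJ, zero_add]
    exact finsum_const_zmod (I := J b) (∑ᶠ z : C.Broken a.1 b.1, s.sg z.2.1)
  have h2' : ∑ᶠ y : Arrow rfl a, ∑ᶠ x : Arrow (add_two_eq k) y.1, ∑ᶠ _j : J x.1, s.sg y.2 =
      ∑ᶠ b : C.Obj (k + 1), (Nat.card (J b) : ZMod 2) * ∑ᶠ z : C.Broken a.1 b.1, s.sg z.2.2 :=
    h2.trans (finsum_congr fun b =>
      finsum_const_zmod (I := J b) (∑ᶠ z : C.Broken a.1 b.1, s.sg z.2.2))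
  -- By `card_interval` the product-formula term is the sum of the signs of `Q` and of `R`, which
  -- cancels the remaining two sums.
  have h3 : ∑ᶠ b : C.Obj (k + 1), (Nat.card (J b) : ZMod 2) *
      Nat.card (Interval (C.gr_eq a b 2 (add_two_of_eq (add_two_eq k) rfl))) =
      ∑ᶠ b : C.Obj (k + 1), (Nat.card (J b) : ZMod 2) * ∑ᶠ z : C.Broken a.1 b.1, s.sg z.2.1 +
      ∑ᶠ b : C.Obj (k + 1), (Nat.card (J b) : ZMod 2) * ∑ᶠ z : C.Broken a.1 b.1, s.sg z.2.2 := by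
    rw [← finsum_add]
    refine finsum_congr fun b => ?_
    rw [card_interval s, ← mul_add, ← finsum_add]
    rfl
  rw [h1', h2', h3]
  have key : ∀ x y z : ZMod 2, x + (x + z + (y + z)) + y = 0 := by decide
  exact key _ _ _

end Cocycle

end OneFlowCategory

/-! ### The induced map on cohomology -/

namespace OneFlowCategory

open Matching

variable {C : OneFlowCategory.{u, v, w}} {k : ℤ} (s : C.SignAssignment)

theorem mem_coboundaries_iff {i j : ℤ} (h : j = i + 1) (x : C.Cochain j) :
    x ∈ coboundaries s j ↔ ∃ ψ, x = delta s i j h ψ := by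
  obtain rfl : i = j - 1 := by omega
  exact ⟨fun ⟨ψ, hψ⟩ => ⟨ψ, hψ.symm⟩, fun ⟨ψ, hψ⟩ => ⟨ψ, hψ.symm⟩⟩

theorem cls_eq_of_add {i j : ℤ} (h : j = i + 1) {x y : C.Cochain j} (hx : x ∈ cocycles s j)
    (hy : y ∈ cocycles s j) (hxy : ∃ ψ, x + y = delta s i j h ψ) : cls s x hx = cls s y hy := by
  refine (Submodule.Quotient.eq _).2 ?_
  refine (mem_coboundaries_iff s h (x - y)).2 ?_
  rwa [show x - y = x + y from funext fun b => CharTwo.sub_eq_add (x b) (y b)]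

variable (f : C.PreFraming)

theorem sq_mem_cocycles (hf : IsFraming s f) {φ : C.Cochain k} (m : BoundaryMatching φ) :
    sq s f m ∈ cocycles s (k + 2) := by
  rw [sq_eq_sqFam]
  exact delta_sqFam _ s f hf

theorem sq_add_sq_mem {φ : C.Cochain k} (m n : BoundaryMatching φ) :
    ∃ ψ, sq s f m + sq s f n = delta s (k + 1) (k + 2) (add_two_eq k) ψ := by
  rw [sq_eq_sqFam, sq_eq_sqFam]
  exact ⟨_, sqFam_add_sqFam s f _ _⟩

/-- The supports may overlap, but the disjoint union of the two has the multiplicities of `φ + φ'`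
modulo 2. -/
theorem sq_add_mem {φ φ' : C.Cochain k} (m : BoundaryMatching φ) (m' : BoundaryMatching φ')
    (n : BoundaryMatching (φ + φ')) :
    ∃ ψ, sq s f n + (sq s f m + sq s f m') = delta s (k + 1) (k + 2) (add_two_eq k) ψ := by
  rw [sq_eq_sqFam, sq_eq_sqFam, sq_eq_sqFam, ← sqFam_unionMatch]
  refine sqFam_add_sqFam_mem s f _ _ _ _ ?_
  rw [multiplicity_elim, multiplicity_supp, multiplicity_supp, multiplicity_supp]

/-- The support of `φ` and the family `cobFam` of a primitive `χ` have equal multiplicities modulo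
2, so their cochains differ by a coboundary, and the second one is a coboundary. -/
theorem sq_mem_of_coboundary (hf : IsFraming s f) {φ : C.Cochain k} (hφ : φ ∈ coboundaries s k)
    (m : BoundaryMatching φ) :
    ∃ ψ, sq s f m = delta s (k + 1) (k + 2) (add_two_eq k) ψ := by
  have hk : k = k - 1 + 1 := by ring
  obtain ⟨χ, hχ⟩ := (mem_coboundaries_iff s hk φ).1 hφ
  obtain ⟨ψ, hψ⟩ := sqFam_add_sqFam_mem s f _ _ m.toMatch
    (cobMatch hk (Subtype.val : Supp χ → C.Obj (k - 1)) s)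
    ((multiplicity_supp φ).trans (hχ.trans (multiplicity_cobFam hk s χ).symm))
  rw [sqFam_cobMatch hk _ s f hf, ← sq_eq_sqFam] at hψ
  refine ⟨ψ - cobCochain hk (Subtype.val : Supp χ → C.Obj (k - 1)) s f, ?_⟩
  rw [map_sub, ← hψ, add_sub_cancel_right]

/-- The square of a cocycle, formed with any boundary matching. -/
noncomputable def sqCls (hf : IsFraming s f) (φ : cocycles s k) : Cohomology s (k + 2) :=
  cls s (sq s f (nonempty_boundaryMatching s φ.2).some) (sq_mem_cocycles s f hf _)

theorem sqCls_eq (hf : IsFraming s f) (φ : C.Cochain k) (hφ : φ ∈ cocycles s k)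
    (m : BoundaryMatching φ) :
    sqCls s f hf ⟨φ, hφ⟩ = cls s (sq s f m) (sq_mem_cocycles s f hf m) :=
  cls_eq_of_add s (add_two_eq k) _ _ (sq_add_sq_mem s f _ m)

theorem sqCls_add (hf : IsFraming s f) (φ φ' : cocycles s k) :
    sqCls s f hf (φ + φ') = sqCls s f hf φ + sqCls s f hf φ' :=
  cls_eq_of_add s (add_two_eq k) _ (add_mem (sq_mem_cocycles s f hf _) (sq_mem_cocycles s f hf _))
    (sq_add_mem s f _ _ _)

theorem sqCls_eq_zero (hf : IsFraming s f) (φ : cocycles s k) (hφ : φ.1 ∈ coboundaries s k) :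
    sqCls s f hf φ = 0 := by
  obtain ⟨ψ, hψ⟩ := sq_mem_of_coboundary s f hf hφ (nonempty_boundaryMatching s φ.2).some
  exact cls_eq_of_add s (add_two_eq k) _ (zero_mem _) ⟨ψ, by rw [add_zero, hψ]⟩

/-- The second Steenrod square of a framed 1-flow category. -/
noncomputable def steenrodSq (hf : IsFraming s f) (k : ℤ) :
    Cohomology s k →ₗ[ZMod 2] Cohomology s (k + 2) :=
  Submodule.liftQ _
    (AddMonoidHom.toZModLinearMap 2 (AddMonoidHom.mk' (sqCls s f hf) (sqCls_add s f hf)))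
    fun φ hφ => sqCls_eq_zero s f hf φ hφ

theorem steenrodSq_cls (hf : IsFraming s f) (φ : C.Cochain k) (hφ : φ ∈ cocycles s k)
    (m : BoundaryMatching φ) :
    steenrodSq s f hf k (cls s φ hφ) = cls s (sq s f m) (sq_mem_cocycles s f hf m) :=
  sqCls_eq s f hf φ hφ m

end OneFlowCategory

theorem theorem3p6 (C : OneFlowCategory.{u, v, w}) (s : C.SignAssignment) (f : C.PreFraming)
    (hf : OneFlowCategory.IsFraming s f) (k : ℤ) :
    -- combinatorial boundary matchings exist, and they define special graph structures
    (∀ φ ∈ OneFlowCategory.cocycles s k, Nonempty (OneFlowCategory.BoundaryMatching φ)) ∧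
    (∀ φ ∈ OneFlowCategory.cocycles s k, ∀ (m : OneFlowCategory.BoundaryMatching φ)
      (a : C.Obj (k + 2)), (OneFlowCategory.graph s f m a).IsSpecial ∧
        (OneFlowCategory.graph s f m a).bdry = ∅) ∧
    -- the cochain is a cocycle
    ∃ hsq : ∀ φ ∈ OneFlowCategory.cocycles s k, ∀ m : OneFlowCategory.BoundaryMatching φ,
        OneFlowCategory.sq s f m ∈ OneFlowCategory.cocycles s (k + 2),
      -- its class does not depend on the matching
      (∀ (φ : C.Cochain k) (hφ : φ ∈ OneFlowCategory.cocycles s k)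
        (m n : OneFlowCategory.BoundaryMatching φ),
          OneFlowCategory.cls s (OneFlowCategory.sq s f m) (hsq φ hφ m) =
            OneFlowCategory.cls s (OneFlowCategory.sq s f n) (hsq φ hφ n)) ∧
      -- it induces a well-defined linear map on cohomology
      ∃! Sq : OneFlowCategory.Cohomology s k →ₗ[ZMod 2] OneFlowCategory.Cohomology s (k + 2),
        ∀ (φ : C.Cochain k) (hφ : φ ∈ OneFlowCategory.cocycles s k)
          (m : OneFlowCategory.BoundaryMatching φ),
            Sq (OneFlowCategory.cls s φ hφ) =
              OneFlowCategory.cls s (OneFlowCategory.sq s f m) (hsq φ hφ m) := by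
  refine ⟨fun φ hφ => OneFlowCategory.nonempty_boundaryMatching s hφ, fun φ _ m a =>
    ⟨OneFlowCategory.graph_isSpecial s f m a, ?_⟩,
    fun φ _ m => OneFlowCategory.sq_mem_cocycles s f hf m, fun φ hφ m n =>
      OneFlowCategory.cls_eq_of_add s (OneFlowCategory.add_two_eq k) _ _
        (OneFlowCategory.sq_add_sq_mem s f m n),
    OneFlowCategory.steenrodSq s f hf k,
    fun φ hφ m => OneFlowCategory.steenrodSq_cls s f hf φ hφ m, fun Sq hSq => ?_⟩
  · have : Finite (OneFlowCategory.graph s f m a).V :=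
      inferInstanceAs (Finite (OneFlowCategory.Vert φ a))
    exact (OneFlowCategory.graph_isMatched s f m a).bdry_eq_empty
  -- Uniqueness holds because every class has a cocycle representative and every cocycle has a
  -- matching, so all values are prescribed.
  · refine LinearMap.ext fun z => ?_
    obtain ⟨⟨φ, hφ⟩, rfl⟩ := Submodule.Quotient.mk_surjective _ z
    obtain ⟨m⟩ := OneFlowCategory.nonempty_boundaryMatching s hφ
    exact (hSq φ hφ m).trans (OneFlowCategory.steenrodSq_cls s f hf φ hφ m).symm
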